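/- **Setting.** Let $d,T\ge 1$ be integers, $\beta,c\in(0,1)$, $B>0$, $\eta\ge 1$. Write $\|\cdot\|$ for the Euclidean norm on $\mathbb{R}^d$, $\mathcal{B}(1)$ for the unit ball, $\|v\|_A=\sqrt{v^\top A v}$, and $\lambda(x,f)=\|\nabla f(x)\|_{(\nabla^2 f(x))^{-1}}$ for the Newton decrement. Let $g_1,\dots,g_T\in\mathbb{R}^d$ satisfy $\|g_t\|\le B$ (in the algorithm $g_t$ is a subgradient at $w_t$ of the $t$-th loss; it may depend on the past). Put $\Psi(x)=-\eta d\ln(1-\|x\|^2)$ and $$\Phi_t(x)=\Psi(x)+\frac{d+B^2\eta}{2}\|x\|^2+\frac{\beta}{2}\sum_{s=1}^{t-1}\langle g_s,x-w_s\rangle^2+x^\top\sum_{s=1}^{t-1}g_s .$$ **Algorithm (OQNS).** Let $m=\Big\lceil-\log_c\Big(\frac{12(4+32/\eta^2)^2(2\eta d+B^2\eta+(B+2\beta B^2)T)^2T}{1-c}\Big)\Big\rceil$ and $u_1=w_1=0$ (and $w_0=0$ by convention). For $t=1,\dots,T$ set $$A_t=\Big(\tfrac{2\eta d}{1-\|u_t\|^2}I+(d+\eta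 B^2)I+\beta\sum_{s=1}^t g_sg_s^\top\Big)^{-1},\qquad H_t=\Big(A_t^{-1}+\tfrac{4\eta d\,w_tw_t^\top}{(1-\|w_t\|^2)^2}\Big)^{-1},$$ $$\gamma_t=\tfrac{2\eta d}{1-\|u_t\|^2}-\tfrac{2\eta d}{1-\|w_t\|^2},\qquad w_{t+1}=w_t-\sum_{k=1}^{m+1}\gamma_t^{k-1}H_t^k\,\nabla\Phi_{t+1}(w_t).$$ Then set $u_{t+1}=u_t$ if $\big|\|w_{t+1}\|^2-\|u_t\|^2\big|\le c\,\sigma_t$, and $u_{t+1}=w_{t+1}$ otherwise. Here, throughout the run, either $\sigma_t=1-\|w_{t+1}\|^2$ (with any $c\in(0,1)$), or $\sigma_t=1-\|u_t\|^2$, in which case it is assumed in addition that $c\le 1/3$. Let $x_t\in\operatorname{argmin}_{x\in\mathcal{B}(1)}\Phi_t(x)$ be the FTRL iterates, where $\Phi_t=+\infty$ on the unit sphere. **Lemma (Master Lemma).** For both versions of the algorithm: I) $w_t\in\operatorname{int}\mathcal{B}(1)$ for all $1\le t\le T+1$. II) For all $1\le t\le T+1$, $$\frac{\sqrt{\eta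 d}}{4}\Big(\|w_t-x_t\|_{\nabla^2\Phi_t(w_t)}-\frac{2}{T}\Big)\le\frac{\sqrt{\eta d}}{2}\Big(\lambda(w_t,\Phi_t)-\frac1T\Big)\le\lambda(w_{t-1},\Phi_t)^2\le\frac4\eta .$$ Further, $$\sum_{t=1}^T\|w_t-x_t\|_{\nabla^2\Phi_t(w_t)}\le 1+\frac{16\sqrt d}{3\beta\sqrt\eta}\ln\Big(d+\frac{B^2T}{d}\Big),$$ $$\sum_{t=1}^T\|w_t-w_{t-1}\|^2_{\nabla^2\Psi(w_t)}+\sum_{t=1}^T\|w_t-w_{t-1}\|^2_{\nabla^2\Psi(w_{t-1})}\le\frac{8d\ln(d+B^2T/d)}{\beta}.$$ -/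

import Mathlib

namespace OQNS

noncomputable section

/-- Euclidean space `ℝᵈ`. -/
abbrev E (d : ℕ) : Type := EuclideanSpace ℝ (Fin d)

/-- The Hessian `∇²f(x)`, as a linear operator: the derivative of the gradient. -/
def hessian {d : ℕ} (f : E d → ℝ) (x : E d) : E d →L[ℝ] E d :=
  fderiv ℝ (gradient f) x

/-- The norm `‖v‖_A = √⟨v, A v⟩` induced by a positive (semi)definite operator `A`. -/
def normIn {d : ℕ} (A : E d →L[ℝ] E d) (v : E d) : ℝ :=
  √(inner ℝ v (A v))

/-- The Newton decrement `λ(x, f) = ‖∇f(x)‖` in the norm of the inverse Hessian of `f` at `x`. -/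
def newtonDecrement {d : ℕ} (x : E d) (f : E d → ℝ) : ℝ :=
  normIn (Ring.inverse (hessian f x)) (gradient f x)

/-- The outer product `v vᵀ`, i.e. the operator `x ↦ ⟨v, x⟩ v`. -/
def outer {d : ℕ} (v : E d) : E d →L[ℝ] E d :=
  InnerProductSpace.rankOne ℝ v v

/-- The barrier `Ψ(x) = -η d log (1 - ‖x‖²)` of the unit ball (only used inside the open ball). -/
def Psi (d : ℕ) (η : ℝ) (x : E d) : ℝ :=
  -η * d * Real.log (1 - ‖x‖ ^ 2)

/-- The potential `Φ_t`, built from the vectors `g_1, …, g_{t-1}` and the points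
`w_1, …, w_{t-1}`. -/
def Phi (d : ℕ) (η B β : ℝ) (g w : ℕ → E d) (t : ℕ) (x : E d) : ℝ :=
  Psi d η x + (d + B ^ 2 * η) / 2 * ‖x‖ ^ 2
    + β / 2 * ∑ s ∈ Finset.Ico 1 t, (inner ℝ (g s) (x - w s)) ^ 2
    + inner ℝ x (∑ s ∈ Finset.Ico 1 t, g s)

/-- The Taylor order `m` of the algorithm (`Real.logb c` is the logarithm in base `c`). -/
def taylorOrder (d : ℕ) (η B β c : ℝ) (T : ℕ) : ℕ :=
  ⌈-Real.logb c (12 * (4 + 32 / η ^ 2) ^ 2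
      * (2 * η * d + B ^ 2 * η + (B + 2 * β * B ^ 2) * T) ^ 2 * T / (1 - c))⌉₊

/-- `A_t = (2ηd/(1-‖u_t‖²) I + (d + ηB²) I + β ∑_{s ≤ t} g_s g_sᵀ)⁻¹`. -/
def opA (d : ℕ) (η B β : ℝ) (g u : ℕ → E d) (t : ℕ) : E d →L[ℝ] E d :=
  Ring.inverse ((2 * η * d / (1 - ‖u t‖ ^ 2)) • (1 : E d →L[ℝ] E d)
    + (d + η * B ^ 2) • (1 : E d →L[ℝ] E d)
    + β • ∑ s ∈ Finset.Icc 1 t, outer (g s))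

/-- `H_t = (A_t⁻¹ + 4ηd/(1-‖w_t‖²)² w_t w_tᵀ)⁻¹`. -/
def opH (d : ℕ) (η B β : ℝ) (g u w : ℕ → E d) (t : ℕ) : E d →L[ℝ] E d :=
  Ring.inverse (Ring.inverse (opA d η B β g u t)
    + (4 * η * d / (1 - ‖w t‖ ^ 2) ^ 2) • outer (w t))

/-- `γ_t = 2ηd/(1-‖u_t‖²) - 2ηd/(1-‖w_t‖²)`. -/
def gam (d : ℕ) (η : ℝ) (u w : ℕ → E d) (t : ℕ) : ℝ :=
  2 * η * d / (1 - ‖u t‖ ^ 2) - 2 * η * d / (1 - ‖w t‖ ^ 2)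

/-- `H̃_t = ∑_{k=1}^{m+1} γ_t^{k-1} H_t^k`. -/
def opHtilde (d : ℕ) (η B β : ℝ) (m : ℕ) (g u w : ℕ → E d) (t : ℕ) : E d →L[ℝ] E d :=
  ∑ k ∈ Finset.Icc 1 (m + 1), (gam d η u w t) ^ (k - 1) • (opH d η B β g u w t) ^ k

/-- The two variants of the test that decides whether the landmark is kept: the change of the
squared norm is compared with `1 - ‖u_t‖²` (the old landmark) or with `1 - ‖w_{t+1}‖²`
(the new iterate). -/
inductive LandmarkRule where
  | oldLandmark
  | newIterate

/-- The quantity `1 - ‖·‖²` that the landmark test uses, with `u` the current landmark and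
`w'` the new iterate. -/
def LandmarkRule.scale {d : ℕ} : LandmarkRule → E d → E d → ℝ
  | .oldLandmark, u, _ => 1 - ‖u‖ ^ 2
  | .newIterate, _, w' => 1 - ‖w'‖ ^ 2

open Classical in
/-- `w_1, …, w_{T+1}` and `u_1, …, u_{T+1}` are the iterates and the landmarks of OQNS with
parameters `B, η, β, c`, horizon `T` and observed vectors `g_1, …, g_T`; by convention `w_0 = 0`.
The recursion determines the iterates and landmarks; each `g_t` may depend on everything that was
played up to round `t`. -/
structure IsRun (d : ℕ) (η B β c : ℝ) (T : ℕ) (rule : LandmarkRule) (g u w : ℕ → E d) : Prop where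
  w_zero : w 0 = 0
  w_one : w 1 = 0
  u_one : u 1 = 0
  w_succ : ∀ t ∈ Finset.Icc 1 T,
    w (t + 1) = w t - opHtilde d η B β (taylorOrder d η B β c T) g u w t
      (gradient (Phi d η B β g w (t + 1)) (w t))
  u_succ : ∀ t ∈ Finset.Icc 1 T,
    u (t + 1) = if |‖w (t + 1)‖ ^ 2 - ‖u t‖ ^ 2| ≤ c * rule.scale (u t) (w (t + 1))
      then u t else w (t + 1)

/-- `x` is the FTRL iterate of round `t`: a minimiser of `Φ_t` over the unit ball. As `Φ_t` is
`+∞` on the unit sphere, this is a minimiser over the open ball. -/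
def IsFTRL (d : ℕ) (η B β : ℝ) (g w : ℕ → E d) (t : ℕ) (x : E d) : Prop :=
  x ∈ Metric.ball (0 : E d) 1 ∧ IsMinOn (Phi d η B β g w t) (Metric.ball (0 : E d) 1) x

end

end OQNS

/-! Each round is one inexact Newton step for $\Phi_{t+1}$ from $w_t$, and everything follows from
control of the local length of the step $\Delta_t=w_{t+1}-w_t$.

Inexactness. With $S=H_t^{-1}$ one has $S-\gamma_t I=\nabla^2\Phi_{t+1}(w_t)$, and the landmark rule
keeps $|\gamma_t|$ below $\sqrt c$ times a lower bound for the spectrum of $S$. The truncated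
Neumann series therefore inverts the Hessian up to a relative error $\varepsilon$
(`abs_inner_residual_le`), and the choice of $m$ makes $\varepsilon\le 1/300$ and $\varepsilon^2\eta
dT\le 1/3000$ (`neumannError_bounds`).

Quadratic convergence. After a Newton step only the second-order remainder of the barrier gradient
is left, up to the residual. Its dual local norm at the new point is at most the squared local
length of the step (`abs_inner_gradRem_le`). Revealing $g_t$ adds at most $1/\sqrt\eta$ to the
decrement. Strong monotonicity of the barrier gradient turns decrements into distances to the
minimiser.

Sums. Testing the Newton equation with $\Delta_t$ itself bounds the energy of the step by $-\langle
g_t,\Delta_t\rangle$, plus the influence of the remainder left by the previous step, plus an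
$\varepsilon$-term. The linear part is paid for by the elliptical potential lemma: $\langle
g_t,\Delta_t\rangle^2\le q_t\cdot(\text{curvature along }\Delta_t)$ with $\sum q_t\le\frac
d\beta\ln(1+\beta B^2T/d)$. The influence of the previous step goes into a telescoping potential.

Two regimes. If $\eta^2d\ge 2$, the squared barrier length of every step is at most $0.32$, by
induction (`StepData.P_le`), and estimates in any dimension suffice. Otherwise $\eta\ge 1$ forces
$d=1$ and $\eta^2<2$, where steps can be longer. There the two walls $\pm1$ are treated explicitly:
the gradient divided by $\eta$ stays below $0.65\,B/\eta$, and away from the centre it hardly pushes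
outward (`ScalarStep.inv`). The squared decrement then serves as potential. Both regimes produce a
`StableRun`, from which the stated bounds are read off. -/

namespace OQNS

/-! ### Local geometry of the barrier $-\log(1-\|x\|^2)$. -/

section BallBarrier

theorem one_sub_norm_sq_pos {V : Type*} [NormedAddCommGroup V] {x : V} (hx : ‖x‖ < 1) :
    0 < 1 - ‖x‖ ^ 2 := by
  nlinarith [norm_nonneg x]

theorem norm_lt_one_of_one_sub_pos {V : Type*} [NormedAddCommGroup V] {x : V}
    (hx : 0 < 1 - ‖x‖ ^ 2) : ‖x‖ < 1 := by
  nlinarith [norm_nonneg x]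

variable {V : Type*} [NormedAddCommGroup V] [InnerProductSpace ℝ V]

/-- The Hessian form of `-log (1 - ‖x‖²)` at `x`, evaluated at `v`. -/
noncomputable def ballHess (x v : V) : ℝ :=
  2 * ‖v‖ ^ 2 / (1 - ‖x‖ ^ 2) + 4 * (inner ℝ x v) ^ 2 / (1 - ‖x‖ ^ 2) ^ 2

/-- The gradient of `-log (1 - ‖x‖²)`. -/
noncomputable def ballGrad (x : V) : V := (2 / (1 - ‖x‖ ^ 2)) • x

/-- The Hessian of `-log (1 - ‖x‖²)` at `x`, applied to `v`. -/
noncomputable def ballHessApply (x v : V) : V :=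
  (2 / (1 - ‖x‖ ^ 2)) • v + (4 * inner ℝ x v / (1 - ‖x‖ ^ 2) ^ 2) • x

/-- The relative radial displacement of the step `v` from `x`. -/
noncomputable def radialPart (x v : V) : ℝ := 2 * inner ℝ x v / (1 - ‖x‖ ^ 2)

/-- The relative squared length of the step `v` from `x`. -/
noncomputable def lengthPart {V : Type*} [NormedAddCommGroup V] (x v : V) : ℝ := ‖v‖ ^ 2 / (1 - ‖x‖ ^ 2)

theorem lengthPart_nonneg {V : Type*} [NormedAddCommGroup V] {x : V} (hx : ‖x‖ < 1) (v : V) : 0 ≤ lengthPart x v :=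
  div_nonneg (sq_nonneg _) (one_sub_norm_sq_pos hx).le

theorem ballHess_eq (x v : V) : ballHess x v = radialPart x v ^ 2 + 2 * lengthPart x v := by
  unfold ballHess radialPart lengthPart
  rw [div_pow]; ring

theorem ballHess_nonneg {x : V} (hx : ‖x‖ < 1) (v : V) : 0 ≤ ballHess x v := by
  rw [ballHess_eq]
  have := lengthPart_nonneg hx v
  positivity

theorem inner_ballHessApply (x v z : V) :
    inner ℝ z (ballHessApply x v) = 2 * inner ℝ v z / (1 - ‖x‖ ^ 2)
      + 4 * inner ℝ x v * inner ℝ x z / (1 - ‖x‖ ^ 2) ^ 2 := by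
  simp only [ballHessApply, inner_add_right, inner_smul_right, real_inner_comm z x,
    real_inner_comm z v]
  ring

theorem inner_ballHessApply_self (x v : V) : inner ℝ v (ballHessApply x v) = ballHess x v := by
  rw [inner_ballHessApply, real_inner_self_eq_norm_sq, ballHess]; ring

/-- The distance to the sphere changes by the exact factor $1-a-r$, with $a$ the radial and $r$ the
length part. This turns the estimates below into polynomial inequalities in $a$ and $r$, where the
squared local length is $a^2+2r$. -/
theorem one_sub_norm_add_sq {x : V} (hx : ‖x‖ < 1) (v : V) :
    1 - ‖x + v‖ ^ 2 = (1 - ‖x‖ ^ 2) * (1 - radialPart x v - lengthPart x v) := by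
  have := (one_sub_norm_sq_pos hx).ne'
  rw [norm_add_sq_real, radialPart, lengthPart]
  field_simp
  ring

theorem abs_radialPart_le {x : V} (hx : ‖x‖ < 1) (v : V) :
    |radialPart x v| ≤ √(ballHess x v) := by
  apply Real.abs_le_sqrt
  rw [ballHess_eq]
  linarith [lengthPart_nonneg hx v]

/-- A step of local length at most one moves the barrier argument by at most its length. -/
theorem radialPart_add_lengthPart_le {x : V} (hx : ‖x‖ < 1) {v : V} (hv : ballHess x v ≤ 1) :
    radialPart x v + lengthPart x v ≤ √(ballHess x v) := by
  have hr := lengthPart_nonneg hx v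
  have h1 : √(ballHess x v) ≤ 1 := Real.sqrt_le_one.mpr hv
  have h0 := Real.sqrt_nonneg (ballHess x v)
  have hs := Real.sq_sqrt (ballHess_nonneg hx v)
  have ha := abs_le.mp (abs_radialPart_le hx v)
  have e := ballHess_eq x v
  set θ := √(ballHess x v)
  -- Substituting $r=(\theta^2-a^2)/2$ gives $\theta-a-r=\tfrac12(\theta-a)(2-\theta-a)$.
  nlinarith [mul_nonneg (sub_nonneg.mpr ha.2) (by linarith : 0 ≤ 2 - θ - radialPart x v)]

theorem norm_add_lt_one {x : V} (hx : ‖x‖ < 1) {v : V} (hv : ballHess x v < 1) :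
    ‖x + v‖ < 1 := by
  apply norm_lt_one_of_one_sub_pos
  rw [one_sub_norm_add_sq hx]
  have h1 : √(ballHess x v) < 1 := by rwa [Real.sqrt_lt' one_pos, one_pow]
  have := radialPart_add_lengthPart_le hx hv.le
  exact mul_pos (one_sub_norm_sq_pos hx) (by linarith)

theorem one_sub_parts_pos {x v : V} (hx : ‖x‖ < 1) (hxv : ‖x + v‖ < 1) :
    0 < 1 - radialPart x v - lengthPart x v := by
  have := one_sub_norm_sq_pos hxv
  rw [one_sub_norm_add_sq hx] at this
  exact (mul_pos_iff_of_pos_left (one_sub_norm_sq_pos hx)).mp this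

/-- The second-order remainder of the barrier gradient. -/
noncomputable def gradRem (x v : V) : V := ballGrad (x + v) - ballGrad x - ballHessApply x v

theorem gradRem_eq {x v : V} (hx : ‖x‖ < 1) (hxv : ‖x + v‖ < 1) :
    gradRem x v = (2 / (1 - ‖x‖ ^ 2)) •
      (((radialPart x v ^ 2 + radialPart x v * lengthPart x v + lengthPart x v)
        / (1 - radialPart x v - lengthPart x v)) • (x + v) + radialPart x v • v) := by
  have hy := (one_sub_norm_sq_pos hx).ne'
  have hz := (one_sub_parts_pos hx hxv).ne'
  have h4 : 4 * inner ℝ x v / (1 - ‖x‖ ^ 2) ^ 2 = 2 / (1 - ‖x‖ ^ 2) * radialPart x v := by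
    rw [radialPart]; field_simp; ring
  rw [gradRem, ballGrad, ballGrad, ballHessApply, one_sub_norm_add_sq hx, h4]
  set y := 1 - ‖x‖ ^ 2
  set a := radialPart x v
  set r := lengthPart x v
  match_scalars
  · field_simp
    ring
  · field_simp
    ring

/-- The first term sees only the radial part of $z$ at the new point and has a nonnegative
coefficient for short steps; the second is the tangential coupling. A sign condition on $z$ can thus
discard the first term. -/
theorem inner_gradRem {x v : V} (hx : ‖x‖ < 1) (hxv : ‖x + v‖ < 1) (z : V) :
    inner ℝ (gradRem x v) z =
      (radialPart x v ^ 2 + radialPart x v * lengthPart x v + lengthPart x v)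
        * radialPart (x + v) z + radialPart x v * (2 * inner ℝ v z / (1 - ‖x‖ ^ 2)) := by
  have hy := (one_sub_norm_sq_pos hx).ne'
  have hz := (one_sub_parts_pos hx hxv).ne'
  rw [gradRem_eq hx hxv, radialPart.eq_1 (x + v) z, one_sub_norm_add_sq hx]
  simp only [inner_smul_left, inner_add_left (_ • _), RCLike.conj_to_real]
  field_simp

/-- Cauchy–Schwarz, with each factor normalised at its own point; the change of normalisation costs
$1-a-r$. -/
theorem sq_two_inner_div_le {x v : V} (hx : ‖x‖ < 1) (hxv : ‖x + v‖ < 1) (z : V) :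
    (2 * inner ℝ v z / (1 - ‖x‖ ^ 2)) ^ 2
      ≤ (2 * lengthPart x v) * (1 - radialPart x v - lengthPart x v)
        * (2 * lengthPart (x + v) z) := by
  have hy := one_sub_norm_sq_pos hx
  have hz := one_sub_parts_pos hx hxv
  have hc : (inner ℝ v z) ^ 2 ≤ ‖v‖ ^ 2 * ‖z‖ ^ 2 := by
    rw [← mul_pow, ← sq_abs]
    exact pow_le_pow_left₀ (abs_nonneg _) (abs_real_inner_le_norm v z) 2
  have h1 : (2 * lengthPart x v) * (1 - radialPart x v - lengthPart x v)
        * (2 * lengthPart (x + v) z) = 4 * (‖v‖ ^ 2 * ‖z‖ ^ 2) / (1 - ‖x‖ ^ 2) ^ 2 := by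
    rw [lengthPart.eq_1 (x + v) z, one_sub_norm_add_sq hx]
    field_simp
    rw [lengthPart]
    field_simp
    ring
  rw [h1, div_pow, mul_pow]
  gcongr
  norm_num

/-- The remainder, in the dual local norm at the new point, is at most the squared local length
of the step. -/
theorem abs_inner_gradRem_le {x v : V} (hx : ‖x‖ < 1) (hxv : ‖x + v‖ < 1)
    (hv : ballHess x v ≤ 1) (z : V) :
    |inner ℝ (gradRem x v) z| ≤ ballHess x v * √(ballHess (x + v) z) := by
  have hr := lengthPart_nonneg hx v
  have hrz := lengthPart_nonneg hxv z
  have hz := one_sub_parts_pos hx hxv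
  have hq := sq_two_inner_div_le hx hxv z
  have ha : |radialPart x v| ≤ 1 :=
    (abs_radialPart_le hx v).trans (Real.sqrt_le_one.mpr hv)
  obtain ⟨ha1, ha2⟩ := abs_le.mp ha
  have hH := ballHess_nonneg hx v
  rw [← Real.sqrt_sq hH, ← Real.sqrt_mul (sq_nonneg _)]
  apply Real.abs_le_sqrt
  rw [inner_gradRem hx hxv, ballHess_eq, ballHess_eq (x + v)]
  set a := radialPart x v
  set r := lengthPart x v
  set A := radialPart (x + v) z
  set s := lengthPart (x + v) z
  set q := 2 * inner ℝ v z / (1 - ‖x‖ ^ 2)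
  set n := a ^ 2 + a * r + r
  -- Weighted Cauchy–Schwarz with weight $c=2r(1-a-r)$, using $q^2\le 2cs$. When $c=0$ the same
  -- bound forces $q=0$.
  have h1 : (n * A + a * q) ^ 2 ≤ (n ^ 2 + 2 * a ^ 2 * r * (1 - a - r)) * (A ^ 2 + 2 * s) := by
    by_cases h0 : 2 * r * (1 - a - r) = 0
    · have : q = 0 := by
        have : q ^ 2 ≤ 0 := by rw [h0] at hq; simpa using hq
        exact pow_eq_zero_iff two_ne_zero |>.mp (le_antisymm this (sq_nonneg _))
      rw [this]
      have : 2 * a ^ 2 * r * (1 - a - r) = 0 := by linear_combination a ^ 2 * h0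
      rw [this]
      nlinarith [mul_nonneg (sq_nonneg n) hrz]
    · have hB : 0 < 2 * r * (1 - a - r) := lt_of_le_of_ne (by positivity) (Ne.symm h0)
      set c := 2 * r * (1 - a - r)
      have h2 : 2 * (n * A) * (a * q) ≤ a ^ 2 * c * A ^ 2 + n ^ 2 * (q ^ 2 / c) := by
        have : 0 ≤ (a * c * A - n * q) ^ 2 / c := by positivity
        have e : (a * c * A - n * q) ^ 2 / c
            = a ^ 2 * c * A ^ 2 + n ^ 2 * (q ^ 2 / c) - 2 * (n * A) * (a * q) := by
          field_simp
          ring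
        linarith
      have h3 : q ^ 2 / c ≤ 2 * s := by rw [div_le_iff₀ hB]; linarith
      have h4 : n ^ 2 * (q ^ 2 / c) ≤ n ^ 2 * (2 * s) := by gcongr
      have h5 : a ^ 2 * q ^ 2 ≤ a ^ 2 * (c * (2 * s)) := by gcongr
      have e : 2 * a ^ 2 * r * (1 - a - r) = a ^ 2 * c := by ring
      rw [e]
      nlinarith
  refine h1.trans (mul_le_mul_of_nonneg_right ?_ (by positivity))
  have : (1 + a) ^ 2 ≤ 4 := by nlinarith
  nlinarith [mul_nonneg (sq_nonneg r) (sub_nonneg.mpr this), mul_nonneg (sq_nonneg a) (sq_nonneg r)]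

/-- If the next step does not point inwards, the remainder helps it only through its
tangential part. -/
theorem neg_inner_gradRem_le {x v : V} (hx : ‖x‖ < 1) (hxv : ‖x + v‖ < 1)
    (hv : ballHess x v ≤ 0.5) {z : V} (hz : 0 ≤ radialPart (x + v) z) :
    -inner ℝ (gradRem x v) z ≤ 0.66 * ballHess x v * √(ballHess (x + v) z) := by
  have hr := lengthPart_nonneg hx v
  have hrz := lengthPart_nonneg hxv z
  have hz' := one_sub_parts_pos hx hxv
  have hq := sq_two_inner_div_le hx hxv z
  have hH := ballHess_nonneg hx v
  have hab := abs_radialPart_le hx v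
  have hsq : √(ballHess x v) ≤ 0.7072 := by
    rw [Real.sqrt_le_left (by norm_num)]; linarith [hv]
  obtain ⟨ha1, ha2⟩ := abs_le.mp (hab.trans hsq)
  have e := ballHess_eq x v
  rw [inner_gradRem hx hxv]
  set a := radialPart x v
  set r := lengthPart x v
  set A := radialPart (x + v) z
  set q := 2 * inner ℝ v z / (1 - ‖x‖ ^ 2)
  have h0 : 0 ≤ (a ^ 2 + a * r + r) * A := mul_nonneg (by nlinarith) hz
  have h1 : |a * q| ≤ 0.66 * ballHess x v * √(ballHess (x + v) z) := by
    rw [← Real.sqrt_sq (by positivity : 0 ≤ 0.66 * ballHess x v), ← Real.sqrt_mul (sq_nonneg _)]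
    apply Real.abs_le_sqrt
    rw [ballHess_eq (x + v)]
    calc (a * q) ^ 2 = a ^ 2 * q ^ 2 := by ring
      _ ≤ a ^ 2 * (2 * r * (1 - a - r) * (2 * lengthPart (x + v) z)) := by gcongr
      _ = (a ^ 2 * (2 * r) * (1 - a - r)) * (2 * lengthPart (x + v) z) := by ring
      _ ≤ (0.66 * ballHess x v) ^ 2 * (2 * lengthPart (x + v) z) := by
        refine mul_le_mul_of_nonneg_right ?_ (by positivity)
        -- AM–GM gives the factor $1/4$. With $1-a-r\le 1.7072$ the constant is
        -- $\sqrt{1.7072/4}<0.66$.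
        have h2 : a ^ 2 * (2 * r) ≤ (ballHess x v) ^ 2 / 4 := by
          rw [e]; nlinarith [sq_nonneg (a ^ 2 - 2 * r)]
        have h3 : a ^ 2 * (2 * r) * (1 - a - r) ≤ (ballHess x v) ^ 2 / 4 * 1.7072 :=
          mul_le_mul h2 (by linarith) hz'.le (by positivity)
        nlinarith [sq_nonneg (ballHess x v)]
      _ ≤ _ := by
        refine mul_le_mul_of_nonneg_left ?_ (sq_nonneg _)
        nlinarith [sq_nonneg A]
  linarith [neg_abs_le (a * q)]

/-- Local norms at nearby points are comparable. -/
theorem ballHess_le_of_step {x v : V} (hx : ‖x‖ < 1) (hxv : ‖x + v‖ < 1)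
    (hv : ballHess x v ≤ 1) (z : V) :
    ballHess x z ≤ 2 * (1 + √(ballHess x v)) ^ 2 * ballHess (x + v) z := by
  have hr := lengthPart_nonneg hx v
  have hrz := lengthPart_nonneg hxv z
  have hy := one_sub_norm_sq_pos hx
  have hz' := one_sub_parts_pos hx hxv
  have hq := sq_two_inner_div_le hx hxv z
  have hab := abs_radialPart_le hx v
  have hs := Real.sq_sqrt (ballHess_nonneg hx v)
  have hs0 := Real.sqrt_nonneg (ballHess x v)
  have hs1 : √(ballHess x v) ≤ 1 := Real.sqrt_le_one.mpr hv
  have e := ballHess_eq x v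
  have h1 : lengthPart x z = (1 - radialPart x v - lengthPart x v) * lengthPart (x + v) z := by
    rw [lengthPart.eq_1 (x + v) z, one_sub_norm_add_sq hx, lengthPart.eq_1 x z]
    field_simp
  have h2 : radialPart x z = (1 - radialPart x v - lengthPart x v) * radialPart (x + v) z
      - 2 * inner ℝ v z / (1 - ‖x‖ ^ 2) := by
    rw [radialPart.eq_1 (x + v) z, one_sub_norm_add_sq hx, radialPart.eq_1 x z, inner_add_left]
    field_simp
    ring
  rw [ballHess_eq x z, ballHess_eq (x + v), h1, h2]
  set a := radialPart x v
  set r := lengthPart x v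
  set A := radialPart (x + v) z
  set s := lengthPart (x + v) z
  set q := 2 * inner ℝ v z / (1 - ‖x‖ ^ 2)
  set θ := √(ballHess x v)
  obtain ⟨ha1, ha2⟩ := abs_le.mp hab
  have hc : 1 - a - r ≤ 1 + θ := by linarith
  have hc2 : (1 - a - r) ^ 2 ≤ (1 + θ) ^ 2 := by gcongr
  have hA : ((1 - a - r) * A - q) ^ 2 ≤ 2 * (1 + θ) ^ 2 * A ^ 2 + 2 * q ^ 2 := by
    nlinarith [sq_nonneg ((1 - a - r) * A + q), mul_le_mul_of_nonneg_right hc2 (sq_nonneg A)]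
  have hB : (1 - a - r) * (1 + 4 * r) ≤ 2 * (1 + θ) ^ 2 := by
    have h4 : 2 * r ≤ θ ^ 2 := by rw [hs, e]; nlinarith [sq_nonneg a]
    have h5 : (1 - a - r) * (1 + 4 * r) ≤ (1 + θ) * (1 + 4 * r) := by gcongr
    nlinarith
  nlinarith [mul_le_mul_of_nonneg_right hB hrz]

theorem ballHess_add_self {x v : V} (hx : ‖x‖ < 1) (hxv : ‖x + v‖ < 1) :
    ballHess (x + v) v
      = (ballHess x v + 2 * lengthPart x v * (radialPart x v + lengthPart x v))
        / (1 - radialPart x v - lengthPart x v) ^ 2 := by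
  have hy := one_sub_norm_sq_pos hx
  have hz' := one_sub_parts_pos hx hxv
  have h1 : lengthPart (x + v) v = lengthPart x v / (1 - radialPart x v - lengthPart x v) := by
    rw [lengthPart.eq_1 (x + v) v, one_sub_norm_add_sq hx, lengthPart.eq_1 x v]
    field_simp
  have h2 : radialPart (x + v) v
      = (radialPart x v + 2 * lengthPart x v) / (1 - radialPart x v - lengthPart x v) := by
    rw [radialPart.eq_1 (x + v) v, one_sub_norm_add_sq hx, inner_add_left,
      real_inner_self_eq_norm_sq, div_mul_eq_div_div]
    congr 1
    rw [radialPart, lengthPart]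
    field_simp
  rw [ballHess_eq, ballHess_eq, h1, h2]
  field_simp
  ring

/-- The usual self-concordance bound: a step of local length $\theta<1$ has local length at most
$\theta/(1-\theta)$ when measured at its end point. -/
theorem ballHess_add_self_le {x v : V} (hx : ‖x‖ < 1) (hv : ballHess x v < 1) :
    ballHess (x + v) v ≤ ballHess x v / (1 - √(ballHess x v)) ^ 2 := by
  have hr := lengthPart_nonneg hx v
  have hxv := norm_add_lt_one hx hv
  have hz' := one_sub_parts_pos hx hxv
  have hab := (abs_le.mp (abs_radialPart_le hx v)).2
  have hs := Real.sq_sqrt (ballHess_nonneg hx v)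
  have hs0 := Real.sqrt_nonneg (ballHess x v)
  have hs1 : √(ballHess x v) < 1 := by rwa [Real.sqrt_lt' one_pos, one_pow]
  have hzle := radialPart_add_lengthPart_le hx hv.le
  have e := ballHess_eq x v
  rw [ballHess_add_self hx hxv]
  set a := radialPart x v
  set r := lengthPart x v
  set θ := √(ballHess x v)
  rw [← hs]
  rw [div_le_div_iff₀ (by positivity) (by have := sub_pos.mpr hs1; positivity)]
  have key : 2 * r * (a + r) * (1 - θ) ^ 2 ≤ θ ^ 2 * ((θ - (a + r)) * (2 - (a + r) - θ)) := by
    have hp : 0 ≤ θ ^ 2 * ((θ - (a + r)) * (2 - (a + r) - θ)) :=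
      mul_nonneg (sq_nonneg _) (mul_nonneg (by linarith) (by linarith))
    rcases le_or_gt (a + r) 0 with hz | hz
    · exact le_trans (mul_nonpos_of_nonpos_of_nonneg
        (mul_nonpos_of_nonneg_of_nonpos (by linarith) hz) (sq_nonneg _)) hp
    -- This is $r\le\theta(\theta-a)$, which holds because $2r=(\theta-a)(\theta+a)$ and
    -- $a\le\theta$.
    · have k1 : r * (1 - θ) ≤ θ * (θ - (a + r)) := by
        nlinarith [mul_nonneg (sub_nonneg.mpr hab) (sub_nonneg.mpr hab)]
      have k2 : r * (1 - θ) * (2 * (1 - θ)) ≤ θ * (θ - (a + r)) * (2 - (a + r) - θ) :=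
        mul_le_mul k1 (by linarith) (by linarith)
          (mul_nonneg hs0 (by linarith))
      calc 2 * r * (a + r) * (1 - θ) ^ 2 ≤ 2 * r * θ * (1 - θ) ^ 2 := by gcongr
        _ = θ * (r * (1 - θ) * (2 * (1 - θ))) := by ring
        _ ≤ θ * (θ * (θ - (a + r)) * (2 - (a + r) - θ)) := by gcongr
        _ = _ := by ring
  nlinarith

/-- For steps that point inwards the local length grows by a bounded factor. -/
theorem ballHess_add_self_le_of_inward {x v : V} (hx : ‖x‖ < 1) (hv : ballHess x v ≤ 0.32)
    (ha : radialPart x v ≤ 0) :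
    ballHess (x + v) v ≤ 1.65 * ballHess x v := by
  have hr := lengthPart_nonneg hx v
  have hxv := norm_add_lt_one hx (by linarith : ballHess x v < 1)
  have hz' := one_sub_parts_pos hx hxv
  have e := ballHess_eq x v
  rw [ballHess_add_self hx hxv]
  set a := radialPart x v
  set r := lengthPart x v
  have hH : 0 ≤ ballHess x v := ballHess_nonneg hx v
  have hr2 : r ≤ 0.16 := by nlinarith [sq_nonneg a]
  rw [div_le_iff₀ (by positivity)]
  have h1 : (0.84 : ℝ) ^ 2 ≤ (1 - a - r) ^ 2 := by
    apply pow_le_pow_left₀ (by norm_num); linarith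
  have h2 : 2 * r * (a + r) ≤ 0.16 * ballHess x v := by
    rw [e]; nlinarith [mul_nonneg hr (sub_nonneg.mpr hr2), mul_nonneg hr (neg_nonneg.mpr ha), sq_nonneg a]
  nlinarith

/-- Strong monotonicity of the barrier gradient. -/
theorem le_inner_ballGrad_sub {x v : V} (hx : ‖x‖ < 1) (hxv : ‖x + v‖ < 1) :
    ballHess x v / (1 + √(ballHess x v)) ≤ inner ℝ (ballGrad (x + v) - ballGrad x) v := by
  have hr := lengthPart_nonneg hx v
  have hy := one_sub_norm_sq_pos hx
  have hz' := one_sub_parts_pos hx hxv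
  have hab := abs_le.mp (abs_radialPart_le hx v)
  have hs := Real.sq_sqrt (ballHess_nonneg hx v)
  have hs0 := Real.sqrt_nonneg (ballHess x v)
  have e := ballHess_eq x v
  have h1 : inner ℝ (ballGrad (x + v) - ballGrad x) v
      = (ballHess x v + radialPart x v * lengthPart x v)
        / (1 - radialPart x v - lengthPart x v) := by
    have h2 : inner ℝ x v = (1 - ‖x‖ ^ 2) * radialPart x v / 2 := by
      rw [radialPart]; field_simp
    have h3 : ‖v‖ ^ 2 = (1 - ‖x‖ ^ 2) * lengthPart x v := by
      rw [lengthPart]; field_simp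
    rw [ballGrad, ballGrad, inner_sub_left, inner_smul_left, inner_smul_left, inner_add_left,
      real_inner_self_eq_norm_sq, h2, h3, one_sub_norm_add_sq hx, e]
    simp only [RCLike.conj_to_real]
    field_simp
    ring
  rw [h1, div_le_div_iff₀ (by positivity) hz']
  set a := radialPart x v
  set r := lengthPart x v
  set θ := √(ballHess x v)
  rw [← hs] at e ⊢
  have h5 : 0 ≤ θ + a := by linarith [hab.1]
  have h6 : 2 * r = (θ - a) * (θ + a) := by linear_combination -e
  have h7 : 0 ≤ θ - a := by linarith [hab.2]
  rcases le_or_gt 0 a with ha | ha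
  · nlinarith [mul_nonneg (mul_nonneg ha hr) hs0, mul_nonneg ha hr, mul_nonneg (sq_nonneg θ) ha,
      mul_nonneg (sq_nonneg θ) hr, mul_nonneg (sq_nonneg θ) hs0]
  · have k : r ≤ θ * (θ + a) := by nlinarith [mul_nonneg h5 h5]
    have k2 : r * θ ≤ θ * (θ + a) * θ := mul_le_mul_of_nonneg_right k hs0
    nlinarith [mul_nonneg (mul_nonneg hr h5) hs0, mul_nonneg hr h5]

end BallBarrier

end OQNS

namespace OQNS

/-! ### Gradients and Hessians of $\Psi$ and $\Phi_t$. -/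

section Derivatives

variable {d : ℕ}

/-- The Hessian operator of the barrier `Ψ`. -/
noncomputable def psiHess (d : ℕ) (η : ℝ) (x : E d) : E d →L[ℝ] E d :=
  (2 * η * d / (1 - ‖x‖ ^ 2)) • (1 : E d →L[ℝ] E d)
    + (4 * η * d / (1 - ‖x‖ ^ 2) ^ 2) • outer x

/-- The Hessian operator of the quadratic part of `Φ_t`. -/
noncomputable def quadHess (d : ℕ) (η B β : ℝ) (g : ℕ → E d) (t : ℕ) : E d →L[ℝ] E d :=
  (d + B ^ 2 * η) • (1 : E d →L[ℝ] E d) + β • ∑ s ∈ Finset.Ico 1 t, outer (g s)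

/-- The gradient of `Φ_t` inside the ball. -/
noncomputable def phiGrad (d : ℕ) (η B β : ℝ) (g w : ℕ → E d) (t : ℕ) (x : E d) : E d :=
  (η * d) • ballGrad x + (d + B ^ 2 * η) • x
    + β • ∑ s ∈ Finset.Ico 1 t, (inner ℝ (g s) (x - w s)) • g s + ∑ s ∈ Finset.Ico 1 t, g s

theorem outer_apply (v x : E d) : outer v x = inner ℝ v x • v := by
  simp [outer, InnerProductSpace.rankOne_apply]

theorem psiHess_apply (η : ℝ) (x v : E d) : psiHess d η x v = (η * d) • ballHessApply x v := by
  simp only [psiHess, ballHessApply, add_apply,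
    smul_apply, one_apply_eq_self, outer_apply]
  match_scalars <;> ring

theorem inner_psiHess_self (η : ℝ) (x v : E d) :
    inner ℝ v (psiHess d η x v) = η * d * ballHess x v := by
  rw [psiHess_apply, inner_smul_right, inner_ballHessApply_self]

theorem inner_quadHess (η B β : ℝ) (g : ℕ → E d) (t : ℕ) (v z : E d) :
    inner ℝ z (quadHess d η B β g t v) = (d + B ^ 2 * η) * inner ℝ z v
      + β * ∑ s ∈ Finset.Ico 1 t, inner ℝ (g s) v * inner ℝ (g s) z := by
  simp only [quadHess, add_apply, smul_apply,
    one_apply_eq_self, sum_apply, outer_apply, inner_add_right,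
    inner_smul_right, inner_sum]
  congr 2
  exact Finset.sum_congr rfl fun s _ => by rw [real_inner_comm z (g s)]

theorem inner_quadHess_self (η B β : ℝ) (g : ℕ → E d) (t : ℕ) (v : E d) :
    inner ℝ v (quadHess d η B β g t v) = (d + B ^ 2 * η) * ‖v‖ ^ 2
      + β * ∑ s ∈ Finset.Ico 1 t, inner ℝ (g s) v ^ 2 := by
  rw [inner_quadHess, real_inner_self_eq_norm_sq]
  simp only [sq]

theorem hasFDerivAt_one_sub_norm_sq (x : E d) :
    HasFDerivAt (fun x : E d => 1 - ‖x‖ ^ 2) (-(2 • innerSL ℝ x)) x := by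
  simpa using (hasStrictFDerivAt_norm_sq x).hasFDerivAt.const_sub 1

theorem hasFDerivAt_Psi (η : ℝ) {x : E d} (hx : ‖x‖ < 1) :
    HasFDerivAt (Psi d η) (innerSL ℝ ((η * d) • ballGrad x)) x := by
  have hy := (one_sub_norm_sq_pos hx).ne'
  have h := ((hasFDerivAt_one_sub_norm_sq x).log hy).const_mul (-η * d)
  refine h.congr_fderiv ?_
  ext v
  simp only [ballGrad, smul_apply, neg_apply, innerSL_apply_apply, inner_smul_left,
    RCLike.conj_to_real, smul_eq_mul, nsmul_eq_mul]
  push_cast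
  field_simp

theorem hasGradientAt_Psi (η : ℝ) {x : E d} (hx : ‖x‖ < 1) :
    HasGradientAt (Psi d η) ((η * d) • ballGrad x) x :=
  hasGradientAt_iff_hasFDerivAt.mpr (hasFDerivAt_Psi η hx)

theorem hasFDerivAt_inner_sub (v z x : E d) :
    HasFDerivAt (fun x : E d => inner ℝ v (x - z)) (innerSL ℝ v) x := by
  refine (((innerSL ℝ v).hasFDerivAt (x := x)).sub_const (innerSL ℝ v z)).congr_of_eventuallyEq ?_
  exact Filter.Eventually.of_forall fun y => by simp [inner_sub_right]

theorem hasGradientAt_Phi (η B β : ℝ) (g w : ℕ → E d) (t : ℕ) {x : E d} (hx : ‖x‖ < 1) :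
    HasGradientAt (Phi d η B β g w t) (phiGrad d η B β g w t x) x := by
  rw [hasGradientAt_iff_hasFDerivAt]
  have h1 := hasFDerivAt_Psi η hx
  have h2 := ((hasStrictFDerivAt_norm_sq x).hasFDerivAt).const_mul ((d + B ^ 2 * η) / 2)
  have h3 : HasFDerivAt (fun x : E d => ∑ s ∈ Finset.Ico 1 t, (inner ℝ (g s) (x - w s)) ^ 2)
      (∑ s ∈ Finset.Ico 1 t, (2 * inner ℝ (g s) (x - w s)) • innerSL ℝ (g s)) x := by
    refine HasFDerivAt.fun_sum fun s _ => ?_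
    have h := hasFDerivAt_inner_sub (g s) (w s) x
    simpa using h.pow 2
  have h4 : HasFDerivAt (fun x : E d => inner ℝ x (∑ s ∈ Finset.Ico 1 t, g s))
      (innerSL ℝ (∑ s ∈ Finset.Ico 1 t, g s)) x := by
    have := (innerSL ℝ (∑ s ∈ Finset.Ico 1 t, g s)).hasFDerivAt (x := x)
    refine this.congr_of_eventuallyEq (Filter.Eventually.of_forall fun y => ?_)
    exact real_inner_comm _ _
  refine (((h1.add h2).add (h3.const_mul (β / 2))).add h4).congr_fderiv ?_
  ext v
  simp only [phiGrad, add_apply, smul_apply,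
    sum_apply, innerSL_apply_apply, InnerProductSpace.toDual_apply_apply,
    inner_add_left, inner_smul_left, sum_inner, RCLike.conj_to_real, smul_eq_mul, nsmul_eq_mul]
  rw [Finset.mul_sum, Finset.mul_sum]
  have : ∀ s, β / 2 * (2 * inner ℝ (g s) (x - w s) * inner ℝ (g s) v)
      = β * (inner ℝ (g s) (x - w s) * inner ℝ (g s) v) := fun s => by ring
  simp only [this]
  push_cast
  ring

theorem hasFDerivAt_ballGrad {x : E d} (hx : ‖x‖ < 1) (η : ℝ) :
    HasFDerivAt (fun x : E d => (η * d) • ballGrad x) (psiHess d η x) x := by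
  have hy := (one_sub_norm_sq_pos hx).ne'
  have h1 : HasFDerivAt (fun x : E d => 2 / (1 - ‖x‖ ^ 2))
      ((4 / (1 - ‖x‖ ^ 2) ^ 2) • innerSL ℝ x) x := by
    have := ((hasDerivAt_inv hy).comp_hasFDerivAt x (hasFDerivAt_one_sub_norm_sq x)).const_mul 2
    refine (this.congr_fderiv ?_).congr_of_eventuallyEq
      (Filter.Eventually.of_forall fun y => by simp [div_eq_mul_inv])
    ext v
    simp
    field_simp
    ring
  have h2 := (h1.smul (hasFDerivAt_id x)).const_smul (η * d)
  refine h2.congr_fderiv ?_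
  ext1 v
  rw [psiHess_apply]
  simp only [add_apply, smul_apply,
    ContinuousLinearMap.smulRight_apply, ballHessApply, innerSL_apply_apply, id,
    ContinuousLinearMap.id_apply, smul_eq_mul]
  match_scalars <;> field_simp

theorem hasFDerivAt_phiGrad (η B β : ℝ) (g w : ℕ → E d) (t : ℕ) {x : E d} (hx : ‖x‖ < 1) :
    HasFDerivAt (phiGrad d η B β g w t) (psiHess d η x + quadHess d η B β g t) x := by
  have h1 := hasFDerivAt_ballGrad hx η
  have h0 : HasFDerivAt (fun y : E d => y) (ContinuousLinearMap.id ℝ (E d)) x := hasFDerivAt_id x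
  have h2 := h0.const_smul ((d : ℝ) + B ^ 2 * η)
  have h3 : HasFDerivAt (fun x : E d => ∑ s ∈ Finset.Ico 1 t, (inner ℝ (g s) (x - w s)) • g s)
      (∑ s ∈ Finset.Ico 1 t, outer (g s)) x := by
    refine HasFDerivAt.fun_sum fun s _ => ?_
    have h := hasFDerivAt_inner_sub (g s) (w s) x
    refine (h.smul_const (g s)).congr_fderiv ?_
    ext1 v
    simp [outer_apply]
  refine (((h1.add h2).add (h3.const_smul β)).add_const _).congr_fderiv ?_
  rw [quadHess, add_assoc]
  rfl

theorem eventually_norm_lt_one {x : E d} (hx : ‖x‖ < 1) : ∀ᶠ y in nhds x, ‖y‖ < 1 :=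
  continuous_norm.continuousAt.eventually_lt continuousAt_const hx

theorem hessian_Psi (η : ℝ) {x : E d} (hx : ‖x‖ < 1) : hessian (Psi d η) x = psiHess d η x := by
  rw [hessian]
  refine ((hasFDerivAt_ballGrad hx η).congr_of_eventuallyEq ?_).fderiv
  filter_upwards [eventually_norm_lt_one hx] with y hy
  exact (hasGradientAt_Psi η hy).gradient

theorem gradient_Phi (η B β : ℝ) (g w : ℕ → E d) (t : ℕ) {x : E d} (hx : ‖x‖ < 1) :
    gradient (Phi d η B β g w t) x = phiGrad d η B β g w t x :=
  (hasGradientAt_Phi η B β g w t hx).gradient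

theorem hessian_Phi (η B β : ℝ) (g w : ℕ → E d) (t : ℕ) {x : E d} (hx : ‖x‖ < 1) :
    hessian (Phi d η B β g w t) x = psiHess d η x + quadHess d η B β g t := by
  rw [hessian]
  refine ((hasFDerivAt_phiGrad η B β g w t hx).congr_of_eventuallyEq ?_).fderiv
  filter_upwards [eventually_norm_lt_one hx] with y hy
  exact gradient_Phi η B β g w t hy

end Derivatives

end OQNS

namespace OQNS

/-! ### Positive definite forms, dual norms and the truncated Neumann series. -/

section Forms

variable {d : ℕ}

/-- Symmetric positive definite operators. -/
structure PosForm (A : E d →L[ℝ] E d) : Prop where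
  symm : ∀ v z, inner ℝ v (A z) = inner ℝ z (A v)
  pos : ∀ v, v ≠ 0 → 0 < inner ℝ v (A v)

namespace PosForm

variable {A : E d →L[ℝ] E d}

theorem nonneg (hA : PosForm A) (v : E d) : 0 ≤ inner ℝ v (A v) := by
  rcases eq_or_ne v 0 with rfl | h
  · simp
  · exact (hA.pos v h).le

theorem of_coercive (hs : ∀ v z, inner ℝ v (A z) = inner ℝ z (A v)) {σ : ℝ} (hσ : 0 < σ)
    (h : ∀ v, σ * ‖v‖ ^ 2 ≤ inner ℝ v (A v)) : PosForm A :=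
  ⟨hs, fun v hv => lt_of_lt_of_le (mul_pos hσ (pow_pos (norm_pos_iff.mpr hv) 2)) (h v)⟩

theorem isUnit (hA : PosForm A) : IsUnit A := by
  have hi : Function.Injective A := by
    rw [injective_iff_map_eq_zero]
    intro v hv
    by_contra h
    have := hA.pos v h
    rw [hv, inner_zero_right] at this
    exact lt_irrefl _ this
  rw [ContinuousLinearMap.isUnit_iff_bijective]
  exact ⟨hi, (LinearMap.injective_iff_surjective (f := (A : E d →ₗ[ℝ] E d))).mp hi⟩

theorem apply_inverse (hA : PosForm A) (v : E d) : A (Ring.inverse A v) = v := by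
  have := Ring.mul_inverse_cancel A hA.isUnit
  rw [← mul_apply_eq_comp, this]; rfl

theorem inner_sq_le (hA : PosForm A) (v z : E d) :
    inner ℝ v (A z) ^ 2 ≤ inner ℝ v (A v) * inner ℝ z (A z) := by
  rcases eq_or_ne z 0 with rfl | hz
  · simp
  · have h := hA.nonneg (inner ℝ z (A z) • v - inner ℝ v (A z) • z)
    have hc := hA.pos z hz
    simp only [map_sub, map_smul, inner_sub_left, inner_sub_right, inner_smul_left,
      inner_smul_right, RCLike.conj_to_real, hA.symm z v] at h
    nlinarith

/-- Together with `normIn_inverse_le` this characterises the dual norm by duality, so that Newton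
decrements are estimated by testing the gradient against vectors instead of computing with the
inverse Hessian. -/
theorem inner_le_normIn_inverse (hA : PosForm A) (G v : E d) :
    inner ℝ G v ≤ normIn (Ring.inverse A) G * √(inner ℝ v (A v)) := by
  rw [normIn, ← Real.sqrt_mul' _ (hA.nonneg v)]
  apply Real.le_sqrt_of_sq_le
  have h := hA.inner_sq_le v (Ring.inverse A G)
  rw [hA.apply_inverse, real_inner_comm G (Ring.inverse A G), real_inner_comm G v] at h
  rwa [mul_comm]

theorem normIn_inverse_le (hA : PosForm A) {G : E d} {c : ℝ} (hc : 0 ≤ c)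
    (h : ∀ v, inner ℝ G v ≤ c * √(inner ℝ v (A v))) : normIn (Ring.inverse A) G ≤ c := by
  have h1 := h (Ring.inverse A G)
  rw [hA.apply_inverse, real_inner_comm G] at h1
  rw [normIn]
  have h0 := Real.sqrt_nonneg (inner ℝ G (Ring.inverse A G))
  have h2 : 0 ≤ inner ℝ G (Ring.inverse A G) := by
    have := hA.nonneg (Ring.inverse A G)
    rwa [hA.apply_inverse, real_inner_comm G] at this
  have h3 := Real.sq_sqrt h2
  rcases h0.eq_or_lt with h4 | h4
  · rw [← h4]; exact hc
  · nlinarith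

end PosForm

theorem inner_eq_sum_orthonormalBasis {n : ℕ} (b : OrthonormalBasis (Fin n) ℝ (E d)) (x y : E d) :
    inner ℝ x y = ∑ i, inner ℝ (b i) x * inner ℝ (b i) y := by
  rw [← b.sum_inner_mul_inner x y]
  exact Finset.sum_congr rfl fun i _ => by rw [real_inner_comm]

/-- The truncated Neumann series is an inexact Newton step: the residual is small relative to
the step, in the local norm. -/
theorem abs_inner_residual_le {S : E d →L[ℝ] E d} (hS : ∀ v z, inner ℝ v (S z) = inner ℝ z (S v))
    {σ γ r : ℝ} (hσ : 0 < σ) (hcoer : ∀ v, σ * ‖v‖ ^ 2 ≤ inner ℝ v (S v))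
    (hr0 : 0 ≤ r) (hr1 : r < 1) (hγ : |γ| ≤ r * σ) (m : ℕ) (G Δ v : E d)
    (hΔ : Δ = -(∑ k ∈ Finset.Icc 1 (m + 1), γ ^ (k - 1) • (Ring.inverse S) ^ k) G) :
    |inner ℝ (G + (S Δ - γ • Δ)) v| ≤ r ^ (m + 1) / (1 - r ^ (m + 1))
      * (√(inner ℝ Δ (S Δ - γ • Δ)) * √(inner ℝ v (S v - γ • v))) := by
  have hP : PosForm S := .of_coercive hS hσ hcoer
  have hsym : (S : E d →ₗ[ℝ] E d).IsSymmetric := fun x y => by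
    change inner ℝ (S x) y = inner ℝ x (S y)
    rw [real_inner_comm, hS]
  -- All operators involved are polynomials in $S$ and $S^{-1}$, so an eigenbasis of $S$ reduces the
  -- claim to scalars $s_i\ge\sigma$.
  let b := hsym.eigenvectorBasis (n := d) (by simp)
  let s : Fin d → ℝ := hsym.eigenvalues (n := d) (by simp)
  have hb : ∀ i, S (b i) = s i • b i := fun i => hsym.apply_eigenvectorBasis (by simp) i
  have hn : ∀ i, ‖b i‖ = 1 := b.orthonormal.1
  have hs : ∀ i, σ ≤ s i := fun i => by
    have := hcoer (b i)
    rw [hb, inner_smul_right, real_inner_self_eq_norm_sq, hn] at this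
    simpa using this
  have hspos : ∀ i, 0 < s i := fun i => hσ.trans_le (hs i)
  have hSc : ∀ i x, inner ℝ (b i) (S x) = s i * inner ℝ (b i) x := fun i x => by
    rw [hS, hb, inner_smul_right, real_inner_comm]
  have hHc : ∀ i x, inner ℝ (b i) (Ring.inverse S x) = (s i)⁻¹ * inner ℝ (b i) x := fun i x => by
    have := hSc i (Ring.inverse S x)
    rw [hP.apply_inverse] at this
    rw [this]
    field_simp [(hspos i).ne']
  have hHk : ∀ i k x, inner ℝ (b i) ((Ring.inverse S ^ k) x)
      = (s i)⁻¹ ^ k * inner ℝ (b i) x := fun i k => by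
    induction k with
    | zero => intro x; simp
    | succ k ih => intro x; rw [pow_succ, mul_apply_eq_comp, ih, hHc]; ring
  set ε := r ^ (m + 1) with hε
  have hε0 : 0 ≤ ε := pow_nonneg hr0 _
  have hε1 : ε < 1 := pow_lt_one₀ hr0 hr1 (by simp)
  have hq : ∀ i, 0 < s i - γ := fun i => by
    have h1 := le_abs_self γ
    have h2 := hs i
    nlinarith
  have hE : ∀ i, |(γ / s i) ^ (m + 1)| ≤ ε := fun i => by
    rw [abs_pow]
    apply pow_le_pow_left₀ (abs_nonneg _)
    rw [abs_div, abs_of_pos (hspos i), div_le_iff₀ (hspos i)]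
    exact hγ.trans (by gcongr; exact hs i)
  -- The geometric sum of ratio $\gamma/s_i$ leaves exactly the factor $1-(\gamma/s_i)^{m+1}$; the
  -- residual therefore has components $(\gamma/s_i)^{m+1}G_i$, with $|\gamma/s_i|\le r$.
  have hΔi : ∀ i, (s i - γ) * inner ℝ (b i) Δ
      = -(1 - (γ / s i) ^ (m + 1)) * inner ℝ (b i) G := fun i => by
    have hne := (hspos i).ne'
    have h1 : inner ℝ (b i) ((∑ k ∈ Finset.Icc 1 (m + 1), γ ^ (k - 1) • (Ring.inverse S) ^ k) G)
        = (s i)⁻¹ * (∑ j ∈ Finset.range (m + 1), (γ / s i) ^ j) * inner ℝ (b i) G := by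
      rw [sum_apply, inner_sum, Finset.mul_sum, Finset.sum_mul,
        ← Finset.Ico_add_one_right_eq_Icc, Finset.sum_Ico_eq_sum_range]
      refine Finset.sum_congr (by simp) fun j _ => ?_
      rw [smul_apply, inner_smul_right, hHk, Nat.add_sub_cancel_left, div_pow, pow_add, inv_pow, inv_pow]
      field_simp
    rw [hΔ, inner_neg_right, h1, ← mul_neg_geom_sum]
    field_simp
  have hres : ∀ i, inner ℝ (b i) (G + (S Δ - γ • Δ))
      = (γ / s i) ^ (m + 1) * inner ℝ (b i) G := fun i => by
    rw [inner_add_right, inner_sub_right, hSc, inner_smul_right, ← sub_mul, hΔi]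
    ring
  have hQ : ∀ x, inner ℝ x (S x - γ • x) = ∑ i, (s i - γ) * inner ℝ (b i) x ^ 2 := fun x => by
    rw [inner_eq_sum_orthonormalBasis b]
    refine Finset.sum_congr rfl fun i _ => ?_
    rw [inner_sub_right, hSc, inner_smul_right]
    ring
  have hterm : ∀ i, |inner ℝ (b i) (G + (S Δ - γ • Δ)) * inner ℝ (b i) v|
      ≤ ε / (1 - ε) * ((√(s i - γ) * |inner ℝ (b i) Δ|) * (√(s i - γ) * |inner ℝ (b i) v|)) :=
    fun i => by
    have h1 : (1 - ε) * |inner ℝ (b i) G| ≤ (s i - γ) * |inner ℝ (b i) Δ| := by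
      have h2 : (s i - γ) * |inner ℝ (b i) Δ|
          = |1 - (γ / s i) ^ (m + 1)| * |inner ℝ (b i) G| := by
        rw [← abs_neg (1 - _), ← abs_mul, ← hΔi, abs_mul, abs_of_pos (hq i)]
      rw [h2]
      gcongr
      have := le_abs_self ((γ / s i) ^ (m + 1))
      exact le_trans (by linarith [hE i]) (le_abs_self _)
    have h3 : (√(s i - γ) * |inner ℝ (b i) Δ|) * (√(s i - γ) * |inner ℝ (b i) v|)
        = ((s i - γ) * |inner ℝ (b i) Δ|) * |inner ℝ (b i) v| := by
      have := Real.mul_self_sqrt (hq i).le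
      linear_combination (|inner ℝ (b i) Δ| * |inner ℝ (b i) v|) * this
    rw [hres, abs_mul, abs_mul, h3, ← mul_assoc]
    refine mul_le_mul_of_nonneg_right ?_ (abs_nonneg _)
    calc |(γ / s i) ^ (m + 1)| * |inner ℝ (b i) G| ≤ ε * |inner ℝ (b i) G| := by
          gcongr; exact hE i
      _ = ε / (1 - ε) * ((1 - ε) * |inner ℝ (b i) G|) := by
          field_simp [(sub_pos.mpr hε1).ne']
      _ ≤ _ := mul_le_mul_of_nonneg_left h1 (div_nonneg hε0 (sub_nonneg.mpr hε1.le))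
  calc |inner ℝ (G + (S Δ - γ • Δ)) v|
      ≤ ∑ i, |inner ℝ (b i) (G + (S Δ - γ • Δ)) * inner ℝ (b i) v| := by
        rw [inner_eq_sum_orthonormalBasis b]
        exact Finset.abs_sum_le_sum_abs _ _
    _ ≤ ∑ i, ε / (1 - ε)
          * ((√(s i - γ) * |inner ℝ (b i) Δ|) * (√(s i - γ) * |inner ℝ (b i) v|)) :=
        Finset.sum_le_sum fun i _ => hterm i
    _ ≤ _ := by
        rw [← Finset.mul_sum]
        refine mul_le_mul_of_nonneg_left ?_ (div_nonneg hε0 (sub_nonneg.mpr hε1.le))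
        refine (Real.sum_mul_le_sqrt_mul_sqrt _ _ _).trans (le_of_eq ?_)
        rw [hQ, hQ]
        congr 2 <;>
        · refine Finset.sum_congr rfl fun i _ => ?_
          rw [mul_pow, Real.sq_sqrt (hq i).le, sq_abs]

end Forms

end OQNS

namespace OQNS

/-! ### The elliptical potential lemma. -/

section EllipticalPotential

open Matrix

variable {ι : Type*} [Fintype ι] [DecidableEq ι]

theorem posDef_sq_dotProduct_le {M : Matrix ι ι ℝ} (hM : M.PosDef) (g v : ι → ℝ) :
    (g ⬝ᵥ v) ^ 2 ≤ (g ⬝ᵥ (M⁻¹ *ᵥ g)) * (v ⬝ᵥ (M *ᵥ v)) := by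
  have hnn : ∀ z : ι → ℝ, 0 ≤ z ⬝ᵥ (M *ᵥ z) := fun z => by
    simpa using hM.posSemidef.dotProduct_mulVec_nonneg z
  have hsymm : ∀ y z : ι → ℝ, y ⬝ᵥ (M *ᵥ z) = z ⬝ᵥ (M *ᵥ y) := fun y z => by
    have ht : Mᵀ = M :=
      (conjTranspose_eq_transpose_of_trivial M).symm.trans hM.1
    rw [dotProduct_mulVec, ← mulVec_transpose, ht, dotProduct_comm]
  have hx : M *ᵥ (M⁻¹ *ᵥ g) = g := by
    rw [mulVec_mulVec, mul_nonsing_inv _ ((isUnit_iff_isUnit_det _).mp hM.isUnit), one_mulVec]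
  set x := M⁻¹ *ᵥ g
  have h1 : g ⬝ᵥ v = v ⬝ᵥ (M *ᵥ x) := by rw [hx, dotProduct_comm]
  have h2 : g ⬝ᵥ x = x ⬝ᵥ (M *ᵥ x) := by rw [hx, dotProduct_comm]
  rw [h1, h2]
  have hq : ∀ r : ℝ, 0 ≤ (x ⬝ᵥ (M *ᵥ x)) * (r * r) + (2 * v ⬝ᵥ (M *ᵥ x)) * r
      + v ⬝ᵥ (M *ᵥ v) := fun r => by
    have := hnn (v + r • x)
    simp only [mulVec_add, mulVec_smul, add_dotProduct, dotProduct_add, smul_dotProduct,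
      dotProduct_smul, smul_eq_mul, hsymm x v] at this
    linarith
  have := discrim_le_zero hq
  rw [discrim] at this
  nlinarith

theorem det_add_smul_vecMulVec {M : Matrix ι ι ℝ} (hM : M.PosDef) (β : ℝ) (g : ι → ℝ) :
    (M + β • vecMulVec g g).det = M.det * (1 + β * (g ⬝ᵥ (M⁻¹ *ᵥ g))) := by
  have h : β • vecMulVec g g = replicateCol Unit (β • g) * replicateRow Unit g := by
    rw [← vecMulVec_eq, smul_vecMulVec]
  rw [h, det_add_replicateCol_mul_replicateRow ((isUnit_iff_isUnit_det _).mp hM.isUnit)]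
  congr 1
  rw [det_unique, Matrix.add_apply, one_apply_eq, Matrix.mul_assoc, ← replicateCol_mulVec,
    replicateRow_mul_replicateCol_apply, mulVec_smul, dotProduct_smul, smul_eq_mul]

/-- AM–GM for the eigenvalues, in the form of the tangent line to $\log$ at $c$. -/
theorem log_det_le {M : Matrix ι ι ℝ} (hM : M.PosDef) {c : ℝ} (hc : 0 < c)
    (htr : M.trace ≤ c * Fintype.card ι) : Real.log M.det ≤ Fintype.card ι * Real.log c := by
  have h1 : M.det = ∏ i, hM.1.eigenvalues i := by simpa using hM.1.det_eq_prod_eigenvalues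
  have h2 : M.trace = ∑ i, hM.1.eigenvalues i := by simpa using hM.1.trace_eq_sum_eigenvalues
  rw [h1, Real.log_prod (fun i _ => (hM.eigenvalues_pos i).ne')]
  have h3 : ∀ i, Real.log (hM.1.eigenvalues i) ≤ Real.log c + (hM.1.eigenvalues i / c - 1) :=
    fun i => by
    have hp := hM.eigenvalues_pos i
    have := Real.log_le_sub_one_of_pos (div_pos hp hc)
    rw [Real.log_div hp.ne' hc.ne'] at this
    linarith
  refine (Finset.sum_le_sum fun i _ => h3 i).trans ?_
  rw [Finset.sum_add_distrib, Finset.sum_sub_distrib, ← Finset.sum_div, ← h2]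
  have : M.trace / c ≤ Fintype.card ι := by rw [div_le_iff₀ hc]; linarith
  simp
  linarith

/-- The elliptical potential lemma: the squared dual norms of the rank-one updates, each measured
after its own update, have a logarithmically bounded sum. -/
theorem exists_elliptical_bound {d : ℕ} (hd : 1 ≤ d) {β B : ℝ} (hβ : 0 < β) (g : ℕ → E d)
    (T : ℕ) (hg : ∀ t ∈ Finset.Icc 1 T, ‖g t‖ ≤ B) :
    ∃ q : ℕ → ℝ, (∀ t, 0 ≤ q t) ∧
      (∀ t v, 1 ≤ t → inner ℝ (g t) v ^ 2
        ≤ q t * (‖v‖ ^ 2 + β * ∑ s ∈ Finset.Ico 1 (t + 1), inner ℝ (g s) v ^ 2)) ∧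
      ∑ t ∈ Finset.Icc 1 T, q t ≤ d / β * Real.log (1 + β * B ^ 2 * T / d) := by
  let M : ℕ → Matrix (Fin d) (Fin d) ℝ := fun t =>
    1 + β • ∑ s ∈ Finset.Ico 1 t, vecMulVec (fun i => g s i) (fun i => g s i)
  have hin : ∀ x y : E d, inner ℝ x y = (fun i => x i) ⬝ᵥ (fun i => y i) := fun x y => by
    simp [PiLp.inner_apply, dotProduct, mul_comm]
  have hM1 : M 1 = 1 := by simp [M]
  have hMs : ∀ t, 1 ≤ t → M (t + 1) = M t + β • vecMulVec (fun i => g t i) (fun i => g t i) :=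
    fun t ht => by
    simp only [M]
    rw [Finset.sum_Ico_succ_top ht, smul_add, add_assoc]
  have hpd : ∀ t, (M t).PosDef := fun t => by
    refine PosDef.add_posSemidef PosDef.one (PosSemidef.smul ?_ hβ.le)
    refine posSemidef_sum _ fun s _ => ?_
    simpa using posSemidef_vecMulVec_self_star (fun i => g s i)
  have hform : ∀ t (v : E d), (fun i => v i) ⬝ᵥ (M t *ᵥ (fun i => v i))
      = ‖v‖ ^ 2 + β * ∑ s ∈ Finset.Ico 1 t, inner ℝ (g s) v ^ 2 := fun t v => by
    have h1 : ∀ u : Fin d → ℝ, (fun i => v i) ⬝ᵥ (vecMulVec u u *ᵥ (fun i => v i))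
        = (u ⬝ᵥ (fun i => v i)) ^ 2 := fun u => by
      rw [vecMulVec_mulVec, dotProduct_smul, dotProduct_comm, sq]
      simp
    simp only [M]
    rw [add_mulVec, one_mulVec, dotProduct_add, ← hin, real_inner_self_eq_norm_sq, smul_mulVec,
      dotProduct_smul, sum_mulVec, dotProduct_sum, smul_eq_mul]
    simp only [h1, hin]
  let x : ℕ → ℝ := fun t => (fun i => g t i) ⬝ᵥ ((M t)⁻¹ *ᵥ (fun i => g t i))
  have hx : ∀ t, 0 ≤ x t := fun t => by
    simpa using (hpd t).inv.posSemidef.dotProduct_mulVec_nonneg (fun i => g t i)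
  have hx1 : ∀ t, 0 < 1 + β * x t := fun t => by have := mul_nonneg hβ.le (hx t); linarith
  have hdet : ∀ t, 1 ≤ t → (M (t + 1)).det = (M t).det * (1 + β * x t) := fun t ht => by
    rw [hMs t ht, det_add_smul_vecMulVec (hpd t)]
  -- By Sherman–Morrison the witness is $g_t^\top M_{t+1}^{-1}g_t$. The determinant grows by the
  -- factor $1+\beta x_t$, and $1-1/y\le\log y$ bounds $\beta q_t$ by the increase of $\log\det$.
  refine ⟨fun t => x t / (1 + β * x t), fun t => div_nonneg (hx t) (hx1 t).le, ?_, ?_⟩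
  · intro t v ht
    have h := posDef_sq_dotProduct_le (hpd t) (fun i => g t i) (fun i => v i)
    rw [hform, ← hin] at h
    change _ ≤ x t * _ at h
    rw [Finset.sum_Ico_succ_top ht, div_mul_eq_mul_div, le_div_iff₀ (hx1 t)]
    linarith
  · have hlog : ∀ n, ∑ t ∈ Finset.Icc 1 n, x t / (1 + β * x t)
        ≤ 1 / β * Real.log (M (n + 1)).det := fun n => by
      induction n with
      | zero => simp [hM1]
      | succ n ih =>
        rw [Finset.sum_Icc_succ_top (by omega), hdet _ (by omega),
          Real.log_mul (hpd _).det_pos.ne' (hx1 _).ne', mul_add]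
        refine add_le_add ih ?_
        have h1 := Real.one_sub_inv_le_log_of_pos (hx1 (n + 1))
        have h2 : x (n + 1) / (1 + β * x (n + 1)) = 1 / β * (1 - (1 + β * x (n + 1))⁻¹) := by
          have := (hx1 (n + 1)).ne'
          rw [div_eq_iff this, mul_assoc, sub_mul, inv_mul_cancel₀ this]
          field_simp
          ring
        rw [h2]
        gcongr
    have hd0 : (0 : ℝ) < d := by exact_mod_cast hd
    refine (hlog T).trans ?_
    have htr : (M (T + 1)).trace ≤ (1 + β * B ^ 2 * T / d) * Fintype.card (Fin d) := by
      simp only [M]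
      rw [trace_add, trace_one, trace_smul, trace_sum, smul_eq_mul, Fintype.card_fin]
      have h1 : ∀ s ∈ Finset.Ico 1 (T + 1),
          trace (vecMulVec (fun i => g s i) (fun i => g s i)) ≤ B ^ 2 := fun s hs => by
        rw [trace_vecMulVec, ← hin, real_inner_self_eq_norm_sq]
        have := hg s (by simpa [Nat.lt_succ_iff] using hs)
        gcongr
      have h2 := Finset.sum_le_card_nsmul _ _ _ h1
      rw [Nat.card_Ico, Nat.add_sub_cancel, nsmul_eq_mul] at h2
      have h3 := mul_le_mul_of_nonneg_left h2 hβ.le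
      have h4 : (1 + β * B ^ 2 * T / d) * d = d + β * (T * B ^ 2) := by field_simp
      rw [h4]
      linarith
    have := log_det_le (hpd (T + 1)) (by positivity) htr
    rw [Fintype.card_fin] at this
    rw [div_mul_eq_mul_div, div_mul_eq_mul_div, one_mul]
    gcongr

end EllipticalPotential

end OQNS

namespace OQNS

/-! ### The algorithm step as an inexact Newton step. -/

section Run

variable {d : ℕ}

/-- The Hessian form of `Φ_t` at `x`, evaluated at `v`. -/
noncomputable def phiForm (d : ℕ) (η B β : ℝ) (g : ℕ → E d) (t : ℕ) (x v : E d) : ℝ :=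
  inner ℝ v ((psiHess d η x + quadHess d η B β g t) v)

/-- The quadratic part of `phiForm`. -/
noncomputable def quadForm (d : ℕ) (η B β : ℝ) (g : ℕ → E d) (t : ℕ) (v : E d) : ℝ :=
  inner ℝ v (quadHess d η B β g t v)

theorem phiForm_eq (η B β : ℝ) (g : ℕ → E d) (t : ℕ) (x v : E d) :
    phiForm d η B β g t x v = η * d * ballHess x v + quadForm d η B β g t v := by
  rw [phiForm, add_apply, inner_add_right, inner_psiHess_self, quadForm]

theorem quadForm_eq (η B β : ℝ) (g : ℕ → E d) (t : ℕ) (v : E d) :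
    quadForm d η B β g t v = (d + B ^ 2 * η) * ‖v‖ ^ 2
      + β * ∑ s ∈ Finset.Ico 1 t, inner ℝ (g s) v ^ 2 := inner_quadHess_self η B β g t v

theorem quadForm_nonneg {η B β : ℝ} (hη : 0 ≤ η) (hβ : 0 ≤ β) (g : ℕ → E d) (t : ℕ) (v : E d) :
    0 ≤ quadForm d η B β g t v := by
  rw [quadForm_eq]
  have := Finset.sum_nonneg fun s (_ : s ∈ Finset.Ico 1 t) => sq_nonneg (inner ℝ (g s) v)
  positivity

theorem quadForm_mono {η B β : ℝ} (hβ : 0 ≤ β) (g : ℕ → E d) (t : ℕ) (v : E d) :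
    quadForm d η B β g t v ≤ quadForm d η B β g (t + 1) v := by
  rw [quadForm_eq, quadForm_eq]
  have : ∑ s ∈ Finset.Ico 1 t, inner ℝ (g s) v ^ 2
      ≤ ∑ s ∈ Finset.Ico 1 (t + 1), inner ℝ (g s) v ^ 2 :=
    Finset.sum_le_sum_of_subset_of_nonneg (Finset.Ico_subset_Ico_right (Nat.le_succ t))
      fun s _ _ => sq_nonneg _
  nlinarith

theorem phiForm_nonneg {η B β : ℝ} (hη : 0 ≤ η) (hβ : 0 ≤ β) (g : ℕ → E d) (t : ℕ) {x : E d}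
    (hx : ‖x‖ < 1) (v : E d) : 0 ≤ phiForm d η B β g t x v := by
  rw [phiForm_eq]
  exact add_nonneg (mul_nonneg (by positivity) (ballHess_nonneg hx v))
    (quadForm_nonneg hη hβ g t v)

theorem psiHess_symm (η : ℝ) (x v z : E d) :
    inner ℝ v (psiHess d η x z) = inner ℝ z (psiHess d η x v) := by
  rw [psiHess_apply, psiHess_apply, inner_smul_right, inner_smul_right, inner_ballHessApply,
    inner_ballHessApply, real_inner_comm z v]
  ring

theorem quadHess_symm (η B β : ℝ) (g : ℕ → E d) (t : ℕ) (v z : E d) :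
    inner ℝ v (quadHess d η B β g t z) = inner ℝ z (quadHess d η B β g t v) := by
  rw [inner_quadHess, inner_quadHess, real_inner_comm z v]
  congr 2
  exact Finset.sum_congr rfl fun s _ => mul_comm _ _

theorem posForm_phi {η B β : ℝ} (hη : 0 ≤ η) (hβ : 0 ≤ β) (hd : 1 ≤ d) (g : ℕ → E d) (t : ℕ)
    {x : E d} (hx : ‖x‖ < 1) : PosForm (psiHess d η x + quadHess d η B β g t) := by
  refine .of_coercive (fun v z => ?_) one_pos (fun v => ?_)
  · simp only [add_apply, inner_add_right, psiHess_symm η x v z, quadHess_symm η B β g t v z]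
  · change _ ≤ phiForm d η B β g t x v
    rw [phiForm_eq, quadForm_eq]
    have h1 := ballHess_nonneg hx v
    have h2 := Finset.sum_nonneg fun s (_ : s ∈ Finset.Ico 1 t) => sq_nonneg (inner ℝ (g s) v)
    have h3 : (1 : ℝ) ≤ d := by exact_mod_cast hd
    have h4 : 0 ≤ β * ∑ s ∈ Finset.Ico 1 t, inner ℝ (g s) v ^ 2 := mul_nonneg hβ h2
    have h5 : 0 ≤ η * d * ballHess x v := by positivity
    nlinarith [sq_nonneg ‖v‖, mul_nonneg (mul_nonneg (sq_nonneg B) hη) (sq_nonneg ‖v‖)]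

/-- The new quadratic term is centred at $w_t$, so to first order only its linear companion $g_t$ is
felt there. -/
theorem phiGrad_succ_self (η B β : ℝ) (g w : ℕ → E d) {t : ℕ} (ht : 1 ≤ t) :
    phiGrad d η B β g w (t + 1) (w t) = phiGrad d η B β g w t (w t) + g t := by
  simp only [phiGrad, Finset.sum_Ico_succ_top ht, sub_self, inner_zero_right, zero_smul, add_zero]
  abel

theorem quadHess_apply_sub (η B β : ℝ) (g w : ℕ → E d) (t : ℕ) (x v : E d) :
    phiGrad d η B β g w t (x + v) - phiGrad d η B β g w t x
      = (η * d) • (ballGrad (x + v) - ballGrad x) + quadHess d η B β g t v := by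
  have h1 : ∑ s ∈ Finset.Ico 1 t, (inner ℝ (g s) (x + v - w s)) • g s
      = ∑ s ∈ Finset.Ico 1 t, (inner ℝ (g s) (x - w s)) • g s
        + (∑ s ∈ Finset.Ico 1 t, outer (g s)) v := by
    rw [sum_apply, ← Finset.sum_add_distrib]
    refine Finset.sum_congr rfl fun s _ => ?_
    rw [outer_apply, ← add_smul, ← inner_add_right]
    congr 2
    abel
  simp only [phiGrad, h1, quadHess, add_apply, smul_apply, one_apply_eq_self, smul_add, smul_sub]
  abel

/-- Everything except the barrier is quadratic, so the only error of linearisation is `gradRem`; the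
bracket vanishes for an exact Newton step. -/
theorem phiGrad_add (η B β : ℝ) (g w : ℕ → E d) (t : ℕ) (x v : E d) :
    phiGrad d η B β g w t (x + v) = (η * d) • gradRem x v
      + (phiGrad d η B β g w t x + (psiHess d η x + quadHess d η B β g t) v) := by
  have h := quadHess_apply_sub η B β g w t x v
  rw [sub_eq_iff_eq_add] at h
  rw [h, gradRem, add_apply, psiHess_apply]
  simp only [smul_sub]
  abel

/-- The landmark stays relatively close to the iterate. -/
structure LandmarkClose (c : ℝ) (u w : E d) : Prop where
  norm_lt : ‖u‖ < 1
  close : |‖u‖ ^ 2 - ‖w‖ ^ 2| ≤ √c * (1 - ‖w‖ ^ 2)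

theorem landmarkClose_self {c : ℝ} {w : E d} (hw : ‖w‖ < 1) : LandmarkClose c w w :=
  ⟨hw, by
    have := one_sub_norm_sq_pos hw
    rw [sub_self, abs_zero]; positivity⟩

/-- A reset makes the difference zero. If the landmark is kept under the new-iterate rule,
$c\le\sqrt c$ suffices. Under the old-landmark rule $1-\|w_{t+1}\|^2\ge(1-c)(1-\|u_t\|^2)$, and
$c\le 1/3$ gives $\sqrt c\le 1-c$, which converts one scale into the other at the cost of a factor
$\sqrt c$. -/
theorem landmarkClose_succ {η B β c : ℝ} {T : ℕ} {rule : LandmarkRule} {g u w : ℕ → E d}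
    (hc : c ∈ Set.Ioo (0 : ℝ) 1) (hrule : rule = LandmarkRule.oldLandmark → c ≤ 1 / 3)
    (hrun : IsRun d η B β c T rule g u w) {t : ℕ} (ht : t ∈ Finset.Icc 1 T)
    (hu : ‖u t‖ < 1) (hw : ‖w (t + 1)‖ < 1) : LandmarkClose c (u (t + 1)) (w (t + 1)) := by
  rw [hrun.u_succ t ht]
  split_ifs with h
  · refine ⟨hu, ?_⟩
    rw [abs_sub_comm]
    refine h.trans ?_
    have h1 := one_sub_norm_sq_pos hw
    have h2 := one_sub_norm_sq_pos hu
    have hsq := Real.sq_sqrt hc.1.le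
    have hs0 := Real.sqrt_pos.mpr hc.1
    have hs1 : √c < 1 := by rw [Real.sqrt_lt' one_pos]; simpa using hc.2
    cases rule with
    | newIterate =>
      simp only [LandmarkRule.scale]
      gcongr
      nlinarith
    | oldLandmark =>
      have hc3 := hrule rfl
      simp only [LandmarkRule.scale] at h ⊢
      have h3 := (abs_le.mp h).2
      have h4 : (1 - c) * (1 - ‖u t‖ ^ 2) ≤ 1 - ‖w (t + 1)‖ ^ 2 := by linarith
      have h5 : √c ≤ 1 - c := by
        rw [Real.sqrt_le_left (by linarith)]
        nlinarith [hc.1]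
      calc c * (1 - ‖u t‖ ^ 2) = √c * (√c * (1 - ‖u t‖ ^ 2)) := by rw [← mul_assoc, ← sq, hsq]
        _ ≤ √c * ((1 - c) * (1 - ‖u t‖ ^ 2)) := by gcongr
        _ ≤ _ := by gcongr
  · exact landmarkClose_self hw

/-- The relative size of the residual of the truncated Neumann series. -/
noncomputable def neumannError (d : ℕ) (η B β c : ℝ) (T : ℕ) : ℝ :=
  √c ^ (taylorOrder d η B β c T + 1) / (1 - √c ^ (taylorOrder d η B β c T + 1))

/-- The step of the algorithm is an inexact Newton step. -/
theorem abs_inner_step_residual_le {η B β c : ℝ} {T : ℕ} {rule : LandmarkRule} {g u w : ℕ → E d}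
    (hd : 1 ≤ d) (hη : 1 ≤ η) (hβ : 0 < β)
    (hc : c ∈ Set.Ioo (0 : ℝ) 1) (hrun : IsRun d η B β c T rule g u w) {t : ℕ}
    (ht : t ∈ Finset.Icc 1 T) (hw : ‖w t‖ < 1) (hu : LandmarkClose c (u t) (w t)) (v : E d) :
    |inner ℝ (phiGrad d η B β g w (t + 1) (w t)
        + (psiHess d η (w t) + quadHess d η B β g (t + 1)) (w (t + 1) - w t)) v|
      ≤ neumannError d η B β c T * (√(phiForm d η B β g (t + 1) (w t) (w (t + 1) - w t))
        * √(phiForm d η B β g (t + 1) (w t) v)) := by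
  have hd0 : (0 : ℝ) < d := by exact_mod_cast hd
  have hη0 : 0 < η := by linarith
  have hu' := one_sub_norm_sq_pos hu.norm_lt
  have hw' := one_sub_norm_sq_pos hw
  set σ := 2 * η * d / (1 - ‖u t‖ ^ 2) with hσ
  have hσ0 : 0 < σ := by positivity
  set X : E d →L[ℝ] E d := σ • (1 : E d →L[ℝ] E d) + (d + η * B ^ 2) • (1 : E d →L[ℝ] E d)
    + β • ∑ s ∈ Finset.Icc 1 t, outer (g s) with hX
  set S : E d →L[ℝ] E d := X + (4 * η * d / (1 - ‖w t‖ ^ 2) ^ 2) • outer (w t) with hS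
  have hXform : ∀ v z : E d, inner ℝ v (X z) = (σ + (d + η * B ^ 2)) * inner ℝ v z
      + β * ∑ s ∈ Finset.Icc 1 t, inner ℝ (g s) z * inner ℝ (g s) v := fun v z => by
    simp only [hX, add_apply, smul_apply, one_apply_eq_self, sum_apply, outer_apply,
      inner_add_right, inner_smul_right, inner_sum, real_inner_comm v (g _)]
    ring
  have hXsymm : ∀ v z : E d, inner ℝ v (X z) = inner ℝ z (X v) := fun v z => by
    rw [hXform, hXform, real_inner_comm z v]
    congr 2
    exact Finset.sum_congr rfl fun s _ => mul_comm _ _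
  have hXcoer : ∀ v : E d, σ * ‖v‖ ^ 2 ≤ inner ℝ v (X v) := fun v => by
    rw [hXform, real_inner_self_eq_norm_sq]
    have h2 := Finset.sum_nonneg fun s (_ : s ∈ Finset.Icc 1 t) => mul_self_nonneg (inner ℝ (g s) v)
    have h3 := mul_nonneg hβ.le h2
    nlinarith [mul_nonneg (by positivity : 0 ≤ d + η * B ^ 2) (sq_nonneg ‖v‖)]
  have hSform : ∀ v z : E d, inner ℝ v (S z) = inner ℝ v (X z)
      + 4 * η * d / (1 - ‖w t‖ ^ 2) ^ 2 * (inner ℝ (w t) z * inner ℝ (w t) v) := fun v z => by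
    simp only [hS, add_apply, smul_apply, outer_apply, inner_add_right, inner_smul_right,
      real_inner_comm v (w t)]
  have hSsymm : ∀ v z : E d, inner ℝ v (S z) = inner ℝ z (S v) := fun v z => by
    rw [hSform, hSform, hXsymm]
    ring
  have hScoer : ∀ v : E d, σ * ‖v‖ ^ 2 ≤ inner ℝ v (S v) := fun v => by
    rw [hSform]
    have := mul_nonneg (by positivity : 0 ≤ 4 * η * d / (1 - ‖w t‖ ^ 2) ^ 2)
      (mul_self_nonneg (inner ℝ (w t) v))
    linarith [hXcoer v]
  have hopH : opH d η B β g u w t = Ring.inverse S := by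
    rw [opH, opA, Ring.inverse_inverse (PosForm.of_coercive hXsymm hσ0 hXcoer).isUnit]
  -- Subtracting $\gamma_t$ exchanges the curvature at the landmark for that at the iterate, so
  -- $S-\gamma_t I$ is the exact Hessian $\nabla^2\Phi_{t+1}(w_t)$.
  have hSQ : ∀ x, S x - gam d η u w t • x
      = (psiHess d η (w t) + quadHess d η B β g (t + 1)) x := fun x => by
    simp only [hS, hX, gam, psiHess, quadHess, add_apply, smul_apply, one_apply_eq_self,
      ← hσ, Finset.Ico_add_one_right_eq_Icc]
    module
  have hγ : |gam d η u w t| ≤ √c * σ := by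
    have e : gam d η u w t
        = σ * ((‖u t‖ ^ 2 - ‖w t‖ ^ 2) / (1 - ‖w t‖ ^ 2)) := by
      rw [gam, hσ]
      field_simp
      ring
    rw [e, abs_mul, abs_of_pos hσ0, mul_comm, abs_div, abs_of_pos hw']
    gcongr
    rw [div_le_iff₀ hw']
    exact hu.close
  have hs1 : √c < 1 := by rw [Real.sqrt_lt' one_pos]; simpa using hc.2
  have hΔ : w (t + 1) - w t = -(∑ k ∈ Finset.Icc 1 (taylorOrder d η B β c T + 1),
      gam d η u w t ^ (k - 1) • (Ring.inverse S) ^ k) (phiGrad d η B β g w (t + 1) (w t)) := by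
    rw [hrun.w_succ t ht, opHtilde, hopH, gradient_Phi η B β g w (t + 1) hw]
    abel
  have := abs_inner_residual_le hSsymm hσ0 hScoer (Real.sqrt_nonneg c) hs1 hγ
    (taylorOrder d η B β c T) _ _ v hΔ
  rw [hSQ, hSQ] at this
  exact this

/-- Since $12(4+32/\eta^2)^2(2\eta d)^2T=12d^2(8\eta+64/\eta)^2T$, the argument of the logarithm in
$m$ dominates $X/(1-c)$. The quantity $X$ is left free so that both bounds on the Neumann error
follow from it. -/
theorem taylorOrder_bound {η B β c : ℝ} {T : ℕ} (hd : 1 ≤ d) (hT : 1 ≤ T) (hη : 1 ≤ η)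
    (hB : 0 < B) (hβ : 0 < β) (hc : c ∈ Set.Ioo (0 : ℝ) 1) {X : ℝ}
    (hX : X ≤ 12 * d ^ 2 * (8 * η + 64 / η) ^ 2 * T) :
    (√c ^ (taylorOrder d η B β c T + 1)) ^ 2 * (4 * X) ≤ 1 := by
  have hd1 : (1 : ℝ) ≤ d := by exact_mod_cast hd
  have hT1 : (1 : ℝ) ≤ T := by exact_mod_cast hT
  have hc0 := hc.1
  have hc1 : 0 < 1 - c := sub_pos.mpr hc.2
  have hη0 : 0 < η := by linarith
  set N : ℝ := 12 * (4 + 32 / η ^ 2) ^ 2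
      * (2 * η * d + B ^ 2 * η + (B + 2 * β * B ^ 2) * T) ^ 2 * T with hN
  have hN1 : 12 * d ^ 2 * (8 * η + 64 / η) ^ 2 * T ≤ N := by
    calc 12 * d ^ 2 * (8 * η + 64 / η) ^ 2 * T
        = 12 * (4 + 32 / η ^ 2) ^ 2 * (2 * η * d) ^ 2 * T := by
          field_simp; ring
      _ ≤ N := by
        rw [hN]
        gcongr
        have : 0 ≤ B ^ 2 * η + (B + 2 * β * B ^ 2) * T := by positivity
        linarith
  have hN0 : 0 < N := lt_of_lt_of_le (by positivity) hN1
  have hpow : c ^ taylorOrder d η B β c T ≤ (1 - c) / N := by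
    have h1 : -Real.logb c (N / (1 - c)) ≤ taylorOrder d η B β c T := Nat.le_ceil _
    have hX : 0 < N / (1 - c) := by positivity
    rw [← Real.rpow_natCast, ← inv_div]
    refine (Real.rpow_le_rpow_of_exponent_ge hc0 hc.2.le h1).trans (le_of_eq ?_)
    rw [Real.rpow_neg hc0.le, Real.rpow_logb hc0 hc.2.ne hX]
  -- The squared ratio is $c^{m+1}$. Its spare factor $c$ and the factor $1-c$ in the logarithm
  -- combine to $4c(1-c)\le 1$.
  have h1 : (√c ^ (taylorOrder d η B β c T + 1)) ^ 2 = c ^ taylorOrder d η B β c T * c := by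
    rw [← pow_mul, mul_comm, pow_mul, Real.sq_sqrt hc0.le, pow_succ]
  calc (√c ^ (taylorOrder d η B β c T + 1)) ^ 2 * (4 * X)
      ≤ (1 - c) / N * c * (4 * N) := by
        rw [h1]
        have h2 : c ^ taylorOrder d η B β c T * c ≤ (1 - c) / N * c :=
          mul_le_mul_of_nonneg_right hpow hc0.le
        calc c ^ taylorOrder d η B β c T * c * (4 * X)
            ≤ c ^ taylorOrder d η B β c T * c * (4 * N) :=
              mul_le_mul_of_nonneg_left (by linarith only [hX, hN1]) (by positivity)
          _ ≤ _ := mul_le_mul_of_nonneg_right h2 (by positivity)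
    _ = 4 * (c * (1 - c)) := by field_simp
    _ ≤ 1 := by nlinarith only [sq_nonneg (2 * c - 1)]

theorem sq_taylorFactor_le {η : ℝ} (hη : 1 ≤ η) :
    2048 ≤ (8 * η + 64 / η) ^ 2 ∧ 64 * η ^ 2 ≤ (8 * η + 64 / η) ^ 2 := by
  have hη0 : 0 < η := by linarith
  have h0 : 0 ≤ 64 / η := by positivity
  have h1 : (8 * η) * (64 / η) = 512 := by field_simp; norm_num
  exact ⟨by nlinarith [sq_nonneg (8 * η - 64 / η)], by nlinarith⟩

/-- The smallness $1/300$ comes from $(8\eta+64/\eta)^2\ge 2048$. The product bound comes from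
$(8\eta+64/\eta)^2\ge 64\eta^2$ and pays for the $1/T$ terms after summation over the rounds. -/
theorem neumannError_bounds {η B β c : ℝ} {T : ℕ} (hd : 1 ≤ d) (hT : 1 ≤ T) (hη : 1 ≤ η)
    (hB : 0 < B) (hβ : 0 < β) (hc : c ∈ Set.Ioo (0 : ℝ) 1) :
    0 ≤ neumannError d η B β c T ∧ neumannError d η B β c T ≤ 1 / 300 ∧
      neumannError d η B β c T ^ 2 * (η * d) * T ≤ 1 / 3000 := by
  have hd1 : (1 : ℝ) ≤ d := by exact_mod_cast hd
  have hT1 : (1 : ℝ) ≤ T := by exact_mod_cast hT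
  have hη0 : 0 < η := by linarith
  obtain ⟨hK1, hK2⟩ := sq_taylorFactor_le hη
  have hA := taylorOrder_bound (d := d) hd hT hη hB hβ hc
    (X := 12 * d ^ 2 * 2048 * T) (by gcongr)
  have hA' := taylorOrder_bound (d := d) hd hT hη hB hβ hc
    (X := 12 * d ^ 2 * (64 * η ^ 2) * T) (by gcongr)
  rw [neumannError]
  have hε0 : 0 ≤ √c ^ (taylorOrder d η B β c T + 1) := by positivity
  generalize √c ^ (taylorOrder d η B β c T + 1) = ε at hA hA' hε0
  have hε1 : ε ≤ 1 / 313 := by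
    have h2 : (1 : ℝ) ≤ d ^ 2 * T := one_le_mul_of_one_le_of_one_le (one_le_pow₀ hd1) hT1
    have h3 : ε ^ 2 * 1 ≤ ε ^ 2 * (d ^ 2 * T) := mul_le_mul_of_nonneg_left h2 (sq_nonneg ε)
    have h4 : ε ^ 2 ≤ (1 / 313) ^ 2 := by
      have h5 : ε ^ 2 * (4 * (12 * d ^ 2 * 2048 * T)) = 98304 * (ε ^ 2 * (d ^ 2 * T)) := by ring
      linarith only [hA, h3, h5]
    exact (pow_le_pow_iff_left₀ hε0 (by norm_num) two_ne_zero).mp h4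
  have hε2 : ε ^ 2 * (η * d) * T ≤ 1 / 3072 := by
    have h3 : 1 ≤ η * d := one_le_mul_of_one_le_of_one_le hη hd1
    have h4 : η * d ≤ (η * d) * (η * d) := le_mul_of_one_le_left (by positivity) h3
    have h5 : ε ^ 2 * (η * d) * T ≤ ε ^ 2 * ((η * d) * (η * d)) * T := by gcongr
    have h6 : ε ^ 2 * ((η * d) * (η * d)) * T * 3072
        = ε ^ 2 * (4 * (12 * d ^ 2 * (64 * η ^ 2) * T)) := by ring
    linarith only [hA', h5, h6]
  have h1ε : 312 / 313 ≤ 1 - ε := by linarith only [hε1]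
  have hle : ε / (1 - ε) ≤ 313 / 312 * ε := by
    rw [div_le_iff₀ (by linarith only [h1ε])]
    nlinarith only [h1ε, hε0]
  have h0 : 0 ≤ ε / (1 - ε) := div_nonneg hε0 (by linarith only [h1ε])
  refine ⟨h0, by linarith only [hle, hε1], ?_⟩
  calc (ε / (1 - ε)) ^ 2 * (η * d) * T ≤ (313 / 312 * ε) ^ 2 * (η * d) * T := by gcongr
    _ = (313 / 312) ^ 2 * (ε ^ 2 * (η * d) * T) := by ring
    _ ≤ (313 / 312) ^ 2 * (1 / 3072) := by gcongr
    _ ≤ 1 / 3000 := by norm_num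

end Run

end OQNS

namespace OQNS

/-! ### Newton decrements and the distance to the FTRL iterate. -/

section Decrement

variable {d : ℕ}

theorem normIn_hessian_Phi (η B β : ℝ) (g w : ℕ → E d) (t : ℕ) {x : E d} (hx : ‖x‖ < 1) (v : E d) :
    normIn (hessian (Phi d η B β g w t) x) v = √(phiForm d η B β g t x v) := by
  rw [normIn, hessian_Phi η B β g w t hx, phiForm]

theorem sq_normIn_hessian_Psi {η : ℝ} (hη : 0 ≤ η) {x : E d} (hx : ‖x‖ < 1) (v : E d) :
    normIn (hessian (Psi d η) x) v ^ 2 = η * d * ballHess x v := by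
  rw [normIn, hessian_Psi η hx, inner_psiHess_self, Real.sq_sqrt]
  exact mul_nonneg (by positivity) (ballHess_nonneg hx v)

theorem newtonDecrement_Phi (η B β : ℝ) (g w : ℕ → E d) (t : ℕ) {x : E d} (hx : ‖x‖ < 1) :
    newtonDecrement x (Phi d η B β g w t)
      = normIn (Ring.inverse (psiHess d η x + quadHess d η B β g t)) (phiGrad d η B β g w t x) := by
  rw [newtonDecrement, hessian_Phi η B β g w t hx, gradient_Phi η B β g w t hx]

theorem newtonDecrement_nonneg (x : E d) (f : E d → ℝ) : 0 ≤ newtonDecrement x f :=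
  Real.sqrt_nonneg _

variable {η B β : ℝ}

theorem inner_phiGrad_le (hη : 0 ≤ η) (hβ : 0 ≤ β) (hd : 1 ≤ d) (g w : ℕ → E d) (t : ℕ) {x : E d}
    (hx : ‖x‖ < 1) (v : E d) : inner ℝ (phiGrad d η B β g w t x) v
      ≤ newtonDecrement x (Phi d η B β g w t) * √(phiForm d η B β g t x v) := by
  rw [newtonDecrement_Phi η B β g w t hx]
  exact (posForm_phi hη hβ hd g t hx).inner_le_normIn_inverse _ _

theorem newtonDecrement_Phi_le (hη : 0 ≤ η) (hβ : 0 ≤ β) (hd : 1 ≤ d) (g w : ℕ → E d) (t : ℕ)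
    {x : E d} (hx : ‖x‖ < 1) {c : ℝ} (hc : 0 ≤ c)
    (h : ∀ v, inner ℝ (phiGrad d η B β g w t x) v ≤ c * √(phiForm d η B β g t x v)) :
    newtonDecrement x (Phi d η B β g w t) ≤ c := by
  rw [newtonDecrement_Phi η B β g w t hx]
  exact (posForm_phi hη hβ hd g t hx).normIn_inverse_le hc h

theorem phiGrad_eq_zero_of_isFTRL {g w : ℕ → E d} {t : ℕ} {x : E d}
    (hx : IsFTRL d η B β g w t x) : phiGrad d η B β g w t x = 0 := by
  have hx1 : ‖x‖ < 1 := by simpa using hx.1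
  rw [← gradient_Phi η B β g w t hx1, gradient,
    (hx.2.isLocalMin (Metric.isOpen_ball.mem_nhds hx.1)).fderiv_eq_zero, map_zero]

theorem phiForm_neg (g : ℕ → E d) (t : ℕ) (x v : E d) :
    phiForm d η B β g t x (-v) = phiForm d η B β g t x v := by
  rw [phiForm, phiForm, map_neg, inner_neg_neg]

theorem phiGrad_one_zero (g w : ℕ → E d) : phiGrad d η B β g w 1 0 = 0 := by
  simp [phiGrad, ballGrad]

/-- The gap between an iterate and the minimiser, from the barrier geometry. -/
theorem inner_phiGrad_gap (g w : ℕ → E d) (t : ℕ) {x y : E d} (hη : 0 ≤ η)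
    (hy : ‖y‖ < 1) (hx : IsFTRL d η B β g w t x) :
    η * d * (ballHess y (x - y) / (1 + √(ballHess y (x - y)))) + quadForm d η B β g t (x - y)
      ≤ inner ℝ (phiGrad d η B β g w t y) (y - x) := by
  have hx1 : ‖x‖ < 1 := by simpa using hx.1
  have h := quadHess_apply_sub η B β g w t y (x - y)
  have hyx : y + (x - y) = x := by abel
  rw [hyx, phiGrad_eq_zero_of_isFTRL hx, zero_sub] at h
  have h2 : inner ℝ (phiGrad d η B β g w t y) (y - x)
      = η * d * inner ℝ (ballGrad x - ballGrad y) (x - y) + quadForm d η B β g t (x - y) := by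
    rw [← neg_sub x y, inner_neg_right, ← inner_neg_left, h, inner_add_left, inner_smul_left,
      quadForm, real_inner_comm (x - y) (quadHess d η B β g t (x - y))]
    rfl
  rw [h2]
  have := le_inner_ballGrad_sub hy (by rwa [hyx] : ‖y + (x - y)‖ < 1)
  rw [hyx] at this
  gcongr

/-- Strong monotonicity gives $r\le(1+s)\lambda$, where $r$ is the gap in the full local norm and
$s$ its barrier part. As $\sqrt{\eta d}\,s\le r$, the assumption on $\lambda$ yields $s\lambda\le
r/2$, which is absorbed. -/
theorem gap_le_two_mul_newtonDecrement (hη : 1 ≤ η) (hβ : 0 ≤ β) (hd : 1 ≤ d)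
    (g w : ℕ → E d) (t : ℕ) {x y : E d} (hy : ‖y‖ < 1) (hx : IsFTRL d η B β g w t x)
    (hl : newtonDecrement y (Phi d η B β g w t) ≤ √(η * d) / 2) :
    normIn (hessian (Phi d η B β g w t) y) (y - x)
      ≤ 2 * newtonDecrement y (Phi d η B β g w t) := by
  have hd0 : (0 : ℝ) < d := by exact_mod_cast hd
  have hη0 : 0 < η := by linarith
  rw [normIn_hessian_Phi η B β g w t hy]
  have h1 := inner_phiGrad_gap g w t hη0.le hy hx
  have h2 := inner_phiGrad_le (B := B) hη0.le hβ hd g w t hy (y - x)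
  have hq := quadForm_nonneg (B := B) hη0.le hβ g t (x - y)
  have hb := ballHess_nonneg hy (x - y)
  have ha : 0 < η * d := by positivity
  have hr := Real.sq_sqrt (phiForm_nonneg (B := B) hη0.le hβ g t hy (y - x))
  have hr0 := Real.sqrt_nonneg (phiForm d η B β g t y (y - x))
  have hs := Real.sq_sqrt hb
  have hs0 := Real.sqrt_nonneg (ballHess y (x - y))
  have hA := Real.sq_sqrt ha.le
  have hA0 := Real.sqrt_pos.mpr ha
  have hneg : phiForm d η B β g t y (y - x) = phiForm d η B β g t y (x - y) := by
    rw [← neg_sub x y, phiForm_neg]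
  rw [hneg] at hr hr0 h2 ⊢
  set r := √(phiForm d η B β g t y (x - y))
  set s := √(ballHess y (x - y))
  set A := √(η * d)
  set l := newtonDecrement y (Phi d η B β g w t)
  rw [phiForm_eq] at hr
  have hsr : A * s ≤ r := by
    apply le_of_sq_le_sq _ hr0
    rw [mul_pow, hA, hs, hr]
    linarith
  have h3 : r ^ 2 ≤ (1 + s) * (l * r) := by
    have h4 : η * d * (ballHess y (x - y) / (1 + s)) + quadForm d η B β g t (x - y) ≤ l * r :=
      h1.trans h2
    have h5 : (1 + s) * (η * d * (ballHess y (x - y) / (1 + s)) + quadForm d η B β g t (x - y))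
        ≤ (1 + s) * (l * r) := by gcongr
    have h6 : (1 + s) * (η * d * (ballHess y (x - y) / (1 + s)))
        = η * d * ballHess y (x - y) := by field_simp
    nlinarith
  rcases hr0.eq_or_lt with h0 | h0
  · rw [← h0]
    exact mul_nonneg zero_le_two (newtonDecrement_nonneg _ _)
  · have h4 : r ≤ (1 + s) * l := by nlinarith
    have h5 : s * l ≤ r / 2 := by
      calc s * l ≤ s * (A / 2) := by gcongr
        _ ≤ _ := by linarith
    linarith

theorem quadForm_ge (hβ : 0 ≤ β) (g : ℕ → E d) (t : ℕ) (v : E d) :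
    (d + B ^ 2 * η) * ‖v‖ ^ 2 ≤ quadForm d η B β g t v := by
  rw [quadForm_eq]
  have := mul_nonneg hβ
    (Finset.sum_nonneg fun s (_ : s ∈ Finset.Ico 1 t) => sq_nonneg (inner ℝ (g s) v))
  linarith

theorem phiForm_mono (hβ : 0 ≤ β) (g : ℕ → E d) (t : ℕ) (x v : E d) :
    phiForm d η B β g t x v ≤ phiForm d η B β g (t + 1) x v := by
  rw [phiForm_eq, phiForm_eq]
  linarith [quadForm_mono (η := η) (B := B) hβ g t v]

/-- One round changes the Newton decrement at the current point by at most `1 / √η`. -/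
theorem newtonDecrement_succ_le (hη : 1 ≤ η) (hB : 0 < B) (hβ : 0 ≤ β) (hd : 1 ≤ d)
    (g w : ℕ → E d) {t : ℕ} (ht : 1 ≤ t) (hg : ‖g t‖ ≤ B) (hw : ‖w t‖ < 1) :
    newtonDecrement (w t) (Phi d η B β g w (t + 1))
      ≤ newtonDecrement (w t) (Phi d η B β g w t) + 1 / √η := by
  have hη0 : 0 < η := by linarith
  have h0 := newtonDecrement_nonneg (w t) (Phi d η B β g w t)
  refine newtonDecrement_Phi_le hη0.le hβ hd g w (t + 1) hw (by positivity) fun v => ?_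
  rw [phiGrad_succ_self η B β g w ht, inner_add_left, add_mul]
  have h1 := inner_phiGrad_le (B := B) hη0.le hβ hd g w t hw v
  have h2 := Real.sqrt_le_sqrt (phiForm_mono (η := η) (B := B) hβ g t (w t) v)
  refine add_le_add (h1.trans (by gcongr)) ?_
  -- The summand $\eta B^2I$ of the Hessian is what bounds $g_t$ in the dual norm, by $B/\sqrt{\eta
  -- B^2}=1/\sqrt\eta$.
  calc inner ℝ (g t) v ≤ ‖g t‖ * ‖v‖ := real_inner_le_norm _ _
    _ ≤ B * ‖v‖ := by gcongr
    _ = 1 / √η * √(η * (B * ‖v‖) ^ 2) := by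
      rw [Real.sqrt_mul hη0.le, Real.sqrt_sq (by positivity)]
      field_simp
    _ ≤ _ := by
      gcongr
      rw [phiForm_eq]
      have h3 := quadForm_ge (η := η) (B := B) hβ g (t + 1) v
      have h4 := ballHess_nonneg hw v
      have h5 : 0 ≤ η * d * ballHess (w t) v := by positivity
      have h6 : (0 : ℝ) ≤ d * ‖v‖ ^ 2 := by positivity
      nlinarith

end Decrement

end OQNS

namespace OQNS

/-! ### One step: gradient after the step, energy, quadratic decrease. -/

section Step

variable {d : ℕ} {η B β c : ℝ} {T : ℕ} {rule : LandmarkRule} {g u w : ℕ → E d}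

theorem phiForm_le_of_step (hη : 0 ≤ η) (hβ : 0 ≤ β) (t : ℕ) {x v : E d} (hx : ‖x‖ < 1)
    (hxv : ‖x + v‖ < 1) (hv : ballHess x v ≤ 1) (z : E d) :
    phiForm d η B β g t x z ≤ 2 * (1 + √(ballHess x v)) ^ 2 * phiForm d η B β g t (x + v) z := by
  rw [phiForm_eq, phiForm_eq]
  have h1 := ballHess_le_of_step hx hxv hv z
  have h2 := quadForm_nonneg (B := B) hη hβ g t z
  have h3 := Real.sqrt_nonneg (ballHess x v)
  have h4 : 1 ≤ 2 * (1 + √(ballHess x v)) ^ 2 := by nlinarith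
  have h5 : η * d * ballHess x z
      ≤ η * d * (2 * (1 + √(ballHess x v)) ^ 2 * ballHess (x + v) z) := by gcongr
  nlinarith

/-- After an inexact Newton step, the gradient consists of the barrier remainder and of the
residual of the step. -/
theorem abs_inner_phiGrad_sub_gradRem_le (hd : 1 ≤ d) (hT : 1 ≤ T) (hη : 1 ≤ η) (hB : 0 < B)
    (hβ : 0 < β) (hc : c ∈ Set.Ioo (0 : ℝ) 1) (hrun : IsRun d η B β c T rule g u w) {t : ℕ}
    (ht : t ∈ Finset.Icc 1 T) (hw : ‖w t‖ < 1) (hu : LandmarkClose c (u t) (w t))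
    (hw' : ‖w (t + 1)‖ < 1) (hs : ballHess (w t) (w (t + 1) - w t) ≤ 1) {κ : ℝ} (hκ : 0 ≤ κ)
    (hκs : 2 * (1 + √(ballHess (w t) (w (t + 1) - w t))) ^ 2 ≤ κ ^ 2) (z : E d) :
    |inner ℝ (phiGrad d η B β g w (t + 1) (w (t + 1))) z
        - η * d * inner ℝ (gradRem (w t) (w (t + 1) - w t)) z|
      ≤ κ * neumannError d η B β c T
        * (√(phiForm d η B β g (t + 1) (w t) (w (t + 1) - w t))
          * √(phiForm d η B β g (t + 1) (w (t + 1)) z)) := by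
  have hη0 : 0 < η := by linarith
  have hε := (neumannError_bounds (d := d) hd hT hη hB hβ hc).1
  have h1 := abs_inner_step_residual_le hd hη hβ hc hrun ht hw hu z
  have h2 := phiGrad_add η B β g w (t + 1) (w t) (w (t + 1) - w t)
  have e : w t + (w (t + 1) - w t) = w (t + 1) := by abel
  rw [e] at h2
  rw [h2, inner_add_left, inner_smul_left]
  have e2 : (starRingEnd ℝ) (η * d) = η * d := rfl
  rw [e2, add_sub_cancel_left]
  refine h1.trans ?_
  have h3 := phiForm_le_of_step (g := g) (B := B) hη0.le hβ.le (t + 1) hw (by rwa [e]) hs z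
  rw [e] at h3
  have h4 := phiForm_nonneg (B := B) hη0.le hβ.le g (t + 1) hw' z
  have h5 : √(phiForm d η B β g (t + 1) (w t) z)
      ≤ κ * √(phiForm d η B β g (t + 1) (w (t + 1)) z) := by
    rw [← Real.sqrt_sq hκ, ← Real.sqrt_mul (sq_nonneg κ)]
    exact Real.sqrt_le_sqrt (h3.trans (by gcongr))
  calc _ ≤ neumannError d η B β c T
        * (√(phiForm d η B β g (t + 1) (w t) (w (t + 1) - w t))
          * (κ * √(phiForm d η B β g (t + 1) (w (t + 1)) z))) := by gcongr
    _ = _ := by ring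

theorem inner_phiGrad_succ_le (hd : 1 ≤ d) (hT : 1 ≤ T) (hη : 1 ≤ η) (hB : 0 < B)
    (hβ : 0 < β) (hc : c ∈ Set.Ioo (0 : ℝ) 1) (hrun : IsRun d η B β c T rule g u w) {t : ℕ}
    (ht : t ∈ Finset.Icc 1 T) (hw : ‖w t‖ < 1) (hu : LandmarkClose c (u t) (w t))
    (hw' : ‖w (t + 1)‖ < 1) (hs : ballHess (w t) (w (t + 1) - w t) ≤ 1) {κ : ℝ} (hκ : 0 ≤ κ)
    (hκs : 2 * (1 + √(ballHess (w t) (w (t + 1) - w t))) ^ 2 ≤ κ ^ 2) (z : E d) :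
    inner ℝ (phiGrad d η B β g w (t + 1) (w (t + 1))) z
      ≤ η * d * (ballHess (w t) (w (t + 1) - w t) * √(ballHess (w (t + 1)) z))
        + κ * neumannError d η B β c T
        * (√(phiForm d η B β g (t + 1) (w t) (w (t + 1) - w t))
          * √(phiForm d η B β g (t + 1) (w (t + 1)) z)) := by
  have hη0 : 0 < η := by linarith
  have h1 := (abs_le.mp (abs_inner_phiGrad_sub_gradRem_le hd hT hη hB hβ hc hrun ht hw hu hw' hs hκ
    hκs z)).2
  have e : w t + (w (t + 1) - w t) = w (t + 1) := by abel
  have h2 := (abs_le.mp (abs_inner_gradRem_le hw (by rwa [e]) hs z)).2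
  rw [e] at h2
  have h3 : η * d * inner ℝ (gradRem (w t) (w (t + 1) - w t)) z
      ≤ η * d * (ballHess (w t) (w (t + 1) - w t) * √(ballHess (w (t + 1)) z)) := by gcongr
  linarith

theorem neg_inner_phiGrad_succ_le (hd : 1 ≤ d) (hT : 1 ≤ T) (hη : 1 ≤ η) (hB : 0 < B)
    (hβ : 0 < β) (hc : c ∈ Set.Ioo (0 : ℝ) 1) (hrun : IsRun d η B β c T rule g u w) {t : ℕ}
    (ht : t ∈ Finset.Icc 1 T) (hw : ‖w t‖ < 1) (hu : LandmarkClose c (u t) (w t))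
    (hw' : ‖w (t + 1)‖ < 1) (hs : ballHess (w t) (w (t + 1) - w t) ≤ 0.5) {κ : ℝ} (hκ : 0 ≤ κ)
    (hκs : 2 * (1 + √(ballHess (w t) (w (t + 1) - w t))) ^ 2 ≤ κ ^ 2) {z : E d}
    (hz : 0 ≤ radialPart (w (t + 1)) z) :
    -inner ℝ (phiGrad d η B β g w (t + 1) (w (t + 1))) z
      ≤ η * d * (0.66 * ballHess (w t) (w (t + 1) - w t) * √(ballHess (w (t + 1)) z))
        + κ * neumannError d η B β c T
        * (√(phiForm d η B β g (t + 1) (w t) (w (t + 1) - w t))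
          * √(phiForm d η B β g (t + 1) (w (t + 1)) z)) := by
  have hη0 : 0 < η := by linarith
  have h1 := (abs_le.mp (abs_inner_phiGrad_sub_gradRem_le hd hT hη hB hβ hc hrun ht hw hu hw'
    (by linarith) hκ hκs z)).1
  have e : w t + (w (t + 1) - w t) = w (t + 1) := by abel
  have h2 := neg_inner_gradRem_le hw (by rwa [e]) hs (z := z) (by rwa [e])
  rw [e] at h2
  have h3 : η * d * -inner ℝ (gradRem (w t) (w (t + 1) - w t)) z
      ≤ η * d * (0.66 * ballHess (w t) (w (t + 1) - w t) * √(ballHess (w (t + 1)) z)) := by gcongr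
  linarith

theorem newtonDecrement_succ_step_le (hd : 1 ≤ d) (hT : 1 ≤ T) (hη : 1 ≤ η) (hB : 0 < B)
    (hβ : 0 < β) (hc : c ∈ Set.Ioo (0 : ℝ) 1) (hrun : IsRun d η B β c T rule g u w) {t : ℕ}
    (ht : t ∈ Finset.Icc 1 T) (hw : ‖w t‖ < 1) (hu : LandmarkClose c (u t) (w t))
    (hw' : ‖w (t + 1)‖ < 1) (hs : ballHess (w t) (w (t + 1) - w t) ≤ 1) {κ : ℝ} (hκ : 0 ≤ κ)
    (hκs : 2 * (1 + √(ballHess (w t) (w (t + 1) - w t))) ^ 2 ≤ κ ^ 2) :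
    newtonDecrement (w (t + 1)) (Phi d η B β g w (t + 1))
      ≤ √(η * d) * ballHess (w t) (w (t + 1) - w t) + κ * neumannError d η B β c T
        * √(phiForm d η B β g (t + 1) (w t) (w (t + 1) - w t)) := by
  have hη0 : 0 < η := by linarith
  have hε := (neumannError_bounds (d := d) hd hT hη hB hβ hc).1
  have hb := ballHess_nonneg hw (w (t + 1) - w t)
  refine newtonDecrement_Phi_le hη0.le hβ.le hd g w (t + 1) hw' (by positivity) fun v => ?_
  refine (inner_phiGrad_succ_le hd hT hη hB hβ hc hrun ht hw hu hw' hs hκ hκs v).trans ?_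
  rw [add_mul]
  refine add_le_add ?_ (by rw [mul_assoc (κ * _)])
  have h1 : √(η * d) * √(ballHess (w (t + 1)) v) ≤ √(phiForm d η B β g (t + 1) (w (t + 1)) v) := by
    rw [← Real.sqrt_mul (by positivity)]
    apply Real.sqrt_le_sqrt
    rw [phiForm_eq]
    linarith [quadForm_nonneg (B := B) hη0.le hβ.le g (t + 1) v]
  have h2 := Real.mul_self_sqrt (by positivity : 0 ≤ η * d)
  calc η * d * (ballHess (w t) (w (t + 1) - w t) * √(ballHess (w (t + 1)) v))
      = √(η * d) * ballHess (w t) (w (t + 1) - w t) * (√(η * d) * √(ballHess (w (t + 1)) v)) := by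
        linear_combination -(ballHess (w t) (w (t + 1) - w t) * √(ballHess (w (t + 1)) v)) * h2
    _ ≤ _ := by gcongr

/-- The energy inequality of an inexact Newton step. -/
theorem step_energy_le (hd : 1 ≤ d) (hη : 1 ≤ η)
    (hβ : 0 < β) (hc : c ∈ Set.Ioo (0 : ℝ) 1) (hrun : IsRun d η B β c T rule g u w) {t : ℕ}
    (ht : t ∈ Finset.Icc 1 T) (hw : ‖w t‖ < 1) (hu : LandmarkClose c (u t) (w t)) :
    (1 - neumannError d η B β c T) * phiForm d η B β g (t + 1) (w t) (w (t + 1) - w t)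
      ≤ -inner ℝ (phiGrad d η B β g w (t + 1) (w t)) (w (t + 1) - w t) := by
  have hη0 : 0 < η := by linarith
  have h1 := (abs_le.mp (abs_inner_step_residual_le hd hη hβ hc hrun ht hw hu
    (w (t + 1) - w t))).2
  rw [Real.mul_self_sqrt (phiForm_nonneg hη0.le hβ.le g _ hw _), inner_add_left,
    real_inner_comm (w (t + 1) - w t) ((psiHess d η (w t) + quadHess d η B β g (t + 1)) _)] at h1
  change _ + phiForm d η B β g (t + 1) (w t) (w (t + 1) - w t) ≤ _ at h1
  linarith

/-- Testing with the step itself and dividing by its length gives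
$(1-\varepsilon)\|\Delta\|\le\lambda$, and $(300/299)^2<1.01$. -/
theorem step_length_le (hd : 1 ≤ d) (hT : 1 ≤ T) (hη : 1 ≤ η) (hB : 0 < B)
    (hβ : 0 < β) (hc : c ∈ Set.Ioo (0 : ℝ) 1) (hrun : IsRun d η B β c T rule g u w) {t : ℕ}
    (ht : t ∈ Finset.Icc 1 T) (hw : ‖w t‖ < 1) (hu : LandmarkClose c (u t) (w t)) :
    phiForm d η B β g (t + 1) (w t) (w (t + 1) - w t)
      ≤ 1.01 * newtonDecrement (w t) (Phi d η B β g w (t + 1)) ^ 2 := by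
  have hη0 : 0 < η := by linarith
  obtain ⟨hε0, hε1, -⟩ := neumannError_bounds (d := d) hd hT hη hB hβ hc
  have h1 := step_energy_le hd hη hβ hc hrun ht hw hu
  have h2 := inner_phiGrad_le (B := B) hη0.le hβ.le hd g w (t + 1) hw (-(w (t + 1) - w t))
  rw [phiForm_neg, inner_neg_right] at h2
  have h3 := phiForm_nonneg (B := B) hη0.le hβ.le g (t + 1) hw (w (t + 1) - w t)
  have h4 := Real.sq_sqrt h3
  have h5 := Real.sqrt_nonneg (phiForm d η B β g (t + 1) (w t) (w (t + 1) - w t))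
  have h6 := newtonDecrement_nonneg (w t) (Phi d η B β g w (t + 1))
  have h7 := h1.trans h2
  rw [← h4]
  nth_rewrite 1 [← h4] at h7
  set r := √(phiForm d η B β g (t + 1) (w t) (w (t + 1) - w t))
  set l := newtonDecrement (w t) (Phi d η B β g w (t + 1))
  set ε := neumannError d η B β c T
  rcases h5.eq_or_lt with h0 | h0
  · rw [← h0, zero_pow two_ne_zero]; positivity
  · have h8 : 299 / 300 * r ≤ l := by nlinarith only [h7, h0, hε1]
    nlinarith only [h8, h5]

/-- The quadratic decrease of the Newton decrement. -/
theorem newtonDecrement_succ_le_sq (hd : 1 ≤ d) (hT : 1 ≤ T) (hη : 1 ≤ η) (hB : 0 < B)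
    (hβ : 0 < β) (hc : c ∈ Set.Ioo (0 : ℝ) 1) (hrun : IsRun d η B β c T rule g u w) {t : ℕ}
    (ht : t ∈ Finset.Icc 1 T) (hw : ‖w t‖ < 1) (hu : LandmarkClose c (u t) (w t))
    (hw' : ‖w (t + 1)‖ < 1) (hs : ballHess (w t) (w (t + 1) - w t) ≤ 1) :
    √(η * d) / 2 * (newtonDecrement (w (t + 1)) (Phi d η B β g w (t + 1)) - 1 / T)
      ≤ newtonDecrement (w t) (Phi d η B β g w (t + 1)) ^ 2 := by
  have hη0 : 0 < η := by linarith
  have hd1 : (1 : ℝ) ≤ d := by exact_mod_cast hd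
  have hT0 : (0 : ℝ) < T := by exact_mod_cast hT
  obtain ⟨hε0, hε1, hε2⟩ := neumannError_bounds (d := d) hd hT hη hB hβ hc
  have hb := ballHess_nonneg hw (w (t + 1) - w t)
  have hθ : √(ballHess (w t) (w (t + 1) - w t)) ≤ 1 := Real.sqrt_le_one.mpr hs
  have hθ0 := Real.sqrt_nonneg (ballHess (w t) (w (t + 1) - w t))
  -- The value $\kappa=3$ is allowed because $2(1+\theta)^2\le 8$ for local length $\theta\le 1$.
  have h1 := newtonDecrement_succ_step_le hd hT hη hB hβ hc hrun ht hw hu hw' hs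
    (κ := 3) (by norm_num) (by nlinarith)
  have h2 := step_length_le hd hT hη hB hβ hc hrun ht hw hu
  have hq := quadForm_nonneg (B := B) hη0.le hβ.le g (t + 1) (w (t + 1) - w t)
  have hs := phiForm_eq η B β g (t + 1) (w t) (w (t + 1) - w t)
  have hs0 := phiForm_nonneg (B := B) hη0.le hβ.le g (t + 1) hw (w (t + 1) - w t)
  have hs2 := Real.sq_sqrt hs0
  have hA := Real.sq_sqrt (by positivity : 0 ≤ η * d)
  have hA1 : 1 ≤ √(η * d) := Real.one_le_sqrt.mpr (one_le_mul_of_one_le_of_one_le hη hd1)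
  set r := √(phiForm d η B β g (t + 1) (w t) (w (t + 1) - w t))
  set l := newtonDecrement (w t) (Phi d η B β g w (t + 1))
  set ε := neumannError d η B β c T
  set A := √(η * d)
  set θ := ballHess (w t) (w (t + 1) - w t)
  have h3 : A ^ 2 * θ ≤ r ^ 2 := by rw [hA]; linarith
  -- Young's inequality: half of $r^2$ still fits into the factor $2$ of the claim, and
  -- $\varepsilon^2A^2\le 1/(3000T)$ is covered by the $1/T$ term.
  have h4 : A * (3 * ε * r) ≤ 1 / 2 * r ^ 2 + 9 / 2 * (ε ^ 2 * A ^ 2) := by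
    nlinarith only [sq_nonneg (r - 3 * (ε * A))]
  have h5 : ε ^ 2 * A ^ 2 ≤ 1 / 3000 * (1 / T) := by
    rw [hA, ← div_eq_mul_one_div, le_div_iff₀ hT0, ← mul_assoc]
    linarith
  have h6 : 0 < 1 / (T : ℝ) := by positivity
  have h7 : 1 / (T : ℝ) ≤ A * (1 / T) := le_mul_of_one_le_left h6.le hA1
  have h8 : A * newtonDecrement (w (t + 1)) (Phi d η B β g w (t + 1)) ≤ A * (A * θ + 3 * ε * r) :=
    mul_le_mul_of_nonneg_left h1 (by linarith)
  rw [← hs2] at h2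
  have hl := sq_nonneg l
  nlinarith only [h2, h3, h4, h5, h6, h7, h8, hl]

end Step

end OQNS

namespace OQNS

/-! ### From a stable run to the stated bounds. -/

section Conclusion

variable {d : ℕ} {η B β c : ℝ} {T : ℕ} {rule : LandmarkRule} {g u w x : ℕ → E d}

/-- The estimates naturally pair round $t$ with $t+1$, the claims pair $t-1$ with $t$. The shift is
free because the step from $w_0$ to $w_1$ is trivial. -/
theorem sum_Icc_pred_le {P : ℕ → ℝ} (h0 : P 0 = 0) (T : ℕ) (hP : ∀ t ∈ Finset.Icc 1 T, 0 ≤ P t) :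
    ∑ t ∈ Finset.Icc 1 T, P (t - 1) ≤ ∑ t ∈ Finset.Icc 1 T, P t := by
  have h1 : ∑ t ∈ Finset.Icc 1 T, P (t - 1) = ∑ t ∈ Finset.range T, P t := by
    rw [← Finset.Ico_add_one_right_eq_Icc, Finset.sum_Ico_eq_sum_range]
    refine Finset.sum_congr (by simp) fun t _ => by simp
  have h2 : ∑ t ∈ Finset.Icc 1 T, P t = ∑ t ∈ Finset.range (T + 1), P t := by
    rw [Finset.range_eq_Ico, Finset.sum_eq_sum_Ico_succ_bot (by omega), h0, zero_add,
      Finset.Ico_add_one_right_eq_Icc]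
  rw [h1, h2, Finset.sum_range_succ]
  rcases Nat.eq_zero_or_pos T with rfl | hT
  · simp [h0]
  · linarith [hP T (by simp; omega)]

/-- The iterates are well behaved up to round `t`. -/
structure GoodIterate (d : ℕ) (η B β c : ℝ) (g u w : ℕ → E d) (t : ℕ) : Prop where
  norm_lt : ‖w t‖ < 1
  close : LandmarkClose c (u t) (w t)
  decrement_le : newtonDecrement (w t) (Phi d η B β g w t) ≤ 1 / √η
  gap_le : ∀ x, IsFTRL d η B β g w t x →
    √(phiForm d η B β g t (w t) (w t - x)) ≤ 2 * newtonDecrement (w t) (Phi d η B β g w t)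

/-- The stability properties of a run from which the bounds follow. -/
structure StableRun (d : ℕ) (η B β c : ℝ) (T : ℕ) (g u w : ℕ → E d) : Prop where
  good : ∀ t ∈ Finset.Icc 1 (T + 1), GoodIterate d η B β c g u w t
  step_le : ∀ t ∈ Finset.Icc 1 T, ballHess (w t) (w (t + 1) - w t) ≤ 1
  sum_decrement_le : ∑ t ∈ Finset.Icc 1 T,
      newtonDecrement (w (t + 1)) (Phi d η B β g w (t + 1))
    ≤ 1 / √(η * d) * (8 / 3 * (d / β * Real.log (1 + β * B ^ 2 * T / d))) + 1 / 2
  sum_two_step_le : ∑ t ∈ Finset.Icc 1 T, (η * d * ballHess (w t) (w (t + 1) - w t)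
      + η * d * ballHess (w (t + 1)) (w (t + 1) - w t))
    ≤ 8 * (d / β * Real.log (1 + β * B ^ 2 * T / d))

theorem log_potential_le (hd : 1 ≤ d) (hβ : β ∈ Set.Ioo (0 : ℝ) 1) :
    Real.log (1 + β * B ^ 2 * T / d) ≤ Real.log (d + B ^ 2 * T / d) := by
  have hd1 : (1 : ℝ) ≤ d := by exact_mod_cast hd
  have hβ0 := hβ.1
  have h1 : β * B ^ 2 * T / d ≤ B ^ 2 * T / d := by
    rw [mul_assoc, mul_div_assoc]
    exact mul_le_of_le_one_left (by positivity) hβ.2.le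
  have h2 : 0 ≤ β * B ^ 2 * T / d := by positivity
  exact Real.log_le_log (by linarith) (by linarith)

theorem newtonDecrement_one (hw1 : w 1 = 0) : newtonDecrement (w 1) (Phi d η B β g w 1) = 0 := by
  rw [newtonDecrement_Phi η B β g w 1 (by simp [hw1]), hw1, phiGrad_one_zero]
  simp [normIn]

theorem newtonDecrement_zero (hw0 : w 0 = 0) (hw1 : w 1 = 0) :
    newtonDecrement (w 0) (Phi d η B β g w 1) = 0 := by
  rw [hw0, ← hw1, newtonDecrement_one hw1]

theorem StableRun.decrement_chain (hd : 1 ≤ d) (hT : 1 ≤ T) (hη : 1 ≤ η) (hB : 0 < B)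
    (hβ : 0 < β) (hc : c ∈ Set.Ioo (0 : ℝ) 1) (hg : ∀ t ∈ Finset.Icc 1 T, ‖g t‖ ≤ B)
    (hrun : IsRun d η B β c T rule g u w) (hst : StableRun d η B β c T g u w) {t : ℕ}
    (ht : t ∈ Finset.Icc 1 (T + 1)) :
    √(η * d) / 2 * (newtonDecrement (w t) (Phi d η B β g w t) - 1 / T)
        ≤ newtonDecrement (w (t - 1)) (Phi d η B β g w t) ^ 2 ∧
      newtonDecrement (w (t - 1)) (Phi d η B β g w t) ^ 2 ≤ 4 / η := by
  have hη0 : 0 < η := by linarith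
  rcases Nat.exists_eq_succ_of_ne_zero (by simp at ht; omega : t ≠ 0) with ⟨k, rfl⟩
  -- Round $1$ rests on the convention $w_0=w_1=0$: the gradient of $\Phi_1$ vanishes there and so
  -- do both decrements.
  rcases Nat.eq_zero_or_pos k with rfl | hk
  · simp only [Nat.succ_eq_add_one, zero_add, Nat.sub_self]
    rw [newtonDecrement_one hrun.w_one, newtonDecrement_zero hrun.w_zero hrun.w_one]
    have : 0 ≤ √(η * d) / 2 * (1 / T) := by positivity
    refine ⟨by linarith, by simp; positivity⟩
  · have hk1 : k ∈ Finset.Icc 1 T := by simp at ht ⊢; omega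
    have hk2 : k ∈ Finset.Icc 1 (T + 1) := by simp at ht ⊢; omega
    have h1 := hst.good k hk2
    have h2 := hst.good (k + 1) ht
    simp only [Nat.succ_eq_add_one, Nat.add_sub_cancel]
    refine ⟨newtonDecrement_succ_le_sq hd hT hη hB hβ hc hrun hk1 h1.norm_lt h1.close h2.norm_lt
      (hst.step_le k hk1), ?_⟩
    have h3 := newtonDecrement_succ_le hη hB hβ.le hd g w hk (hg k hk1) h1.norm_lt
    have h4 := h1.decrement_le
    calc newtonDecrement (w k) (Phi d η B β g w (k + 1)) ^ 2 ≤ (1 / √η + 1 / √η) ^ 2 :=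
          pow_le_pow_left₀ (newtonDecrement_nonneg _ _) (by linarith) 2
      _ = 4 * (1 / √η) ^ 2 := by ring
      _ = 4 / η := by rw [div_pow, Real.sq_sqrt hη0.le]; ring

theorem newtonDecrement_succ_le_energy (hd : 1 ≤ d) (hT : 1 ≤ T) (hη : 1 ≤ η) (hB : 0 < B)
    (hβ : 0 < β) (hc : c ∈ Set.Ioo (0 : ℝ) 1) (hrun : IsRun d η B β c T rule g u w) {t : ℕ}
    (ht : t ∈ Finset.Icc 1 T) (hw : ‖w t‖ < 1) (hu : LandmarkClose c (u t) (w t))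
    (hw' : ‖w (t + 1)‖ < 1) (hs : ballHess (w t) (w (t + 1) - w t) ≤ 1) :
    newtonDecrement (w (t + 1)) (Phi d η B β g w (t + 1)) ≤ 1 / √(η * d) *
      (η * d * ballHess (w t) (w (t + 1) - w t)
        + 1 / 100 * phiForm d η B β g (t + 1) (w t) (w (t + 1) - w t)) + 1 / 2 * (1 / T) := by
  have hη0 : 0 < η := by linarith
  have hd1 : (1 : ℝ) ≤ d := by exact_mod_cast hd
  have hT0 : (0 : ℝ) < T := by exact_mod_cast hT
  obtain ⟨hε0, hε1, hε2⟩ := neumannError_bounds (d := d) hd hT hη hB hβ hc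
  have hb := ballHess_nonneg hw (w (t + 1) - w t)
  have hθ : √(ballHess (w t) (w (t + 1) - w t)) ≤ 1 := Real.sqrt_le_one.mpr hs
  have hθ0 := Real.sqrt_nonneg (ballHess (w t) (w (t + 1) - w t))
  have h3 := newtonDecrement_succ_step_le hd hT hη hB hβ hc hrun ht hw hu hw' hs
    (κ := 3) (by norm_num) (by nlinarith)
  have hs2 := Real.sq_sqrt (phiForm_nonneg (B := B) hη0.le hβ.le g (t + 1) hw (w (t + 1) - w t))
  have hA := Real.sq_sqrt (by positivity : 0 ≤ η * d)
  have hA1 : 1 ≤ √(η * d) := Real.one_le_sqrt.mpr (one_le_mul_of_one_le_of_one_le hη hd1)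
  rw [← hs2, ← hA]
  set r := √(phiForm d η B β g (t + 1) (w t) (w (t + 1) - w t))
  set ε := neumannError d η B β c T
  set A := √(η * d)
  set θ := ballHess (w t) (w (t + 1) - w t)
  have h5 : ε ^ 2 * A ^ 2 ≤ 1 / 3000 * (1 / T) := by
    rw [hA, ← div_eq_mul_one_div, le_div_iff₀ hT0, ← mul_assoc]
    linarith
  have h6 : 0 < 1 / (T : ℝ) := by positivity
  -- Young's inequality again, now weighted so that only $r^2/100$ is charged to the energy;
  -- $225/3000$ stays below the allowed $1/2$.
  have h7 : A * (3 * ε * r) ≤ 1 / 100 * r ^ 2 + 225 * (ε ^ 2 * A ^ 2) := by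
    nlinarith only [sq_nonneg (1 / 10 * r - 15 * (ε * A))]
  have h8 : A * newtonDecrement (w (t + 1)) (Phi d η B β g w (t + 1))
      ≤ A * (A * θ + 3 * ε * r) := mul_le_mul_of_nonneg_left h3 (by linarith)
  have h9 : 1 / (T : ℝ) ≤ A * (1 / T) := le_mul_of_one_le_left h6.le hA1
  have h10 : A * (1 / A * (A ^ 2 * θ + 1 / 100 * r ^ 2) + 1 / 2 * (1 / T))
      = A ^ 2 * θ + 1 / 100 * r ^ 2 + 1 / 2 * (A * (1 / T)) := by
    field_simp
  refine le_of_mul_le_mul_left ?_ (by linarith : 0 < A)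
  rw [Real.sqrt_sq (by linarith : 0 ≤ A), h10]
  nlinarith only [h5, h7, h8, h9]

/-- A bound for the lengths of the steps bounds the Newton decrements. -/
theorem sum_newtonDecrement_le_of_sum_energy (hd : 1 ≤ d) (hT : 1 ≤ T) (hη : 1 ≤ η) (hB : 0 < B)
    (hβ : 0 < β) (hc : c ∈ Set.Ioo (0 : ℝ) 1) (hrun : IsRun d η B β c T rule g u w)
    (hgood : ∀ t ∈ Finset.Icc 1 (T + 1), GoodIterate d η B β c g u w t)
    (hstep : ∀ t ∈ Finset.Icc 1 T, ballHess (w t) (w (t + 1) - w t) ≤ 1) {M : ℝ}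
    (hsum : ∑ t ∈ Finset.Icc 1 T, (η * d * ballHess (w t) (w (t + 1) - w t)
      + 1 / 100 * phiForm d η B β g (t + 1) (w t) (w (t + 1) - w t)) ≤ M) :
    ∑ t ∈ Finset.Icc 1 T, newtonDecrement (w (t + 1)) (Phi d η B β g w (t + 1))
      ≤ 1 / √(η * d) * M + 1 / 2 := by
  have hT0 : (0 : ℝ) < T := by exact_mod_cast hT
  have h1 := Finset.sum_le_sum fun t (ht : t ∈ Finset.Icc 1 T) =>
    newtonDecrement_succ_le_energy hd hT hη hB hβ hc hrun ht
      (hgood t (by simp at ht ⊢; omega)).norm_lt (hgood t (by simp at ht ⊢; omega)).close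
      (hgood (t + 1) (by simp at ht ⊢; omega)).norm_lt (hstep t ht)
  rw [Finset.sum_add_distrib, ← Finset.mul_sum, Finset.sum_const, Nat.card_Icc,
    Nat.add_sub_cancel, nsmul_eq_mul] at h1
  have h2 : (T : ℝ) * (1 / 2 * (1 / T)) = 1 / 2 := by field_simp
  rw [h2] at h1
  refine h1.trans ?_
  gcongr

theorem StableRun.sum_gap_le (hd : 1 ≤ d) (hη : 1 ≤ η)
    (hβ : β ∈ Set.Ioo (0 : ℝ) 1)
    (hrun : IsRun d η B β c T rule g u w) (hst : StableRun d η B β c T g u w)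
    (hx : ∀ t ∈ Finset.Icc 1 T, IsFTRL d η B β g w t (x t)) :
    ∑ t ∈ Finset.Icc 1 T, √(phiForm d η B β g t (w t) (w t - x t))
      ≤ 1 + 16 * √d / (3 * β * √η) * Real.log (d + B ^ 2 * T / d) := by
  have hη0 : 0 < η := by linarith
  have hβ0 := hβ.1
  have hd0 : (0 : ℝ) < d := by exact_mod_cast hd
  have h1 := Finset.sum_le_sum fun t (ht : t ∈ Finset.Icc 1 T) =>
    (hst.good t (by simp at ht ⊢; omega)).gap_le (x t) (hx t ht)
  rw [← Finset.mul_sum] at h1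
  have h2 := sum_Icc_pred_le (P := fun t => newtonDecrement (w (t + 1)) (Phi d η B β g w (t + 1)))
    (newtonDecrement_one hrun.w_one) T (fun t _ => newtonDecrement_nonneg _ _)
  have h2' : ∑ t ∈ Finset.Icc 1 T, newtonDecrement (w t) (Phi d η B β g w t)
      = ∑ t ∈ Finset.Icc 1 T, newtonDecrement (w (t - 1 + 1)) (Phi d η B β g w (t - 1 + 1)) :=
    Finset.sum_congr rfl fun t ht => by rw [Nat.sub_add_cancel (Finset.mem_Icc.mp ht).1]
  have h3 := hst.sum_decrement_le.trans
    (add_le_add_left (mul_le_mul_of_nonneg_left (mul_le_mul_of_nonneg_left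
      (mul_le_mul_of_nonneg_left (log_potential_le (B := B) (T := T) hd hβ)
      (by positivity)) (by norm_num)) (by positivity)) _ :
      _ ≤ 1 / √(η * d) * (8 / 3 * (d / β * Real.log (d + B ^ 2 * T / d))) + 1 / 2)
  have h4 : 1 / √(η * d) * (8 / 3 * (d / β * Real.log (d + B ^ 2 * T / d)))
      = 1 / 2 * (16 * √d / (3 * β * √η) * Real.log (d + B ^ 2 * T / d)) := by
    rw [Real.sqrt_mul hη0.le]
    have h5 := Real.sq_sqrt hd0.le
    have h6 := Real.sqrt_pos.mpr hd0
    have h7 := Real.sqrt_pos.mpr hη0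
    field_simp
    rw [h5]
    ring
  rw [h4] at h3
  rw [h2'] at h1
  linarith

theorem StableRun.sum_sq_step_le (hd : 1 ≤ d) (hη : 1 ≤ η)
    (hβ : β ∈ Set.Ioo (0 : ℝ) 1)
    (hrun : IsRun d η B β c T rule g u w) (hst : StableRun d η B β c T g u w) :
    ∑ t ∈ Finset.Icc 1 T, normIn (hessian (Psi d η) (w t)) (w t - w (t - 1)) ^ 2
        + ∑ t ∈ Finset.Icc 1 T, normIn (hessian (Psi d η) (w (t - 1))) (w t - w (t - 1)) ^ 2
      ≤ 8 * d * Real.log (d + B ^ 2 * T / d) / β := by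
  have hη0 : 0 < η := by linarith
  have hβ0 := hβ.1
  have hd0 : (0 : ℝ) < d := by exact_mod_cast hd
  have hgood : ∀ t ≤ T, ‖w t‖ < 1 := fun t ht => by
    rcases Nat.eq_zero_or_pos t with rfl | h
    · simp [hrun.w_zero]
    · exact (hst.good t (by simp; omega)).norm_lt
  have h2 := sum_Icc_pred_le (P := fun t => η * d * ballHess (w t) (w (t + 1) - w t)
    + η * d * ballHess (w (t + 1)) (w (t + 1) - w t))
    (by simp [hrun.w_one, hrun.w_zero, ballHess]) T (fun t ht => by
      have := ballHess_nonneg (hst.good t (by simp at ht ⊢; omega)).norm_lt (w (t + 1) - w t)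
      have := ballHess_nonneg (hst.good (t + 1) (by simp at ht ⊢; omega)).norm_lt
        (w (t + 1) - w t)
      positivity)
  have h3 := (h2.trans hst.sum_two_step_le).trans
    (mul_le_mul_of_nonneg_left (mul_le_mul_of_nonneg_left (log_potential_le (B := B) (T := T) hd hβ)
      (by positivity)) (by norm_num) :
      _ ≤ 8 * (d / β * Real.log (d + B ^ 2 * T / d)))
  rw [← Finset.sum_add_distrib]
  refine le_trans (le_of_eq ?_) (h3.trans (le_of_eq (by ring)))
  refine Finset.sum_congr rfl fun t ht => ?_
  simp only [Finset.mem_Icc] at ht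
  rw [sq_normIn_hessian_Psi hη0.le (hgood t ht.2), sq_normIn_hessian_Psi hη0.le
    (hgood (t - 1) (by omega)), Nat.sub_add_cancel ht.1]
  ring

end Conclusion

end OQNS

namespace OQNS

/-! ### Real inequalities behind the potential argument for $\eta^2d\ge 2$. -/

section EnergyReal

/-- Completing the square in the linear part of the step energy. -/
theorem energy_lower {C k χ y Z v G R S ψ : ℝ} (hC : χ / 2 < C) (hk : χ < k) (hχ : 0 ≤ χ)
    (hy : 0 ≤ y) (hyZ : y ≤ Z) (hv : 0 ≤ v) (hG : 0 ≤ G) (hvG : v ^ 2 ≤ G * Z)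
    (hS : S ≤ v + R) (hZ : Z + v ^ 2 ≤ S) (hψ0 : 0 ≤ ψ)
    (hψ : (ψ + χ / 2) * (4 * (C - χ / 2 + (k - χ) * y))
      ≤ (k - χ) * (4 * (C - χ / 2 + (k - χ) * y) - (k - χ))) :
    ψ * y + χ * S ≤ C * G + k * R := by
  have hZ0 : 0 ≤ Z := hy.trans hyZ
  have hvm : v ≤ (G + Z) / 2 := by
    nlinarith only [sq_nonneg (G - Z), hvG, hv, hG, hZ0]
  have h1 : ψ * y ≤ ψ * Z := mul_le_mul_of_nonneg_left hyZ hψ0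
  generalize hC' : C - χ / 2 = C' at hψ
  generalize hk' : k - χ = k' at hψ
  have hC0 : 0 < C' := by linarith
  have hk0 : 0 < k' := by linarith
  have hR : Z + v ^ 2 - v ≤ R := by linarith
  have h2 : (ψ + χ / 2) * Z ≤ C' * G + k' * (Z + v ^ 2 - v) := by
    rcases hZ0.eq_or_lt with h0 | h0
    · rw [← h0] at hvG ⊢
      have : v = 0 := by nlinarith only [hvG, hv]
      rw [this]
      nlinarith only [mul_nonneg hC0.le hG]
    · have h3 : (ψ + χ / 2) * (4 * (C' + k' * Z)) ≤ k' * (4 * (C' + k' * Z) - k') := by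
        have h4 : 0 < C' + k' * y := by positivity
        have h5 : ψ + χ / 2 ≤ k' := by
          by_contra h
          push Not at h
          nlinarith only [hψ, h, h4, hk0]
        nlinarith only [hψ, mul_nonneg (mul_nonneg hk0.le (sub_nonneg.mpr h5))
          (sub_nonneg.mpr hyZ)]
      have h6 : 0 < C' + k' * Z := by positivity
      have h7 : C' * v ^ 2 ≤ C' * G * Z := by nlinarith only [hvG, hC0]
      -- With $G\ge v^2/Z$ and $R\ge Z+v^2-v$, the right side is a quadratic in $v$ minimised at
      -- $v=k'Z/(2(C'+k'Z))$. Its minimum divided by $Z$ increases with $Z$, so the hypothesis is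
      -- only needed at $y\le Z$.
      have h8 : 0 ≤ (2 * (C' + k' * Z) * v - k' * Z) ^ 2 := sq_nonneg _
      have h9 : (ψ + χ / 2) * Z * (4 * (C' + k' * Z) * Z)
          ≤ (C' * G + k' * (Z + v ^ 2 - v)) * (4 * (C' + k' * Z) * Z) := by
        have h10 : (ψ + χ / 2) * (4 * (C' + k' * Z)) * Z ^ 2
            ≤ k' * (4 * (C' + k' * Z) - k') * Z ^ 2 :=
          mul_le_mul_of_nonneg_right h3 (sq_nonneg Z)
        have h11 : 4 * (C' + k' * Z) * (C' * v ^ 2) ≤ 4 * (C' + k' * Z) * (C' * G * Z) :=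
          mul_le_mul_of_nonneg_left h7 (by positivity)
        nlinarith only [h10, h11, h8]
      exact le_of_mul_le_mul_right h9 (by positivity)
  have h3 : k' * (Z + v ^ 2 - v) ≤ k' * R := mul_le_mul_of_nonneg_left hR hk0.le
  have h4 : χ * S ≤ χ * ((G + Z) / 2 + R) := mul_le_mul_of_nonneg_left (by linarith) hχ
  rw [← hC', ← hk'] at *
  nlinarith only [h1, h2, h3, h4]

variable {ε τ P p v Z r ro G : ℝ}

/-- The constraints that relate consecutive steps in the regime of small curvature. `P` and `p`
are the scaled local lengths of the step and of its predecessor, `r` and `ro` the square roots of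
their energies, `v` the linear part, and `κ` the influence of the previous step. -/
structure StepData (ε τ κ P p v Z r ro G : ℝ) : Prop where
  eps_nonneg : 0 ≤ ε
  eps_le : ε ≤ 1 / 300
  tau_nonneg : 0 ≤ τ
  tau_le : τ ≤ 0.7072
  P_nonneg : 0 ≤ P
  p_nonneg : 0 ≤ p
  v_nonneg : 0 ≤ v
  r_nonneg : 0 ≤ r
  ro_nonneg : 0 ≤ ro
  G_nonneg : 0 ≤ G
  P_sq_le : P ^ 2 ≤ Z
  v_sq_le : v ^ 2 ≤ G * Z
  add_le : Z + v ^ 2 ≤ r ^ 2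
  le_add : (1 - ε) * r ^ 2 ≤ v + κ * τ * p ^ 2 * P + 2.3 * ε * ro * r
  p_le : p ≤ 0.8
  ro_le : ro ^ 2 ≤ 2.2

/-- Both $P$ and $v$ are at most $r$ and $\tau p^2\le 0.7072\cdot 0.64$, so the energy inequality
can be divided by $r$; it yields $r\le 1.47<\sqrt{2.2}$. -/
theorem StepData.r_sq_le (h : StepData ε τ 1 P p v Z r ro G) : r ^ 2 ≤ 2.2 := by
  obtain ⟨he, he1, ht, ht1, hP, hp, hv, hr, hro, hG, hPS, hvG, hS, hmain, hp8, hro2⟩ := h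
  have hPr : P ≤ r := by nlinarith only [hPS, hS, hP, hr, hv]
  have hvr : v ≤ r := by nlinarith only [hPS, hS, hP, hr, hv]
  have hro1 : ro ≤ 1.484 := by nlinarith only [hro2, hro]
  have h1 : τ * p ^ 2 ≤ 0.4527 := by
    have : p ^ 2 ≤ 0.64 := by nlinarith only [hp, hp8]
    nlinarith only [this, ht, ht1, sq_nonneg p]
  have h2 : 2.3 * ε * ro ≤ 0.0114 := by nlinarith only [hro1, hro, he, he1]
  have h3 : 1 * τ * p ^ 2 * P ≤ 0.4527 * r := by nlinarith only [h1, hP, hPr]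
  have h4 : 2.3 * ε * ro * r ≤ 0.0114 * r := mul_le_mul_of_nonneg_right h2 hr
  have h5 : 299 / 300 * r ^ 2 ≤ 1.4641 * r := by nlinarith only [hmain, h3, h4, hvr, he1, sq_nonneg r]
  have h6 : r ≤ 1.47 := by nlinarith only [h5, hr]
  nlinarith only [h6, hr]

/-- Since $Z+v^2\le r^2$, the linear part contributes at most $v-v^2\le 1/4$. What remains is about
$P^2\le 1/4+0.4527P$ with a small error, and this fails above $0.8$. Thus the bounds assumed on the
previous step reproduce themselves. -/
theorem StepData.P_le (h : StepData ε τ 1 P p v Z r ro G) : P ≤ 0.8 := by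
  have hr2 := h.r_sq_le
  obtain ⟨he, he1, ht, ht1, hP, hp, hv, hr, hro, hG, hPS, hvG, hS, hmain, hp8, hro2⟩ := h
  have h1 : τ * p ^ 2 ≤ 0.4527 := by
    have : p ^ 2 ≤ 0.64 := by nlinarith only [hp, hp8]
    nlinarith only [this, ht, ht1, sq_nonneg p]
  have h0 : ro * r ≤ 2.2 := by nlinarith only [hro2, hr2, sq_nonneg (ro - r)]
  have h2 : ε * (ro * r) ≤ 1 / 300 * 2.2 := by
    have := mul_nonneg hro hr
    nlinarith only [h0, he, he1, this]
  have h3 : 1 * τ * p ^ 2 * P ≤ 0.4527 * P := by nlinarith only [h1, hP]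
  have h4 : ε * r ^ 2 ≤ 1 / 300 * 2.2 := by nlinarith only [hr2, he, he1, sq_nonneg r]
  by_contra hcon
  push Not at hcon
  nlinarith only [hmain, h3, h2, h4, hcon, hPS, hS, sq_nonneg (v - 1 / 2)]

/-- Moves the $\varepsilon$-terms into a remainder without products, using $2.3\,r_or\le
1.15(r_o^2+r^2)$. -/
theorem StepData.sq_le_remainder {κ : ℝ} (h : StepData ε τ κ P p v Z r ro G) :
    r ^ 2 ≤ v + (κ * τ * p ^ 2 * P + (2.15 * r ^ 2 + 1.15 * ro ^ 2) / 300) := by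
  have h1 : ε * (r ^ 2 + 2.3 * ro * r) ≤ 1 / 300 * (r ^ 2 + 2.3 * ro * r) := by
    have := mul_nonneg h.ro_nonneg h.r_nonneg
    have := sq_nonneg r
    exact mul_le_mul_of_nonneg_right h.eps_le (by nlinarith)
  nlinarith only [h.le_add, h1, sq_nonneg (ro - r)]

theorem cube_split (hP : 0 ≤ P) (hp : 0 ≤ p) : p ^ 2 * P ≤ 2 / 3 * p ^ 3 + 1 / 3 * P ^ 3 := by
  nlinarith only [mul_nonneg (by linarith : 0 ≤ 2 * p + P) (sq_nonneg (p - P))]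

/-- The cross term $8\tau p^2P$ splits into $\tfrac{16}3\tau p^3$, paid by the old potential, and
$\tfrac83\tau P^3$. Together with the new potential this makes $8\tau P^3\le 5.6576P^3$, whence
$\psi$; likewise $\chi=0.01+9.2/300+8\cdot 2.15/300$. -/
theorem StepData.potential_step (h : StepData ε τ 1 P p v Z r ro G) (hP8 : P ≤ 0.8) :
    P ^ 2 + 1 / 100 * r ^ 2 + (16 / 3 * τ * P ^ 3 + 9.2 / 300 * r ^ 2)
      ≤ 8 / 3 * G + (16 / 3 * τ * p ^ 3 + 9.2 / 300 * ro ^ 2) := by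
  have hP := h.P_nonneg
  have key := energy_lower (C := 8 / 3) (k := 8) (χ := 0.098) (y := P ^ 2)
    (ψ := 1 + 5.6576 * P) (by norm_num) (by norm_num) (by norm_num) (sq_nonneg P) h.P_sq_le
    h.v_nonneg h.G_nonneg h.v_sq_le h.sq_le_remainder h.add_le (by linarith)
    (by nlinarith only [hP, hP8, mul_nonneg hP (sub_nonneg.mpr hP8), sq_nonneg (P - 0.5),
      mul_nonneg hP (mul_nonneg hP (sub_nonneg.mpr hP8)), mul_nonneg hP (sq_nonneg (P - 0.4)),
      mul_nonneg (sub_nonneg.mpr hP8) (sq_nonneg (P - 0.4))])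
  have h1 := mul_le_mul_of_nonneg_left (cube_split hP h.p_nonneg) h.tau_nonneg
  have h2 := mul_nonneg (sub_nonneg.mpr h.tau_le) (pow_nonneg hP 3)
  nlinarith only [key, h1, h2]

/-- Here $P'$ is the scaled squared length measured at the end of the step. Inward steps lengthen by
at most $1.65$, so $k=16$ suffices and $\psi=1+1.65+16\cdot 0.7072P$. -/
theorem StepData.potential_two_step_inward (h : StepData ε τ 1 P p v Z r ro G) (hP8 : P ≤ 0.8)
    {P' : ℝ} (hP' : P' ≤ 1.65 * P ^ 2) :
    P ^ 2 + P' + (32 / 3 * τ * P ^ 3 + 27.6 / 300 * r ^ 2)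
      ≤ 8 * G + (32 / 3 * τ * p ^ 3 + 27.6 / 300 * ro ^ 2) := by
  have hP := h.P_nonneg
  have key := energy_lower (C := 8) (k := 16) (χ := 0.207) (y := P ^ 2)
    (ψ := 2.65 + 11.3152 * P) (by norm_num) (by norm_num) (by norm_num) (sq_nonneg P) h.P_sq_le
    h.v_nonneg h.G_nonneg h.v_sq_le h.sq_le_remainder h.add_le (by linarith)
    (by nlinarith only [hP, hP8, mul_nonneg hP (sub_nonneg.mpr hP8), sq_nonneg (P - 0.5),
      mul_nonneg hP (mul_nonneg hP (sub_nonneg.mpr hP8)), mul_nonneg hP (sq_nonneg (P - 0.4)),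
      mul_nonneg (sub_nonneg.mpr hP8) (sq_nonneg (P - 0.4))])
  have h1 := mul_le_mul_of_nonneg_left (cube_split hP h.p_nonneg) h.tau_nonneg
  have h2 := mul_nonneg (sub_nonneg.mpr h.tau_le) (pow_nonneg hP 3)
  nlinarith only [key, h1, h2, hP', sq_nonneg r, sq_nonneg ro]

/-- An outward step can lengthen more when measured at its end, but then the previous remainder
helps it only with factor $0.66$. As $24\cdot 0.66<16$, the larger weight $k=24$ is affordable with
the same potential as in the inward case. -/
theorem StepData.potential_two_step_outward (h : StepData ε τ 0.66 P p v Z r ro G) (hP8 : P ≤ 0.8)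
    {P' : ℝ} (hP' : P' ≤ P ^ 2 / (1 - τ * P) ^ 2) :
    P ^ 2 + P' + (32 / 3 * τ * P ^ 3 + 27.6 / 300 * r ^ 2)
      ≤ 8 * G + (32 / 3 * τ * p ^ 3 + 27.6 / 300 * ro ^ 2) := by
  have hP := h.P_nonneg
  have key := energy_lower (C := 8) (k := 24) (χ := 0.264) (y := P ^ 2)
    (ψ := 2 + 16.8 * P) (by norm_num) (by norm_num) (by norm_num) (sq_nonneg P) h.P_sq_le
    h.v_nonneg h.G_nonneg h.v_sq_le h.sq_le_remainder h.add_le (by linarith)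
    (by nlinarith only [hP, hP8, mul_nonneg hP (sub_nonneg.mpr hP8), sq_nonneg (P - 0.5),
      mul_nonneg hP (mul_nonneg hP (sub_nonneg.mpr hP8)), mul_nonneg hP (sq_nonneg (P - 0.4)),
      mul_nonneg (sub_nonneg.mpr hP8) (sq_nonneg (P - 0.4))])
  have h1 := mul_le_mul_of_nonneg_left (cube_split hP h.p_nonneg) h.tau_nonneg
  have h2 := mul_nonneg (sub_nonneg.mpr h.tau_le) (pow_nonneg hP 3)
  -- The bound $(1-\theta)^{-2}\le 1+7.7\theta$ holds up to $\theta=0.7072\cdot 0.8<0.5658$.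
  have h3 : P' ≤ (1 + 7.7 * (τ * P)) * P ^ 2 := by
    refine hP'.trans ?_
    have ht0 := mul_nonneg h.tau_nonneg hP
    have ht1 : τ * P ≤ 0.5658 := by nlinarith only [h.tau_le, hP8, hP, h.tau_nonneg]
    generalize τ * P = θ at ht0 ht1
    rw [div_le_iff₀ (by nlinarith only [ht1])]
    have h4 : 1 ≤ (1 + 7.7 * θ) * (1 - θ) ^ 2 := by
      nlinarith only [mul_nonneg ht0 (sub_nonneg.mpr ht1), ht0,
        mul_nonneg ht0 (mul_nonneg ht0 (sub_nonneg.mpr ht1)), ht1,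
        mul_nonneg ht0 (sq_nonneg (θ - 0.5658))]
    nlinarith only [h4, sq_nonneg P]
  have h5 := mul_nonneg h.tau_nonneg (pow_nonneg hP 3)
  have h6 := mul_nonneg h.tau_nonneg (mul_nonneg (sq_nonneg p) hP)
  nlinarith only [key, h1, h2, h3, h5, h6]

end EnergyReal

end OQNS

namespace OQNS

/-! ### The regime $\eta^2d\ge 2$. -/

section SmallCurvature

variable {d : ℕ} {η B β c : ℝ} {T : ℕ} {rule : LandmarkRule} {g u w x : ℕ → E d}

/-- The invariant of the run when `η² d ≥ 2`. -/
structure SmallCurvature (d : ℕ) (η B β c : ℝ) (T : ℕ) (g u w : ℕ → E d) (t : ℕ) : Prop where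
  norm_lt : ‖w t‖ < 1
  norm_pred_lt : ‖w (t - 1)‖ < 1
  close : LandmarkClose c (u t) (w t)
  step_le : η * (η * d * ballHess (w (t - 1)) (w t - w (t - 1))) ≤ 0.64
  energy_le : η * phiForm d η B β g t (w (t - 1)) (w t - w (t - 1)) ≤ 2.2
  grad_le : ∀ z, inner ℝ (phiGrad d η B β g w t (w t)) z
    ≤ η * d * (ballHess (w (t - 1)) (w t - w (t - 1)) * √(ballHess (w t) z))
      + 2.3 * neumannError d η B β c T
        * (√(phiForm d η B β g t (w (t - 1)) (w t - w (t - 1))) * √(phiForm d η B β g t (w t) z))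
  neg_grad_le : ∀ z, 0 ≤ radialPart (w t) z → -inner ℝ (phiGrad d η B β g w t (w t)) z
    ≤ η * d * (0.66 * ballHess (w (t - 1)) (w t - w (t - 1)) * √(ballHess (w t) z))
      + 2.3 * neumannError d η B β c T
        * (√(phiForm d η B β g t (w (t - 1)) (w t - w (t - 1))) * √(phiForm d η B β g t (w t) z))

theorem smallCurvature_one (hrun : IsRun d η B β c T rule g u w) :
    SmallCurvature d η B β c T g u w 1 := by
  constructor <;> simp [hrun.w_one, hrun.w_zero, hrun.u_one, landmarkClose_self, ballHess, phiForm,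
    phiGrad_one_zero] <;> norm_num

theorem ballHess_neg (x v : E d) : ballHess x (-v) = ballHess x v := by
  simp [ballHess]

/-- The linear part of the scaled step energy. -/
noncomputable def linearPart (η : ℝ) (g w : ℕ → E d) (t : ℕ) : ℝ :=
  η * max 0 (-inner ℝ (g t) (w (t + 1) - w t))

/-- Multiplying energies by $\eta$ removes the parameters except $\tau=1/\sqrt{\eta^2d}$, and $\tau
P$ is the barrier length of the step. The quantity $Z$ omits the share $\eta B^2\|\Delta\|^2$ of the
energy, which is what pays for $v^2$. The factor $\kappa$ is free so that the full and the one-sided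
remainder bounds can both be inserted. -/
theorem SmallCurvature.stepData (hd : 1 ≤ d) (hT : 1 ≤ T) (hη : 1 ≤ η) (hηd : 2 ≤ η * (η * d))
    (hB : 0 < B) (hβ : 0 < β) (hc : c ∈ Set.Ioo (0 : ℝ) 1)
    (hrun : IsRun d η B β c T rule g u w) {t : ℕ}
    (ht : t ∈ Finset.Icc 1 T) (hg : ‖g t‖ ≤ B) {q : ℝ} (hq0 : 0 ≤ q)
    (hq : ∀ v, inner ℝ (g t) v ^ 2
      ≤ q * (‖v‖ ^ 2 + β * ∑ s ∈ Finset.Ico 1 (t + 1), inner ℝ (g s) v ^ 2))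
    (h : SmallCurvature d η B β c T g u w t) {κ : ℝ}
    (he : -inner ℝ (phiGrad d η B β g w t (w t)) (w (t + 1) - w t)
      ≤ η * d * (κ * ballHess (w (t - 1)) (w t - w (t - 1)) * √(ballHess (w t) (w (t + 1) - w t)))
      + 2.3 * neumannError d η B β c T
        * (√(phiForm d η B β g t (w (t - 1)) (w t - w (t - 1)))
          * √(phiForm d η B β g t (w t) (w (t + 1) - w t)))) :
    StepData (neumannError d η B β c T) (√(η * (η * d)))⁻¹ κ
      √(η * (η * d * ballHess (w t) (w (t + 1) - w t)))
      √(η * (η * d * ballHess (w (t - 1)) (w t - w (t - 1))))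
      (linearPart η g w t)
      (η * (phiForm d η B β g (t + 1) (w t) (w (t + 1) - w t)
        - η * B ^ 2 * ‖w (t + 1) - w t‖ ^ 2))
      √(η * phiForm d η B β g (t + 1) (w t) (w (t + 1) - w t))
      √(η * phiForm d η B β g t (w (t - 1)) (w t - w (t - 1)))
      (η * q) := by
  have hη0 : 0 < η := by linarith
  have hd1 : (1 : ℝ) ≤ d := by exact_mod_cast hd
  obtain ⟨hε0, hε1, -⟩ := neumannError_bounds (d := d) hd hT hη hB hβ hc
  have hbo := ballHess_nonneg h.norm_pred_lt (w t - w (t - 1))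
  have hso := phiForm_nonneg (B := B) hη0.le hβ.le g t h.norm_pred_lt (w t - w (t - 1))
  set Δ := w (t + 1) - w t with hΔ
  have hb := ballHess_nonneg h.norm_lt Δ
  have hs := phiForm_nonneg (B := B) hη0.le hβ.le g (t + 1) h.norm_lt Δ
  have hsmono := phiForm_mono (η := η) (B := B) hβ.le g t (w t) Δ
  have hseq := phiForm_eq η B β g (t + 1) (w t) Δ
  have hqeq := quadForm_eq η B β g (t + 1) Δ
  have henergy := step_energy_le hd hη hβ hc hrun ht h.norm_lt h.close
  rw [← hΔ, phiGrad_succ_self η B β g w (Finset.mem_Icc.mp ht).1, inner_add_left] at henergy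
  set bo := ballHess (w (t - 1)) (w t - w (t - 1))
  set b := ballHess (w t) Δ
  set so := phiForm d η B β g t (w (t - 1)) (w t - w (t - 1))
  set s := phiForm d η B β g (t + 1) (w t) Δ
  set ε := neumannError d η B β c T
  have hN := sq_nonneg ‖Δ‖
  have hG0 := mul_nonneg hβ.le (Finset.sum_nonneg fun i (_ : i ∈ Finset.Ico 1 (t + 1)) =>
    sq_nonneg (inner ℝ (g i) Δ))
  have hP2 : √(η * (η * d * b)) ^ 2 = η * (η * d * b) := Real.sq_sqrt (by positivity)
  have hp2 : √(η * (η * d * bo)) ^ 2 = η * (η * d * bo) := Real.sq_sqrt (by positivity)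
  have hr2 : √(η * s) ^ 2 = η * s := Real.sq_sqrt (by positivity)
  have hro2 : √(η * so) ^ 2 = η * so := Real.sq_sqrt (by positivity)
  have hlin : linearPart η g w t = η * max 0 (-inner ℝ (g t) Δ) := rfl
  have hgs : max 0 (-inner ℝ (g t) Δ) ^ 2 ≤ inner ℝ (g t) Δ ^ 2 := by
    rcases max_cases 0 (-inner ℝ (g t) Δ) with ⟨h1, -⟩ | ⟨h1, -⟩ <;> rw [h1]
    · simpa using sq_nonneg (inner ℝ (g t) Δ)
    · rw [neg_sq]
  have hη2 : 0 ≤ η ^ 2 := sq_nonneg η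
  have hgB : max 0 (-inner ℝ (g t) Δ) ^ 2 ≤ B ^ 2 * ‖Δ‖ ^ 2 := by
    refine hgs.trans ?_
    rw [← mul_pow, ← sq_abs]
    exact pow_le_pow_left₀ (abs_nonneg _) ((abs_real_inner_le_norm _ _).trans (by gcongr)) 2
  have hK : ‖Δ‖ ^ 2 + β * ∑ i ∈ Finset.Ico 1 (t + 1), inner ℝ (g i) Δ ^ 2
      ≤ s - η * B ^ 2 * ‖Δ‖ ^ 2 := by
    have h1 : ‖Δ‖ ^ 2 ≤ d * ‖Δ‖ ^ 2 := le_mul_of_one_le_left hN hd1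
    have h2 : 0 ≤ η * d * b := by positivity
    nlinarith only [hseq, hqeq, h1, h2]
  have hτ : (√(η * (η * d)))⁻¹ * √(η * (η * d * b)) = √b := by
    rw [show η * (η * d * b) = η * (η * d) * b by ring,
      Real.sqrt_mul (by positivity : 0 ≤ η * (η * d))]
    exact inv_mul_cancel_left₀ (Real.sqrt_pos.mpr (by positivity : 0 < η * (η * d))).ne' _
  refine ⟨hε0, hε1, by positivity, ?_, by positivity, by positivity, ?_, by positivity,
    by positivity, by positivity, ?_, ?_, ?_, ?_, ?_, ?_⟩
  · have h1 : (1.4141 : ℝ) ≤ √(η * (η * d)) := Real.le_sqrt_of_sq_le (by linarith)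
    rw [inv_le_comm₀ (by linarith) (by norm_num)]
    exact le_trans (by norm_num) h1
  · rw [hlin]; positivity
  · rw [hP2]
    have : η * d * b ≤ s - η * B ^ 2 * ‖Δ‖ ^ 2 := by
      nlinarith only [hseq, hqeq, hG0, mul_nonneg (by positivity : (0 : ℝ) ≤ d) hN]
    gcongr
  · rw [hlin, mul_pow]
    calc η ^ 2 * max 0 (-inner ℝ (g t) Δ) ^ 2
        ≤ η ^ 2 * (q * (s - η * B ^ 2 * ‖Δ‖ ^ 2)) := by
          gcongr
          exact hgs.trans ((hq Δ).trans (by gcongr))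
      _ = _ := by ring
  · rw [hlin, hr2, mul_pow]
    nlinarith only [mul_le_mul_of_nonneg_left hgB hη2]
  · rw [hr2, hlin]
    have h1 : κ * (√(η * (η * d)))⁻¹ * √(η * (η * d * bo)) ^ 2 * √(η * (η * d * b))
        = η * (η * d * (κ * bo * √b)) := by
      rw [hp2, ← hτ]; ring
    have h2 : 2.3 * ε * √(η * so) * √(η * s) = η * (2.3 * ε * (√so * √s)) := by
      rw [Real.sqrt_mul hη0.le, Real.sqrt_mul hη0.le]
      have := Real.mul_self_sqrt hη0.le
      linear_combination (2.3 * ε * √so * √s) * this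
    rw [h1, h2]
    have h3 : -inner ℝ (g t) Δ ≤ max 0 (-inner ℝ (g t) Δ) := le_max_right _ _
    have h4 : 2.3 * ε * (√so * √(phiForm d η B β g t (w t) Δ)) ≤ 2.3 * ε * (√so * √s) := by
      have := Real.sqrt_le_sqrt hsmono
      gcongr
    have h5 : (1 - ε) * s ≤ max 0 (-inner ℝ (g t) Δ) + η * d * (κ * bo * √b)
        + 2.3 * ε * (√so * √s) := by linarith
    nlinarith only [mul_le_mul_of_nonneg_left h5 hη0.le]
  · rw [Real.sqrt_le_left (by norm_num)]
    have := h.step_le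
    norm_num at this ⊢
    exact this
  · rw [hro2]
    exact h.energy_le

theorem SmallCurvature.stepData_one (hd : 1 ≤ d) (hT : 1 ≤ T) (hη : 1 ≤ η)
    (hηd : 2 ≤ η * (η * d))
    (hB : 0 < B) (hβ : 0 < β) (hc : c ∈ Set.Ioo (0 : ℝ) 1)
    (hrun : IsRun d η B β c T rule g u w) {t : ℕ}
    (ht : t ∈ Finset.Icc 1 T) (hg : ‖g t‖ ≤ B) {q : ℝ} (hq0 : 0 ≤ q)
    (hq : ∀ v, inner ℝ (g t) v ^ 2
      ≤ q * (‖v‖ ^ 2 + β * ∑ s ∈ Finset.Ico 1 (t + 1), inner ℝ (g s) v ^ 2))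
    (h : SmallCurvature d η B β c T g u w t) :
    StepData (neumannError d η B β c T) (√(η * (η * d)))⁻¹ 1
      √(η * (η * d * ballHess (w t) (w (t + 1) - w t)))
      √(η * (η * d * ballHess (w (t - 1)) (w t - w (t - 1))))
      (linearPart η g w t)
      (η * (phiForm d η B β g (t + 1) (w t) (w (t + 1) - w t)
        - η * B ^ 2 * ‖w (t + 1) - w t‖ ^ 2))
      √(η * phiForm d η B β g (t + 1) (w t) (w (t + 1) - w t))
      √(η * phiForm d η B β g t (w (t - 1)) (w t - w (t - 1)))
      (η * q) := by
  refine h.stepData hd hT hη hηd hB hβ hc hrun ht hg hq0 hq ?_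
  have := h.grad_le (-(w (t + 1) - w t))
  rwa [phiForm_neg, ballHess_neg, inner_neg_right, ← one_mul (ballHess (w (t - 1)) _)] at this

theorem SmallCurvature.step_bound (hd : 1 ≤ d) (hT : 1 ≤ T) (hη : 1 ≤ η)
    (hηd : 2 ≤ η * (η * d))
    (hB : 0 < B) (hβ : 0 < β) (hc : c ∈ Set.Ioo (0 : ℝ) 1)
    (hrun : IsRun d η B β c T rule g u w) {t : ℕ}
    (ht : t ∈ Finset.Icc 1 T) (hg : ‖g t‖ ≤ B) {q : ℝ} (hq0 : 0 ≤ q)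
    (hq : ∀ v, inner ℝ (g t) v ^ 2
      ≤ q * (‖v‖ ^ 2 + β * ∑ s ∈ Finset.Ico 1 (t + 1), inner ℝ (g s) v ^ 2))
    (h : SmallCurvature d η B β c T g u w t) :
    η * (η * d * ballHess (w t) (w (t + 1) - w t)) ≤ 0.64 ∧
      ballHess (w t) (w (t + 1) - w t) ≤ 0.32 ∧
      η * phiForm d η B β g (t + 1) (w t) (w (t + 1) - w t) ≤ 2.2 := by
  have hη0 : 0 < η := by linarith
  have hD := h.stepData_one hd hT hη hηd hB hβ hc hrun ht hg hq0 hq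
  have h1 := hD.P_le
  have h2 := hD.r_sq_le
  have hb := ballHess_nonneg h.norm_lt (w (t + 1) - w t)
  have hs := phiForm_nonneg (B := B) hη0.le hβ.le g (t + 1) h.norm_lt (w (t + 1) - w t)
  rw [Real.sq_sqrt (by positivity)] at h2
  rw [Real.sqrt_le_left (by norm_num)] at h1
  have h3 : η * (η * d * ballHess (w t) (w (t + 1) - w t)) ≤ 0.64 := h1.trans (by norm_num)
  exact ⟨h3, by nlinarith only [h3, hηd, hb], h2⟩

theorem SmallCurvature.succ (hd : 1 ≤ d) (hT : 1 ≤ T) (hη : 1 ≤ η) (hηd : 2 ≤ η * (η * d))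
    (hB : 0 < B) (hβ : 0 < β) (hc : c ∈ Set.Ioo (0 : ℝ) 1)
    (hrule : rule = LandmarkRule.oldLandmark → c ≤ 1 / 3)
    (hrun : IsRun d η B β c T rule g u w) {t : ℕ}
    (ht : t ∈ Finset.Icc 1 T) (hg : ‖g t‖ ≤ B) {q : ℝ} (hq0 : 0 ≤ q)
    (hq : ∀ v, inner ℝ (g t) v ^ 2
      ≤ q * (‖v‖ ^ 2 + β * ∑ s ∈ Finset.Ico 1 (t + 1), inner ℝ (g s) v ^ 2))
    (h : SmallCurvature d η B β c T g u w t) : SmallCurvature d η B β c T g u w (t + 1) := by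
  obtain ⟨h1, h2, h3⟩ := h.step_bound hd hT hη hηd hB hβ hc hrun ht hg hq0 hq
  have hw' : ‖w (t + 1)‖ < 1 := by
    have := norm_add_lt_one h.norm_lt (by linarith : ballHess (w t) (w (t + 1) - w t) < 1)
    rwa [add_sub_cancel] at this
  have hθ : √(ballHess (w t) (w (t + 1) - w t)) ≤ 0.57 := by
    rw [Real.sqrt_le_left (by norm_num)]
    linarith
  have hθ0 := Real.sqrt_nonneg (ballHess (w t) (w (t + 1) - w t))
  -- The barrier length is at most $0.57$ since $0.57^2>0.32$, and $2\cdot 1.57^2<2.3^2$.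
  have hκ : 2 * (1 + √(ballHess (w t) (w (t + 1) - w t))) ^ 2 ≤ (2.3 : ℝ) ^ 2 := by nlinarith
  refine ⟨hw', h.norm_lt, landmarkClose_succ hc hrule hrun ht h.close.norm_lt hw', h1, h3,
    fun z => ?_, fun z hz => ?_⟩
  · exact inner_phiGrad_succ_le hd hT hη hB hβ hc hrun ht h.norm_lt h.close hw' (by linarith)
      (by norm_num) hκ z
  · exact neg_inner_phiGrad_succ_le hd hT hη hB hβ hc hrun ht h.norm_lt h.close hw' (by linarith)
      (by norm_num) hκ hz

theorem SmallCurvature.goodIterate (hd : 1 ≤ d) (hT : 1 ≤ T) (hη : 1 ≤ η)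
    (hηd : 2 ≤ η * (η * d))
    (hB : 0 < B) (hβ : 0 < β) (hc : c ∈ Set.Ioo (0 : ℝ) 1) {t : ℕ}
    (h : SmallCurvature d η B β c T g u w t) : GoodIterate d η B β c g u w t := by
  have hη0 : 0 < η := by linarith
  have hd1 : (1 : ℝ) ≤ d := by exact_mod_cast hd
  obtain ⟨hε0, hε1, -⟩ := neumannError_bounds (d := d) hd hT hη hB hβ hc
  have hbo := ballHess_nonneg h.norm_pred_lt (w t - w (t - 1))
  have hso := phiForm_nonneg (B := B) hη0.le hβ.le g t h.norm_pred_lt (w t - w (t - 1))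
  have h1 : newtonDecrement (w t) (Phi d η B β g w t)
      ≤ √(η * d) * ballHess (w (t - 1)) (w t - w (t - 1)) + 2.3 * neumannError d η B β c T
        * √(phiForm d η B β g t (w (t - 1)) (w t - w (t - 1))) := by
    refine newtonDecrement_Phi_le hη0.le hβ.le hd g w t h.norm_lt (by positivity) fun v => ?_
    refine (h.grad_le v).trans ?_
    rw [add_mul]
    refine add_le_add ?_ (by rw [mul_assoc (2.3 * _)])
    have h1 : √(η * d) * √(ballHess (w t) v) ≤ √(phiForm d η B β g t (w t) v) := by
      rw [← Real.sqrt_mul (by positivity)]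
      apply Real.sqrt_le_sqrt
      rw [phiForm_eq]
      linarith [quadForm_nonneg (B := B) hη0.le hβ.le g t v]
    have h2 := Real.mul_self_sqrt (by positivity : 0 ≤ η * d)
    calc η * d * (ballHess (w (t - 1)) (w t - w (t - 1)) * √(ballHess (w t) v))
        = √(η * d) * ballHess (w (t - 1)) (w t - w (t - 1))
          * (√(η * d) * √(ballHess (w t) v)) := by
          linear_combination
            -(ballHess (w (t - 1)) (w t - w (t - 1)) * √(ballHess (w t) v)) * h2
      _ ≤ _ := by gcongr
  have hA := Real.sq_sqrt (by positivity : 0 ≤ η * d)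
  have hA0 : 0 < √(η * d) := Real.sqrt_pos.mpr (by positivity)
  have hE := Real.sq_sqrt hη0.le
  have hE1 : 1 ≤ √η := Real.one_le_sqrt.mpr hη
  have hA1 : 1 ≤ √(η * d) := Real.one_le_sqrt.mpr (one_le_mul_of_one_le_of_one_le hη hd1)
  have hr : √η * √(phiForm d η B β g t (w (t - 1)) (w t - w (t - 1))) ≤ 1.484 := by
    rw [← Real.sqrt_mul hη0.le, Real.sqrt_le_left (by norm_num)]
    linarith [h.energy_le]
  have hr0 := Real.sqrt_nonneg (phiForm d η B β g t (w (t - 1)) (w t - w (t - 1)))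
  have hstep := h.step_le
  set b := ballHess (w (t - 1)) (w t - w (t - 1))
  set r := √(phiForm d η B β g t (w (t - 1)) (w t - w (t - 1)))
  set l := newtonDecrement (w t) (Phi d η B β g w t)
  set ε := neumannError d η B β c T
  have hb : b ≤ 0.32 := by nlinarith only [hstep, hηd, hbo]
  have hr1 : r ≤ 1.484 := by nlinarith only [hr, hE1, hr0]
  have hn : 2.3 * ε * (√η * r) ≤ 0.0115 := by
    have := mul_nonneg (Real.sqrt_nonneg η) hr0
    nlinarith only [hr, hε1, hε0, this]
  have hsmall : √η * (√(η * d) * b) ≤ 0.46 := by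
    have h2 : (√η * √(η * d)) ^ 2 * b ≤ 0.64 := by rw [mul_pow, hE, hA]; linarith
    have h3 : (√η * √(η * d)) ^ 2 * b ^ 2 ≤ 0.2048 := by nlinarith only [h2, hb, hbo]
    have h4 : 0 ≤ √η * (√(η * d) * b) := by positivity
    nlinarith only [h3, h4]
  refine ⟨h.norm_lt, h.close, ?_, fun x hx => ?_⟩
  · rw [le_div_iff₀ (by linarith)]
    nlinarith only [mul_le_mul_of_nonneg_left h1 (Real.sqrt_nonneg η), hsmall, hn]
  · have hgap := gap_le_two_mul_newtonDecrement hη hβ.le hd g w t h.norm_lt hx (by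
      have : 2.3 * ε * r ≤ 0.0115 := by nlinarith only [hr1, hε1, hε0, hr0]
      have h5 : √(η * d) * b ≤ √(η * d) * 0.32 := by gcongr
      change l ≤ _
      linarith)
    rwa [normIn_hessian_Phi η B β g w t h.norm_lt] at hgap

theorem sum_le_of_potential {a b pot : ℕ → ℝ} (T : ℕ)
    (h : ∀ t ∈ Finset.Icc 1 T, a t + pot (t + 1) ≤ b t + pot t) :
    ∑ t ∈ Finset.Icc 1 T, a t + pot (T + 1) ≤ ∑ t ∈ Finset.Icc 1 T, b t + pot 1 := by
  induction T with
  | zero => simp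
  | succ n ih =>
    rw [Finset.sum_Icc_succ_top (by omega), Finset.sum_Icc_succ_top (by omega)]
    have h1 := ih fun t ht => h t (by simp at ht ⊢; omega)
    have h2 := h (n + 1) (by simp)
    linarith

theorem stableRun_of_two_le (hd : 1 ≤ d) (hT : 1 ≤ T) (hη : 1 ≤ η) (hηd : 2 ≤ η * (η * d))
    (hB : 0 < B) (hβ : 0 < β) (hc : c ∈ Set.Ioo (0 : ℝ) 1)
    (hrule : rule = LandmarkRule.oldLandmark → c ≤ 1 / 3)
    (hg : ∀ t ∈ Finset.Icc 1 T, ‖g t‖ ≤ B)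
    (hrun : IsRun d η B β c T rule g u w) : StableRun d η B β c T g u w := by
  have hη0 : 0 < η := by linarith
  obtain ⟨q, hq0, hq, hqsum⟩ := exists_elliptical_bound hd hβ g T hg
  have hinv : ∀ t, t + 1 ∈ Finset.Icc 1 (T + 1) → SmallCurvature d η B β c T g u w (t + 1) := by
    intro t
    induction t with
    | zero => exact fun _ => smallCurvature_one hrun
    | succ n ih =>
      intro ht
      have hn : n + 1 ∈ Finset.Icc 1 T := by simp at ht ⊢; omega
      exact (ih (by simp at ht ⊢; omega)).succ hd hT hη hηd hB hβ hc hrule hrun hn (hg _ hn)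
        (hq0 _) (fun v => hq _ v (by omega))
  have hinv' : ∀ t ∈ Finset.Icc 1 (T + 1), SmallCurvature d η B β c T g u w t := fun t ht => by
    have h1 := (Finset.mem_Icc.mp ht).1
    have := hinv (t - 1) (by rwa [Nat.sub_add_cancel h1])
    rwa [Nat.sub_add_cancel h1] at this
  have hT' : ∀ t ∈ Finset.Icc 1 T, t ∈ Finset.Icc 1 (T + 1) := fun t ht => by
    simp at ht ⊢; omega
  have hT1 : ∀ t ∈ Finset.Icc 1 T, t + 1 ∈ Finset.Icc 1 (T + 1) := fun t ht => by
    simp at ht ⊢; omega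
  have hstep := fun t (ht : t ∈ Finset.Icc 1 T) => (hinv' t (hT' t ht)).step_bound hd hT hη hηd
    hB hβ hc hrun ht (hg t ht) (hq0 t) (fun v => hq t v (Finset.mem_Icc.mp ht).1)
  have hdata := fun t (ht : t ∈ Finset.Icc 1 T) => (hinv' t (hT' t ht)).stepData_one hd hT hη hηd
    hB hβ hc hrun ht (hg t ht) (hq0 t) (fun v => hq t v (Finset.mem_Icc.mp ht).1)
  have hP8 : ∀ t ∈ Finset.Icc 1 T, √(η * (η * d * ballHess (w t) (w (t + 1) - w t))) ≤ 0.8 :=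
    fun t ht => (hdata t ht).P_le
  have hP2 : ∀ t ∈ Finset.Icc 1 T, √(η * (η * d * ballHess (w t) (w (t + 1) - w t))) ^ 2
      = η * (η * d * ballHess (w t) (w (t + 1) - w t)) := fun t ht => by
    have := ballHess_nonneg (hinv' t (hT' t ht)).norm_lt (w (t + 1) - w t)
    exact Real.sq_sqrt (by positivity)
  have hr2 : ∀ t ∈ Finset.Icc 1 T, √(η * phiForm d η B β g (t + 1) (w t) (w (t + 1) - w t)) ^ 2
      = η * phiForm d η B β g (t + 1) (w t) (w (t + 1) - w t) := fun t ht => by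
    have := phiForm_nonneg (B := B) hη0.le hβ.le g (t + 1) (hinv' t (hT' t ht)).norm_lt
      (w (t + 1) - w t)
    exact Real.sq_sqrt (by positivity)
  -- Telescoping: the potential vanishes in round $1$ because $w_1=w_0$ and is nonnegative at the
  -- end, so only the sum of the $q_t$ survives.
  have hpot : ∀ a k K : ℝ, 0 ≤ k → 0 ≤ K → ∀ f : ℕ → ℝ,
      (∀ t ∈ Finset.Icc 1 T, η * f t
        + (k * (√(η * (η * d)))⁻¹ * √(η * (η * d * ballHess (w t) (w (t + 1) - w t))) ^ 3
          + K * √(η * phiForm d η B β g (t + 1) (w t) (w (t + 1) - w t)) ^ 2)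
        ≤ a * (η * q t)
        + (k * (√(η * (η * d)))⁻¹
            * √(η * (η * d * ballHess (w (t - 1)) (w t - w (t - 1)))) ^ 3
          + K * √(η * phiForm d η B β g t (w (t - 1)) (w t - w (t - 1))) ^ 2)) →
      ∑ t ∈ Finset.Icc 1 T, f t ≤ a * ∑ t ∈ Finset.Icc 1 T, q t := by
    intro a k K hk hK f hf
    have h1 := sum_le_of_potential (a := fun t => η * f t) (b := fun t => a * (η * q t))
      (pot := fun t => k * (√(η * (η * d)))⁻¹
            * √(η * (η * d * ballHess (w (t - 1)) (w t - w (t - 1)))) ^ 3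
          + K * √(η * phiForm d η B β g t (w (t - 1)) (w t - w (t - 1))) ^ 2) T hf
    have h2 : ∑ t ∈ Finset.Icc 1 T, a * (η * q t) = η * (a * ∑ t ∈ Finset.Icc 1 T, q t) := by
      rw [Finset.mul_sum, Finset.mul_sum]
      exact Finset.sum_congr rfl fun t _ => by ring
    rw [h2, ← Finset.mul_sum] at h1
    have h3 : w 1 - w (1 - 1) = 0 := by simp [hrun.w_one, hrun.w_zero]
    have h4 : ballHess (w (1 - 1)) (w 1 - w (1 - 1)) = 0 := by rw [h3]; simp [ballHess]
    have h5 : phiForm d η B β g 1 (w (1 - 1)) (w 1 - w (1 - 1)) = 0 := by rw [h3]; simp [phiForm]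
    simp only [h4, h5, mul_zero, Real.sqrt_zero] at h1
    have h6 : 0 ≤ k * (√(η * (η * d)))⁻¹
            * √(η * (η * d * ballHess (w (T + 1 - 1)) (w (T + 1) - w (T + 1 - 1)))) ^ 3
          + K * √(η * phiForm d η B β g (T + 1) (w (T + 1 - 1)) (w (T + 1) - w (T + 1 - 1))) ^ 2 := by
      positivity
    refine le_of_mul_le_mul_left ?_ hη0
    linarith
  have hgood : ∀ t ∈ Finset.Icc 1 (T + 1), GoodIterate d η B β c g u w t :=
    fun t ht => (hinv' t ht).goodIterate hd hT hη hηd hB hβ hc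
  have hone : ∀ t ∈ Finset.Icc 1 T, ballHess (w t) (w (t + 1) - w t) ≤ 1 :=
    fun t ht => (hstep t ht).2.1.trans (by norm_num)
  refine ⟨hgood, hone,
    sum_newtonDecrement_le_of_sum_energy hd hT hη hB hβ hc hrun hgood hone ?_, ?_⟩
  · refine (hpot (8 / 3) (16 / 3) (9.2 / 300) (by norm_num) (by norm_num) _ fun t ht => ?_).trans
      (by gcongr)
    have := (hdata t ht).potential_step (hP8 t ht)
    rw [hP2 t ht, hr2 t ht] at this
    rw [hr2 t ht]
    linarith
  · refine (hpot 8 (32 / 3) (27.6 / 300) (by norm_num) (by norm_num) _ fun t ht => ?_).trans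
      (by gcongr)
    have hw := (hinv' t (hT' t ht)).norm_lt
    have hb := ballHess_nonneg hw (w (t + 1) - w t)
    have hb3 := (hstep t ht).2.1
    -- Each round uses the inequality matching the radial direction of its step; both carry the same
    -- potential, so the rounds can be mixed.
    rcases le_total 0 (radialPart (w t) (w (t + 1) - w t)) with hr | hr
    · have hD := (hinv' t (hT' t ht)).stepData hd hT hη hηd
        hB hβ hc hrun ht (hg t ht) (hq0 t) (fun v => hq t v (Finset.mem_Icc.mp ht).1)
        (by simpa only [mul_assoc] using (hinv' t (hT' t ht)).neg_grad_le _ hr)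
      have := hD.potential_two_step_outward (hP8 t ht)
        (P' := η * (η * d * ballHess (w (t + 1)) (w (t + 1) - w t))) (by
        have h1 := ballHess_add_self_le hw (by linarith : ballHess (w t) (w (t + 1) - w t) < 1)
        rw [add_sub_cancel] at h1
        have h2 : (√(η * (η * d)))⁻¹ * √(η * (η * d * ballHess (w t) (w (t + 1) - w t)))
            = √(ballHess (w t) (w (t + 1) - w t)) := by
          rw [show η * (η * d * ballHess (w t) (w (t + 1) - w t))
            = η * (η * d) * ballHess (w t) (w (t + 1) - w t) by ring,
            Real.sqrt_mul (by positivity : 0 ≤ η * (η * d))]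
          exact inv_mul_cancel_left₀ (Real.sqrt_pos.mpr (by positivity : 0 < η * (η * d))).ne' _
        rw [h2, hP2 t ht]
        calc _ ≤ η * (η * d * (ballHess (w t) (w (t + 1) - w t)
              / (1 - √(ballHess (w t) (w (t + 1) - w t))) ^ 2)) := by gcongr
          _ = _ := by ring)
      rw [hP2 t ht] at this
      linarith
    · have := (hdata t ht).potential_two_step_inward (hP8 t ht)
        (P' := η * (η * d * ballHess (w (t + 1)) (w (t + 1) - w t))) (by
        have h1 := ballHess_add_self_le_of_inward hw hb3 hr
        rw [add_sub_cancel] at h1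
        rw [hP2 t ht]
        calc _ ≤ η * (η * d * (1.65 * ballHess (w t) (w (t + 1) - w t))) := by gcongr
          _ = _ := by ring)
      rw [hP2 t ht] at this
      linarith

end SmallCurvature

end OQNS

namespace OQNS

/-! ### Scalar barrier calculus for $d=1$, $\eta^2<2$. -/

section Scalar

/-- The derivative of `-log (1 - x²)`. -/
noncomputable def barrierGrad (x : ℝ) : ℝ := 1 / (1 - x) - 1 / (1 + x)

/-- The second derivative of `-log (1 - x²)`. -/
noncomputable def barrierHess (x : ℝ) : ℝ := 1 / (1 - x) ^ 2 + 1 / (1 + x) ^ 2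

theorem barrierGrad_neg (x : ℝ) : barrierGrad (-x) = -barrierGrad x := by
  simp only [barrierGrad, sub_neg_eq_add, ← sub_eq_add_neg]
  ring

theorem barrierHess_neg (x : ℝ) : barrierHess (-x) = barrierHess x := by
  simp only [barrierHess, sub_neg_eq_add, ← sub_eq_add_neg]
  ring

theorem barrierHess_nonneg (x : ℝ) : 0 ≤ barrierHess x := by
  unfold barrierHess
  positivity

theorem barrierGrad_sub {x y : ℝ} (hx : x ∈ Set.Ioo (-1 : ℝ) 1) (hy : y ∈ Set.Ioo (-1 : ℝ) 1) :
    barrierGrad y - barrierGrad x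
      = (y - x) * (1 / ((1 - x) * (1 - y)) + 1 / ((1 + x) * (1 + y))) := by
  have h1 : 1 - x ≠ 0 := (sub_pos.mpr hx.2).ne'
  have h2 : 1 - y ≠ 0 := (sub_pos.mpr hy.2).ne'
  have h3 : 1 + x ≠ 0 := by linarith [hx.1]
  have h4 : 1 + y ≠ 0 := by linarith [hy.1]
  unfold barrierGrad
  field_simp
  ring

/-- In one dimension the remainder is exact and is a difference of two nonnegative terms, one for
each wall, which can be bounded separately. -/
theorem barrierGrad_taylor {x y : ℝ} (hx : x ∈ Set.Ioo (-1 : ℝ) 1)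
    (hy : y ∈ Set.Ioo (-1 : ℝ) 1) :
    barrierGrad y - barrierGrad x - barrierHess x * (y - x)
      = (y - x) ^ 2 / ((1 - x) ^ 2 * (1 - y)) - (y - x) ^ 2 / ((1 + x) ^ 2 * (1 + y)) := by
  have h1 : 1 - x ≠ 0 := (sub_pos.mpr hx.2).ne'
  have h2 : 1 - y ≠ 0 := (sub_pos.mpr hy.2).ne'
  have h3 : 1 + x ≠ 0 := by linarith [hx.1]
  have h4 : 1 + y ≠ 0 := by linarith [hy.1]
  unfold barrierGrad barrierHess
  field_simp
  ring

/-- The minimiser is within twice the Newton step, in one dimension. -/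
theorem scalar_gap_le {b k x y e : ℝ} (hx : x ∈ Set.Ioo (-1 : ℝ) 1) (hy : y ∈ Set.Ioo (-1 : ℝ) 1)
    (hyx : y ≤ x) (hk : b ^ 2 ≤ k) (he : e ≤ b)
    (h : e = barrierGrad x - barrierGrad y + k * (x - y)) :
    (barrierHess x + k) * (x - y) ≤ 2 * e := by
  have h1 : 0 < 1 - x := sub_pos.mpr hx.2
  have h2 : 0 < 1 - y := sub_pos.mpr hy.2
  have h3 : 0 < 1 + x := by linarith [hx.1]
  have h4 : 0 < 1 + y := by linarith [hy.1]
  have h5 : 0 ≤ x - y := sub_nonneg.mpr hyx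
  rw [barrierGrad_sub hy hx] at h
  have hk0 : 0 ≤ k := (sq_nonneg b).trans hk
  -- Otherwise the gradient would be at least $\frac1{2(1-x)}+b^2(1-x)\ge\sqrt2\,b>b$. Once the
  -- distances to the wall are comparable, the secant slope is at least half the Hessian.
  have hsmall : 1 - y ≤ 2 * (1 - x) := by
    by_contra hcon
    push Not at hcon
    have h6 : 1 / (2 * (1 - x)) ≤ (x - y) * (1 / ((1 - y) * (1 - x))) := by
      rw [mul_one_div, div_le_div_iff₀ (by positivity) (by positivity)]
      nlinarith only [hcon, h1, h2, mul_pos h1 (sub_pos.mpr hcon)]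
    have h7 : b ^ 2 * (1 - x) ≤ k * (x - y) :=
      mul_le_mul hk (by linarith) h1.le hk0
    have h8 : 0 ≤ (x - y) * (1 / ((1 + y) * (1 + x))) := by positivity
    have h9 : 1 / (2 * (1 - x)) + b ^ 2 * (1 - x) ≤ b := by linarith
    have h10 : 1 / (2 * (1 - x)) * (2 * (1 - x)) = 1 := by field_simp
    have h11 := mul_le_mul_of_nonneg_right h9 (by linarith : 0 ≤ 2 * (1 - x))
    nlinarith only [h10, h11, sq_nonneg (2 * (b * (1 - x)) - 1 / 2)]
  have h6 : 1 / (1 - x) ^ 2 ≤ 2 * (1 / ((1 - y) * (1 - x))) := by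
    rw [mul_one_div, div_le_div_iff₀ (by positivity) (by positivity)]
    nlinarith only [hsmall, h1]
  have h7 : 1 / (1 + x) ^ 2 ≤ 1 / ((1 + y) * (1 + x)) := by
    apply one_div_le_one_div_of_le (by positivity)
    nlinarith only [hyx, h3]
  have h8 : 0 < 1 / ((1 + y) * (1 + x)) := by positivity
  rw [h, barrierHess]
  have h9 : 1 / (1 - x) ^ 2 + 1 / (1 + x) ^ 2 + k
      ≤ 2 * (1 / ((1 - y) * (1 - x)) + 1 / ((1 + y) * (1 + x)) + k) := by linarith
  nlinarith only [mul_le_mul_of_nonneg_left h9 h5]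

/-- The invariant of the gradient along the run, in one dimension. -/
structure ScalarInv (b w e : ℝ) : Prop where
  abs_le : |e| ≤ 0.65 * b
  of_pos : 0 < w → -(0.006 * b) ≤ e ∨ (w ≤ 0.34 ∧ -(0.3 * b) ≤ e)
  of_neg : w < 0 → e ≤ 0.006 * b ∨ (-0.34 ≤ w ∧ e ≤ 0.3 * b)

/-- An inexact Newton step in one dimension. -/
structure ScalarStep (ε b k w w' e g : ℝ) : Prop where
  mem : w ∈ Set.Ioo (-1 : ℝ) 1
  eps_nonneg : 0 ≤ ε
  eps_le : ε ≤ 1 / 300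
  b_pos : 0 < b
  le_k : b ^ 2 + 0.7 ≤ k
  abs_g_le : |g| ≤ b
  residual : |e + g + (barrierHess w + k) * (w' - w)| ≤ ε * ((barrierHess w + k) * |w' - w|)

variable {ε b k w w' e g : ℝ}

theorem ScalarInv.neg (h : ScalarInv b w e) : ScalarInv b (-w) (-e) := by
  refine ⟨by rw [abs_neg]; exact h.abs_le, fun hw => ?_, fun hw => ?_⟩
  · rcases h.of_neg (by linarith) with h1 | ⟨h1, h2⟩
    · exact .inl (by linarith)
    · exact .inr ⟨by linarith, by linarith⟩
  · rcases h.of_pos (by linarith) with h1 | ⟨h1, h2⟩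
    · exact .inl (by linarith)
    · exact .inr ⟨by linarith, by linarith⟩

theorem ScalarStep.neg (h : ScalarStep ε b k w w' e g) :
    ScalarStep ε b k (-w) (-w') (-e) (-g) := by
  refine ⟨⟨by linarith [h.mem.2], by linarith [h.mem.1]⟩, h.eps_nonneg, h.eps_le, h.b_pos, h.le_k,
    by rw [abs_neg]; exact h.abs_g_le, ?_⟩
  have h1 : -e + -g + (barrierHess (-w) + k) * (-w' - -w)
      = -(e + g + (barrierHess w + k) * (w' - w)) := by rw [barrierHess_neg]; ring
  have h2 : -w' - -w = -(w' - w) := by ring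
  rw [h1, abs_neg, h2, abs_neg, barrierHess_neg]
  exact h.residual

/-- The function $M\beta/(n+\beta^2)$ is largest at $\beta=\sqrt n$, with value $M/(2\sqrt n)$. -/
theorem le_of_mul_add_sq_le {n M θ β : ℝ} (hn : 0 < n)
    (h : θ * (n + β ^ 2) ≤ M * β) {a : ℝ} (ha : 0 < a) (hM : M ^ 2 ≤ 4 * a ^ 2 * n) : θ ≤ a := by
  have h1 : M * β ≤ a * (n + β ^ 2) := by
    nlinarith only [hM, ha, sq_nonneg (M - 2 * a * β)]
  exact le_of_mul_le_mul_right (h.trans h1) (by positivity)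

/-- A bound for the remainder of an outward step. -/
theorem sq_le_of_mul_add_sq_le {n M θ β : ℝ} (hθ : 0 ≤ θ) (hβ : 0 ≤ β) (hn : 0 < n)
    (h : θ * (n + β ^ 2) ≤ M * β)
    (hM : M ^ 2 * β + 0.64 * M * β * (n + β ^ 2) ≤ 0.64 * (n + β ^ 2) ^ 2) :
    θ ^ 2 ≤ 0.64 * β * (1 - θ) := by
  have hN : 0 < n + β ^ 2 := by positivity
  generalize n + β ^ 2 = N at h hM hN
  have h1 : (θ * N) ^ 2 ≤ (M * β) ^ 2 := pow_le_pow_left₀ (by positivity) h 2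
  have h2 : 0.64 * β * N * (θ * N) ≤ 0.64 * β * N * (M * β) :=
    mul_le_mul_of_nonneg_left h (by positivity)
  have h3 := mul_le_mul_of_nonneg_left hM hβ
  have h4 : θ ^ 2 * N ^ 2 ≤ 0.64 * β * (1 - θ) * N ^ 2 := by nlinarith only [h1, h2, h3]
  exact le_of_mul_le_mul_right h4 (by positivity)

/-- Used for the wall that the step moves away from: $\varphi$ is the step relative to the distance
to that wall, $c$ and $K$ are the rescaled $b$ and $k$. The constant $0.83$ is $1.656/2$ rounded up.
-/
theorem inward_bounds {φ c K : ℝ} (hφ : 0 ≤ φ) (hc : 0 ≤ c) (hcK : c ^ 2 ≤ K)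
    (h : φ * (1 + K) ≤ 1.656 * c) :
    φ ≤ 0.83 ∧ φ ^ 2 ≤ 0.64 * c * (1 + φ) ∧ φ ^ 2 ≤ 0.41 * (1 + K) := by
  have hK : 0 ≤ K := (sq_nonneg c).trans hcK
  have h1 : φ * (1 + c ^ 2) ≤ 1.656 * c := le_trans (by gcongr) h
  have h2 : φ ≤ 0.83 := le_of_mul_add_sq_le one_pos h1 (by norm_num) (by norm_num)
  refine ⟨h2, ?_, ?_⟩
  · have hN : 0 < 1 + c ^ 2 := by positivity
    have h3 : φ * (1.656 - 0.64 * (1 + c ^ 2)) ≤ 0.64 * (1 + c ^ 2) := by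
      rcases le_total (1.656 - 0.64 * (1 + c ^ 2)) 0 with h4 | h4
      · nlinarith only [h4, hφ, hN]
      · have h5 : φ * (1 + c ^ 2) * (1.656 - 0.64 * (1 + c ^ 2))
            ≤ 1.656 * c * (1.656 - 0.64 * (1 + c ^ 2)) := mul_le_mul_of_nonneg_right h1 h4
        have h6 : 1.656 * c * (1.656 - 0.64 * (1 + c ^ 2)) ≤ 0.64 * (1 + c ^ 2) ^ 2 := by
          nlinarith only [hc, sq_nonneg (c - 1), sq_nonneg (c ^ 2 - 1 / 2), sq_nonneg (c - 1 / 2),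
            mul_nonneg hc (sq_nonneg (c - 1 / 2))]
        nlinarith only [h5, h6, hN]
    have h7 : φ * (φ * (1 + c ^ 2)) ≤ φ * (1.656 * c) := mul_le_mul_of_nonneg_left h1 hφ
    have h8 : φ ^ 2 * (1 + c ^ 2) ≤ 0.64 * c * (1 + φ) * (1 + c ^ 2) := by
      nlinarith only [h7, mul_le_mul_of_nonneg_left h3 hc]
    exact le_of_mul_le_mul_right h8 hN
  · have h3 : (φ * (1 + K)) ^ 2 ≤ (1.656 * c) ^ 2 := pow_le_pow_left₀ (by positivity) h 2
    have h4 : 2.742336 * K ≤ 0.41 * (1 + K) ^ 3 := by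
      nlinarith only [mul_nonneg (by linarith : 0 ≤ K + 4) (sq_nonneg (K - 1 / 2)), hK]
    have h5 : φ ^ 2 * (1 + K) ^ 2 ≤ 0.41 * (1 + K) * (1 + K) ^ 2 := by nlinarith only [h3, h4, hcK]
    exact le_of_mul_le_mul_right h5 (by positivity)

end Scalar

end OQNS

namespace OQNS

/-! ### Invariance of the scalar gradient bounds under one step. -/

section ScalarStep

variable {ε b k w w' e g : ℝ}

/-- The bounds for a step to the right. -/
structure ForwardStep (b k w w' : ℝ) : Prop where
  mem' : w' ∈ Set.Ioo (-1 : ℝ) 1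
  right_le : w' - w ≤ 0.53 * (1 - w)
  left_le : w' - w ≤ 0.83 * (1 + w)
  left_sq_le : (w' - w) ^ 2 ≤ 0.41 * (1 + w) ^ 2 * (1 + k * (1 + w) ^ 2)
  right_rem_le : (w' - w) ^ 2 / ((1 - w) ^ 2 * (1 - w')) ≤ 0.644 * b
  left_rem_le : (w' - w) ^ 2 / ((1 + w) ^ 2 * (1 + w')) ≤ 0.644 * b
  length_le : (barrierHess w + k) * (w' - w) ≤ 1.656 * b

theorem ScalarStep.length_le (h : ScalarStep ε b k w w' e g) (hΔ : w ≤ w') {M : ℝ}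
    (hM : -e ≤ (M - 1) * b) : 299 / 300 * ((barrierHess w + k) * (w' - w)) ≤ M * b := by
  have h1 := (abs_le.mp h.residual).2
  have h2 := (abs_le.mp h.abs_g_le).1
  have h0 : 0 ≤ w' - w := sub_nonneg.mpr hΔ
  have hk : 0 ≤ k := by linarith [h.le_k, sq_nonneg b]
  have h3 : 0 ≤ (barrierHess w + k) * (w' - w) :=
    mul_nonneg (add_nonneg (barrierHess_nonneg w) hk) h0
  rw [abs_of_nonneg h0] at h1
  nlinarith only [h1, h2, hM, h3, h.eps_le]

/-- The outward part of a step, when the constants of the three cases are given. -/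
theorem outward_bounds {M n : ℝ} (hw : w ∈ Set.Ioo (-1 : ℝ) 1) (hΔ : w ≤ w')
    (hb : 0 < b) (hk : b ^ 2 + 0.7 ≤ k)
    (hl : (barrierHess w + k) * (w' - w) ≤ M * b) (hn : 0 < n)
    (hn' : n ≤ 1 + (1 - w) ^ 2 / (1 + w) ^ 2 + 0.7 * (1 - w) ^ 2)
    (hM : M ^ 2 ≤ 4 * 0.53 ^ 2 * n)
    (hM' : ∀ β : ℝ, 0 ≤ β →
      M ^ 2 * β + 0.64 * M * β * (n + β ^ 2) ≤ 0.64 * (n + β ^ 2) ^ 2) :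
    w' - w ≤ 0.53 * (1 - w) ∧ (w' - w) ^ 2 / ((1 - w) ^ 2 * (1 - w')) ≤ 0.644 * b := by
  have h1 : 0 < 1 - w := sub_pos.mpr hw.2
  have h3 : 0 < 1 + w := by linarith [hw.1]
  have h0 : 0 ≤ w' - w := sub_nonneg.mpr hΔ
  have hθ0 : 0 ≤ (w' - w) / (1 - w) := by positivity
  have hβ0 : 0 ≤ b * (1 - w) := by positivity
  have key : (w' - w) / (1 - w) * (n + (b * (1 - w)) ^ 2) ≤ M * (b * (1 - w)) := by
    have h5 : n + (b * (1 - w)) ^ 2 ≤ (barrierHess w + k) * (1 - w) ^ 2 := by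
      have h6 : barrierHess w * (1 - w) ^ 2 = 1 + (1 - w) ^ 2 / (1 + w) ^ 2 := by
        unfold barrierHess; field_simp
      nlinarith only [h6, hn', mul_le_mul_of_nonneg_right hk (sq_nonneg (1 - w))]
    calc _ ≤ (w' - w) / (1 - w) * ((barrierHess w + k) * (1 - w) ^ 2) := by gcongr
      _ = (barrierHess w + k) * (w' - w) * (1 - w) := by field_simp
      _ ≤ M * b * (1 - w) := by gcongr
      _ = _ := by ring
  have h53 := le_of_mul_add_sq_le hn key (by norm_num : (0 : ℝ) < 0.53) hM
  have hrem := sq_le_of_mul_add_sq_le hθ0 hβ0 hn key (hM' _ hβ0)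
  have e1 : w' - w = (w' - w) / (1 - w) * (1 - w) := by field_simp
  refine ⟨by rw [div_le_iff₀ h1] at h53; exact h53, ?_⟩
  have h2 : 0 < 1 - w' := by
    rw [div_le_iff₀ h1] at h53
    linarith
  rw [div_le_iff₀ (by positivity)]
  have e2 : 1 - w' = (1 - w) * (1 - (w' - w) / (1 - w)) := by field_simp; ring
  generalize (w' - w) / (1 - w) = θ at *
  rw [e1, e2]
  have h7 : 0 ≤ b * (1 - w) * (1 - θ) * (1 - w) ^ 2 := by
    have : 0 ≤ 1 - θ := by linarith
    positivity
  nlinarith only [mul_le_mul_of_nonneg_right hrem (sq_nonneg (1 - w)), h7]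

theorem ScalarStep.forward (h : ScalarStep ε b k w w' e g) (hi : ScalarInv b w e)
    (hΔ : w ≤ w') : ForwardStep b k w w' := by
  have hw := h.mem
  have hb := h.b_pos
  have h1 : 0 < 1 - w := sub_pos.mpr hw.2
  have h3 : 0 < 1 + w := by linarith [hw.1]
  have h0 : 0 ≤ w' - w := sub_nonneg.mpr hΔ
  have hlen := h.length_le hΔ (M := 1.65) (by linarith [(abs_le.mp hi.abs_le).1])
  have hlen' : (barrierHess w + k) * (w' - w) ≤ 1.656 * b := by linarith
  have hright : w' - w ≤ 0.53 * (1 - w)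
      ∧ (w' - w) ^ 2 / ((1 - w) ^ 2 * (1 - w')) ≤ 0.644 * b := by
    -- The three cases trade gradient against curvature. Left of the centre the full $0.65b$ can
    -- push outward, but both walls contribute, so $n=1+1+0.7$. To the right, either almost no
    -- gradient pushes outward and $n=1$ suffices, or $w\le 0.34$ and the far wall still gives
    -- $n=1.54$. Each $M$ is $1.65$, $1.006$ or $1.3$ times $300/299$, rounded up.
    rcases le_or_gt w 0 with hneg | hpos
    · refine outward_bounds (n := 2.7) hw hΔ hb h.le_k hlen' (by norm_num) ?_ (by norm_num) ?_
      · have h4 : 1 ≤ (1 - w) ^ 2 / (1 + w) ^ 2 := by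
          rw [one_le_div (by positivity)]
          nlinarith only [hneg]
        nlinarith only [h4, hneg]
      · intro β hβ
        nlinarith only [hβ, sq_nonneg (β - 1), sq_nonneg (β ^ 2 - 1), mul_nonneg hβ
          (sq_nonneg (β - 1))]
    · rcases hi.of_pos hpos with h4 | ⟨h4, h5⟩
      · have hl := h.length_le hΔ (M := 1.006) (by linarith)
        refine outward_bounds (n := 1) (M := 1.0094) hw hΔ hb h.le_k (by linarith) (by norm_num)
          ?_ (by norm_num) ?_
        · have : 0 ≤ (1 - w) ^ 2 / (1 + w) ^ 2 := by positivity
          nlinarith only [this, sq_nonneg (1 - w)]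
        · intro β hβ
          nlinarith only [hβ, sq_nonneg (β - 0.7), sq_nonneg (β ^ 2 - 0.49), mul_nonneg hβ
            (sq_nonneg (β - 0.7)), sq_nonneg (β ^ 2 - 0.7 * β), sq_nonneg (β ^ 2 - 0.8 * β + 0.1)]
      · have hl := h.length_le hΔ (M := 1.3) (by linarith)
        refine outward_bounds (n := 1.54) (M := 1.3044) hw hΔ hb h.le_k (by linarith)
          (by norm_num) ?_ (by norm_num) ?_
        · have h6 : 0.24 ≤ (1 - w) ^ 2 / (1 + w) ^ 2 := by
            rw [le_div_iff₀ (by positivity)]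
            nlinarith only [h4, hpos]
          nlinarith only [h6, h4, hpos]
        · intro β hβ
          nlinarith only [hβ, sq_nonneg (β - 0.9), sq_nonneg (β ^ 2 - 0.81), mul_nonneg hβ
            (sq_nonneg (β - 0.9)), sq_nonneg (β ^ 2 - 0.9 * β)]
  have hK : (w' - w) / (1 + w) * (1 + k * (1 + w) ^ 2) ≤ 1.656 * (b * (1 + w)) := by
    have h5 : 1 + k * (1 + w) ^ 2 ≤ (barrierHess w + k) * (1 + w) ^ 2 := by
      have h6 : barrierHess w * (1 + w) ^ 2 = 1 + (1 + w) ^ 2 / (1 - w) ^ 2 := by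
        unfold barrierHess; field_simp; ring
      have : 0 ≤ (1 + w) ^ 2 / (1 - w) ^ 2 := by positivity
      linarith
    calc _ ≤ (w' - w) / (1 + w) * ((barrierHess w + k) * (1 + w) ^ 2) := by gcongr
      _ = (barrierHess w + k) * (w' - w) * (1 + w) := by field_simp
      _ ≤ 1.656 * b * (1 + w) := by gcongr
      _ = _ := by ring
  obtain ⟨hl1, hl2, hl3⟩ := inward_bounds (by positivity) (by positivity)
    (by nlinarith only [mul_le_mul_of_nonneg_right h.le_k (sq_nonneg (1 + w)), sq_nonneg (1 + w)])
    hK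
  have e1 : w' - w = (w' - w) / (1 + w) * (1 + w) := by field_simp
  refine ⟨⟨by linarith [hw.1], by linarith [hright.1]⟩, hright.1,
    by rwa [div_le_iff₀ h3] at hl1, ?_, hright.2, ?_, hlen'⟩
  · rw [div_pow, div_le_iff₀ (by positivity)] at hl3
    linarith
  · have h4 : 0 < 1 + w' := by linarith
    rw [div_le_iff₀ (by positivity)]
    have e2 : 1 + w' = (1 + w) * (1 + (w' - w) / (1 + w)) := by field_simp; ring
    have hφ : 0 ≤ (w' - w) / (1 + w) := by positivity
    generalize (w' - w) / (1 + w) = φ at *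
    rw [e1, e2]
    have h7 : 0 ≤ b * (1 + w) * (1 + φ) * (1 + w) ^ 2 := by positivity
    nlinarith only [mul_le_mul_of_nonneg_right hl2 (sq_nonneg (1 + w)), h7]

/-- The scaled gradient after the step. -/
noncomputable def nextGrad (k w w' e g : ℝ) : ℝ :=
  e + g + (barrierGrad w' - barrierGrad w) + k * (w' - w)

theorem nextGrad_neg (k w w' e g : ℝ) :
    nextGrad k (-w) (-w') (-e) (-g) = -nextGrad k w w' e g := by
  simp only [nextGrad, barrierGrad_neg]
  ring

theorem nextGrad_eq (hw : w ∈ Set.Ioo (-1 : ℝ) 1) (hw' : w' ∈ Set.Ioo (-1 : ℝ) 1) :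
    nextGrad k w w' e g = (w' - w) ^ 2 / ((1 - w) ^ 2 * (1 - w'))
      - (w' - w) ^ 2 / ((1 + w) ^ 2 * (1 + w')) + (e + g + (barrierHess w + k) * (w' - w)) := by
  rw [← barrierGrad_taylor hw hw', nextGrad]
  ring

/-- A step that crosses the centre leaves only a small gradient that points outward. -/
theorem crossing_bounds (hw : w ∈ Set.Ioo (-1 : ℝ) 1) (hw0 : w < 0) (hw0' : 0 < w')
    (hw' : w' < 1) (hb : 0 < b) (hk : b ^ 2 + 0.7 ≤ k)
    (hl : (barrierHess w + k) * (w' - w) ≤ 1.656 * b)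
    (hlt : (w' - w) ^ 2 / ((1 - w) ^ 2 * (1 - w')) < (w' - w) ^ 2 / ((1 + w) ^ 2 * (1 + w'))) :
    w' ≤ 0.34 ∧ (w' - w) ^ 2 / ((1 + w) ^ 2 * (1 + w'))
      - (w' - w) ^ 2 / ((1 - w) ^ 2 * (1 - w')) ≤ 0.294 * b := by
  have h3 : 0 < 1 + w := by linarith [hw.1]
  have h1 : 0 < 1 - w := by linarith
  have h2 : 0 < 1 - w' := sub_pos.mpr hw'
  have hs : 0 < 1 - w ^ 2 := by nlinarith only [h1, h3]
  have hFeq : barrierHess w * (1 - w ^ 2) ^ 2 = 2 * (1 + w ^ 2) := by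
    have e : 1 - w ^ 2 = (1 - w) * (1 + w) := by ring
    rw [e]
    unfold barrierHess
    field_simp
    ring
  have hF : 2 + 6 * w ^ 2 + 10 * w ^ 4 ≤ barrierHess w := by
    have h4 : (2 + 6 * w ^ 2 + 10 * w ^ 4) * (1 - w ^ 2) ^ 2 ≤ barrierHess w * (1 - w ^ 2) ^ 2 := by
      rw [hFeq]
      have h5 : 0 ≤ w ^ 6 := by positivity
      have h6 : 0 ≤ w ^ 6 * (1 - w ^ 2) := by positivity
      nlinarith only [h5, h6]
    exact le_of_mul_le_mul_right h4 (by positivity)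
  have hΔ : 0 < w' - w := by linarith
  -- Rearrangement of $(1+w)^2(1+w')<(1-w)^2(1-w')$, the hypothesis that the left wall's remainder
  -- dominates.
  have hcross : w' * (1 + w ^ 2) < 2 * -w := by
    rw [div_lt_div_iff₀ (by positivity) (by positivity)] at hlt
    have := lt_of_mul_lt_mul_left hlt (by positivity)
    nlinarith only [this]
  -- The total curvature is at least $2.7+b^2$, and $1.656/(2\sqrt{2.7})<0.504$.
  have hΔ504 : w' - w ≤ 0.504 := by
    refine le_of_mul_add_sq_le (n := 2.7) (M := 1.656) (β := b) (by norm_num) ?_ (by norm_num)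
      (by norm_num)
    refine le_trans ?_ hl
    rw [mul_comm]
    refine mul_le_mul_of_nonneg_right ?_ hΔ.le
    nlinarith only [hF, hk, sq_nonneg w, sq_nonneg (w ^ 2)]
  have hv : -w ≤ 0.42 := by
    by_contra hcon
    push Not at hcon
    have h4 : 0.1764 ≤ w ^ 2 := by nlinarith only [hcon]
    have h5 : 4.069 + b ^ 2 ≤ barrierHess w + k := by nlinarith only [h4, hF, hk]
    have h6 : (4.069 + b ^ 2) * 0.42 ≤ (barrierHess w + k) * (w' - w) :=
      mul_le_mul h5 (by linarith) (by norm_num) (by linarith [sq_nonneg b])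
    nlinarith only [h6, hl, sq_nonneg (b - 1.97)]
  refine ⟨?_, ?_⟩
  · by_contra hcon
    push Not at hcon
    nlinarith only [hcon, hcross, hΔ504, sq_nonneg w, mul_nonneg hw0'.le (sq_nonneg w)]
  · have h4 : (w' - w) ^ 2 / ((1 + w) ^ 2 * (1 + w')) ≤ (w' - w) ^ 2 / (1 + w) ^ 2 := by
      gcongr
      nlinarith only [mul_pos (pow_pos h3 2) hw0']
    have h5 : (w' - w) ^ 2 / (1 - w) ^ 2 ≤ (w' - w) ^ 2 / ((1 - w) ^ 2 * (1 - w')) := by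
      gcongr
      nlinarith only [mul_pos (pow_pos h1 2) hw0']
    have h6 : (w' - w) ^ 2 / (1 + w) ^ 2 - (w' - w) ^ 2 / (1 - w) ^ 2
        = (w' - w) ^ 2 / (1 - w ^ 2) ^ 2 * (4 * -w) := by
      have e : 1 - w ^ 2 = (1 - w) * (1 + w) := by ring
      rw [e]
      field_simp
      ring
    have h7 : barrierHess w * (w' - w) ^ 2 = (w' - w) ^ 2 / (1 - w ^ 2) ^ 2 * (2 * (1 + w ^ 2)) := by
      rw [← hFeq]
      field_simp
    -- Subtracting $k(w'-w)$ with $k\ge b^2+0.7\ge 1.672b$ leaves a concave quadratic in the step,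
    -- whose maximum $1.656^2/(4\cdot 1.672)$ gives $0.4101$.
    have h8 : barrierHess w * (w' - w) ≤ b * (1.656 - 1.672 * (w' - w)) := by
      have : 1.672 * b ≤ k := by nlinarith only [hk, sq_nonneg (b - 0.836)]
      nlinarith only [hl, mul_le_mul_of_nonneg_right this hΔ.le]
    have h9 : barrierHess w * (w' - w) ^ 2 ≤ 0.4101 * b := by
      have h10 := mul_le_mul_of_nonneg_right h8 hΔ.le
      have h11 : (1.656 - 1.672 * (w' - w)) * (w' - w) ≤ 0.4101 := by
        nlinarith only [sq_nonneg (w' - w - 0.4952)]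
      nlinarith only [h10, mul_le_mul_of_nonneg_left h11 hb.le]
    have h10 : 2 * -w ≤ 0.7142 * (1 + w ^ 2) := by nlinarith only [hv, hw0]
    have h11 : 0 ≤ (w' - w) ^ 2 / (1 - w ^ 2) ^ 2 := by positivity
    generalize (w' - w) ^ 2 / (1 - w ^ 2) ^ 2 = P at *
    nlinarith only [hb, h4, h5, h6, h7, h9, mul_le_mul_of_nonneg_left h10 h11]

theorem ScalarStep.abs_residual_le (h : ScalarStep ε b k w w' e g) (hi : ScalarInv b w e)
    (hΔ : w ≤ w') : |e + g + (barrierHess w + k) * (w' - w)| ≤ 0.006 * b := by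
  have h1 := (h.forward hi hΔ).length_le
  have h0 : 0 ≤ w' - w := sub_nonneg.mpr hΔ
  have hk : 0 ≤ k := by linarith [h.le_k, sq_nonneg b]
  have h3 : 0 ≤ (barrierHess w + k) * (w' - w) :=
    mul_nonneg (add_nonneg (barrierHess_nonneg w) hk) h0
  refine h.residual.trans ?_
  rw [abs_of_nonneg h0]
  nlinarith only [h1, h3, h.eps_le, h.eps_nonneg]

/-- Each wall's remainder is at most $0.644b$ and the residual at most $0.006b$. As the remainders
have opposite signs, this gives $0.65b$. An outward-pushing gradient beyond the residual needs the
farther wall to dominate, which for a rightward step ending at $w'>0$ requires crossing the centre;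
then $0.294+0.006=0.3$. -/
theorem ScalarStep.inv_of_le (h : ScalarStep ε b k w w' e g) (hi : ScalarInv b w e)
    (hΔ : w ≤ w') : ScalarInv b w' (nextGrad k w w' e g) := by
  have hf := h.forward hi hΔ
  have hw := h.mem
  have hρ := abs_le.mp (h.abs_residual_le hi hΔ)
  have h1 : 0 < 1 - w := sub_pos.mpr hw.2
  have h2 : 0 < 1 - w' := sub_pos.mpr hf.mem'.2
  have h3 : 0 < 1 + w := by linarith [hw.1]
  have h4 : 0 < 1 + w' := by linarith [hf.mem'.1]
  have hX : 0 ≤ (w' - w) ^ 2 / ((1 - w) ^ 2 * (1 - w')) := by positivity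
  have hY : 0 ≤ (w' - w) ^ 2 / ((1 + w) ^ 2 * (1 + w')) := by positivity
  have hX' := hf.right_rem_le
  have hY' := hf.left_rem_le
  rw [nextGrad_eq hw hf.mem']
  refine ⟨abs_le.mpr ⟨by linarith [hρ.1], by linarith [hρ.2]⟩, fun hw0' => ?_, fun hw0' => .inl ?_⟩
  · rcases le_or_gt ((w' - w) ^ 2 / ((1 + w) ^ 2 * (1 + w')))
      ((w' - w) ^ 2 / ((1 - w) ^ 2 * (1 - w'))) with hle | hlt
    · exact .inl (by linarith [hρ.1])
    · have hw0 : w < 0 := by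
        by_contra hcon
        push Not at hcon
        refine absurd hlt (not_lt.mpr ?_)
        gcongr <;> linarith
      obtain ⟨h5, h6⟩ := crossing_bounds hw hw0 hw0' hf.mem'.2 h.b_pos h.le_k hf.length_le hlt
      exact .inr ⟨h5, by linarith [hρ.1]⟩
  · have : (w' - w) ^ 2 / ((1 - w) ^ 2 * (1 - w')) ≤ (w' - w) ^ 2 / ((1 + w) ^ 2 * (1 + w')) := by
      gcongr <;> linarith
    linarith [hρ.2]

/-- Leftward steps follow from rightward ones by reflection in the origin. -/
theorem ScalarStep.inv (h : ScalarStep ε b k w w' e g) (hi : ScalarInv b w e) :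
    w' ∈ Set.Ioo (-1 : ℝ) 1 ∧ ScalarInv b w' (nextGrad k w w' e g) := by
  rcases le_total w w' with hΔ | hΔ
  · exact ⟨(h.forward hi hΔ).mem', h.inv_of_le hi hΔ⟩
  · have h1 := (h.neg.forward hi.neg (neg_le_neg hΔ)).mem'
    have h2 := (h.neg.inv_of_le hi.neg (neg_le_neg hΔ)).neg
    rw [nextGrad_neg, neg_neg, neg_neg] at h2
    exact ⟨⟨by linarith [h1.2], by linarith [h1.1]⟩, h2⟩

end ScalarStep

end OQNS

namespace OQNS

/-! ### Energy and potential inequalities for a scalar step. -/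

section ScalarEnergy

variable {ε b k w w' e g : ℝ}

/-- The consequences of a step that enter the potential argument. -/
structure ScalarEnergy (ε k w w' e g : ℝ) : Prop where
  length_le_one : barrierHess w * (w' - w) ^ 2 ≤ 1
  next_length_le : barrierHess w' * (w' - w) ^ 2 ≤ 4.53 * (barrierHess w * (w' - w) ^ 2)
  sq_grad_le : nextGrad k w w' e g ^ 2 ≤ (barrierHess w' + k)
    * (0.4141 * (barrierHess w * (w' - w) ^ 2) + 0.0045 * ((barrierHess w + k) * (w' - w) ^ 2))
  abs_grad_le : |nextGrad k w w' e g| ≤ √(barrierHess w' + k)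
    * (barrierHess w * (w' - w) ^ 2 + 0.01 * ((barrierHess w + k) * (w' - w) ^ 2) + 100 * ε ^ 2)
  energy_le : 0.9933 * ((barrierHess w + k) * ((barrierHess w + k) * (w' - w) ^ 2)) ≤ (e + g) ^ 2

theorem ScalarEnergy.of_neg (h : ScalarEnergy ε k (-w) (-w') (-e) (-g)) :
    ScalarEnergy ε k w w' e g := by
  obtain ⟨h1, h2, h3, h4, h5⟩ := h
  have e1 : (-w' - -w) ^ 2 = (w' - w) ^ 2 := by ring
  have e2 : (-e + -g) ^ 2 = (e + g) ^ 2 := by ring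
  rw [barrierHess_neg, e1] at h1
  rw [barrierHess_neg, barrierHess_neg, e1] at h2
  rw [barrierHess_neg, barrierHess_neg, e1, nextGrad_neg, neg_sq] at h3
  rw [barrierHess_neg, barrierHess_neg, e1, nextGrad_neg, abs_neg] at h4
  rw [barrierHess_neg, e1, e2] at h5
  exact ⟨h1, h2, h3, h4, h5⟩

theorem sq_sub_le_of_sq_le {X Y A : ℝ} (hX : 0 ≤ X) (hY : 0 ≤ Y) (hXA : X ^ 2 ≤ A)
    (hYA : Y ^ 2 ≤ A) : (X - Y) ^ 2 ≤ A := by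
  rcases le_total X Y with h | h <;> nlinarith

theorem barrierHess_mul_sq (w v : ℝ) :
    barrierHess w * v ^ 2 = (v / (1 - w)) ^ 2 + (v / (1 + w)) ^ 2 := by
  unfold barrierHess
  rw [div_pow, div_pow]
  ring

theorem ForwardStep.length_le_one (hf : ForwardStep b k w w') (hw : w ∈ Set.Ioo (-1 : ℝ) 1)
    (hΔ : w ≤ w') : barrierHess w * (w' - w) ^ 2 ≤ 1 := by
  have h1 : 0 < 1 - w := sub_pos.mpr hw.2
  have h3 : 0 < 1 + w := by linarith [hw.1]
  have h0 : 0 ≤ w' - w := sub_nonneg.mpr hΔ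
  have h4 : (w' - w) / (1 - w) ≤ 0.53 := by rw [div_le_iff₀ h1]; exact hf.right_le
  have h5 : (w' - w) / (1 + w) ≤ 0.83 := by rw [div_le_iff₀ h3]; exact hf.left_le
  have h6 : 0 ≤ (w' - w) / (1 - w) := by positivity
  have h7 : 0 ≤ (w' - w) / (1 + w) := by positivity
  rw [barrierHess_mul_sq]
  nlinarith only [h4, h5, h6, h7]

theorem ForwardStep.next_length_le (hf : ForwardStep b k w w') (hw : w ∈ Set.Ioo (-1 : ℝ) 1)
    (hΔ : w ≤ w') :
    barrierHess w' * (w' - w) ^ 2 ≤ 4.53 * (barrierHess w * (w' - w) ^ 2) := by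
  have h1 : 0 < 1 - w := sub_pos.mpr hw.2
  have h3 : 0 < 1 + w := by linarith [hw.1]
  have h2 : 0.47 * (1 - w) ≤ 1 - w' := by linarith [hf.right_le]
  have h4 : barrierHess w' ≤ 4.53 * barrierHess w := by
    unfold barrierHess
    have h5 : 1 / (1 - w') ^ 2 ≤ 4.53 * (1 / (1 - w) ^ 2) := by
      have : 0 < 1 - w' := by linarith
      rw [mul_one_div, div_le_div_iff₀ (by positivity) (by positivity)]
      nlinarith only [h2, h1]
    have h7 : 1 / (1 + w') ^ 2 ≤ 1 / (1 + w) ^ 2 := by gcongr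
    have h9 : 0 ≤ 1 / (1 + w) ^ 2 := by positivity
    linarith
  nlinarith only [mul_le_mul_of_nonneg_right h4 (sq_nonneg (w' - w))]

theorem ForwardStep.hess_le (hf : ForwardStep b k w w') (hw : w ∈ Set.Ioo (-1 : ℝ) 1)
    (hΔ : w ≤ w') (hk : 0 ≤ k) : barrierHess w + k ≤ 4 * (barrierHess w' + k) := by
  have h1 : 0 < 1 - w := sub_pos.mpr hw.2
  have h3 : 0 < 1 + w := by linarith [hw.1]
  have h2 : 0 < 1 - w' := sub_pos.mpr hf.mem'.2
  have h4 : 0 < 1 + w' := by linarith [hf.mem'.1]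
  unfold barrierHess
  have h5 : 1 / (1 - w) ^ 2 ≤ 1 / (1 - w') ^ 2 := by gcongr
  have h6 : 1 / (1 + w) ^ 2 ≤ 4 * (1 / (1 + w') ^ 2) := by
    rw [mul_one_div, div_le_div_iff₀ (by positivity) (by positivity)]
    nlinarith only [hf.left_le, h3, h4]
  have h8 : 0 ≤ 1 / (1 - w') ^ 2 := by positivity
  linarith

/-- Both wall terms are nonnegative, so the square of their difference is at most the larger square.
The linear bound in the squared step length feeds the potential, the quadratic one the sum of
decrements. -/
theorem ForwardStep.rem_le (hf : ForwardStep b k w w') (hw : w ∈ Set.Ioo (-1 : ℝ) 1)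
    (hΔ : w ≤ w') (hk : 0 ≤ k) {R : ℝ}
    (hR : R = (w' - w) ^ 2 / ((1 - w) ^ 2 * (1 - w')) - (w' - w) ^ 2 / ((1 + w) ^ 2 * (1 + w'))) :
    R ^ 2 ≤ 0.41 * (barrierHess w * (w' - w) ^ 2) * (barrierHess w' + k) ∧
      R ^ 2 ≤ (barrierHess w * (w' - w) ^ 2) ^ 2 * (barrierHess w' + k) := by
  have h1 : 0 < 1 - w := sub_pos.mpr hw.2
  have h3 : 0 < 1 + w := by linarith [hw.1]
  have h2 : 0 < 1 - w' := sub_pos.mpr hf.mem'.2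
  have h4 : 0 < 1 + w' := by linarith [hf.mem'.1]
  have h0 : 0 ≤ w' - w := sub_nonneg.mpr hΔ
  have hX : (w' - w) ^ 2 / ((1 - w) ^ 2 * (1 - w')) = ((w' - w) / (1 - w)) ^ 2 * (1 / (1 - w')) := by
    field_simp
  have hY : (w' - w) ^ 2 / ((1 + w) ^ 2 * (1 + w')) = ((w' - w) / (1 + w)) ^ 2 * (1 / (1 + w')) := by
    field_simp
  have hH : barrierHess w' = (1 / (1 - w')) ^ 2 + (1 / (1 + w')) ^ 2 := by
    unfold barrierHess
    rw [div_pow, div_pow, one_pow]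
  have hθ : ((w' - w) / (1 - w)) ^ 2 ≤ 0.41 := by
    have h5 : (w' - w) / (1 - w) ≤ 0.53 := by rw [div_le_iff₀ h1]; exact hf.right_le
    have h6 : 0 ≤ (w' - w) / (1 - w) := by positivity
    nlinarith only [h5, h6]
  have hφ : ((w' - w) / (1 + w)) ^ 2 * (1 / (1 + w')) ^ 2 ≤ 0.41 * ((1 / (1 + w')) ^ 2 + k) := by
    have h5 : ((w' - w) / (1 + w)) ^ 2 ≤ 0.41 * (1 + k * (1 + w) ^ 2) := by
      rw [div_pow, div_le_iff₀ (by positivity)]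
      linarith [hf.left_sq_le]
    have h6 : (1 + w) ^ 2 * (1 / (1 + w')) ^ 2 ≤ 1 := by
      rw [← mul_pow, mul_one_div]
      exact pow_le_one₀ (by positivity) ((div_le_one h4).mpr (by linarith))
    have h7 := mul_le_mul_of_nonneg_right h5 (sq_nonneg (1 / (1 + w')))
    nlinarith only [h7, mul_le_mul_of_nonneg_left h6 hk]
  rw [hR, hX, hY, barrierHess_mul_sq, hH]
  have hp : 0 ≤ 1 / (1 - w') := by positivity
  have hq : 0 ≤ 1 / (1 + w') := by positivity
  have hs : 0 ≤ ((w' - w) / (1 - w)) ^ 2 := sq_nonneg _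
  have ht : 0 ≤ ((w' - w) / (1 + w)) ^ 2 := sq_nonneg _
  generalize ((w' - w) / (1 - w)) ^ 2 = s at *
  generalize ((w' - w) / (1 + w)) ^ 2 = t at *
  generalize 1 / (1 - w') = p at *
  generalize 1 / (1 + w') = q at *
  have hp2 := sq_nonneg p
  have hq2 := sq_nonneg q
  refine ⟨sq_sub_le_of_sq_le (by positivity) (by positivity) ?_ ?_,
    sq_sub_le_of_sq_le (by positivity) (by positivity) ?_ ?_⟩
  · calc (s * p) ^ 2 = s * s * p ^ 2 := by ring
      _ ≤ 0.41 * (s + t) * (p ^ 2 + q ^ 2 + k) := by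
        refine mul_le_mul ?_ (by linarith) hp2 (by positivity)
        exact mul_le_mul hθ (by linarith) hs (by norm_num)
  · calc (t * q) ^ 2 = t * (t * q ^ 2) := by ring
      _ ≤ (s + t) * (0.41 * (p ^ 2 + q ^ 2 + k)) :=
        mul_le_mul (by linarith) (by linarith) (by positivity) (by positivity)
      _ = _ := by ring
  · calc (s * p) ^ 2 = s ^ 2 * p ^ 2 := by ring
      _ ≤ (s + t) ^ 2 * (p ^ 2 + q ^ 2 + k) := by
        gcongr <;> linarith
  · calc (t * q) ^ 2 = t ^ 2 * q ^ 2 := by ring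
      _ ≤ (s + t) ^ 2 * (p ^ 2 + q ^ 2 + k) := by
        gcongr <;> linarith

theorem ScalarStep.energy_of_le (h : ScalarStep ε b k w w' e g) (hi : ScalarInv b w e)
    (hΔ : w ≤ w') : ScalarEnergy ε k w w' e g := by
  have hf := h.forward hi hΔ
  have hw := h.mem
  have hk : 0 ≤ k := by linarith [h.le_k, sq_nonneg b]
  have h0 : 0 ≤ w' - w := sub_nonneg.mpr hΔ
  obtain ⟨hR1, hR2⟩ := hf.rem_le hw hΔ hk rfl
  have hH := hf.hess_le hw hΔ hk
  have hres := h.residual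
  have hx0 : 0 ≤ barrierHess w * (w' - w) ^ 2 := mul_nonneg (barrierHess_nonneg w) (sq_nonneg _)
  have hW := barrierHess_nonneg w
  have hW' := barrierHess_nonneg w'
  have hε := h.eps_nonneg
  have hε1 := h.eps_le
  have hε2 : ε ^ 2 ≤ 1 / 90000 := by nlinarith only [hε, hε1]
  rw [abs_of_nonneg h0] at hres
  have hρ : (e + g + (barrierHess w + k) * (w' - w)) ^ 2
      ≤ 4 * ε ^ 2 * ((barrierHess w + k) * (w' - w) ^ 2) * (barrierHess w' + k) := by
    have h1 : (e + g + (barrierHess w + k) * (w' - w)) ^ 2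
        ≤ (ε * ((barrierHess w + k) * (w' - w))) ^ 2 := by
      rw [← sq_abs]
      exact pow_le_pow_left₀ (abs_nonneg _) hres 2
    have h2 : 0 ≤ ε ^ 2 * ((barrierHess w + k) * (w' - w) ^ 2) := by positivity
    nlinarith only [h1, mul_le_mul_of_nonneg_left hH h2]
  have hx : barrierHess w * (w' - w) ^ 2 ≤ (barrierHess w + k) * (w' - w) ^ 2 := by
    nlinarith only [mul_nonneg hk (sq_nonneg (w' - w))]
  refine ⟨hf.length_le_one hw hΔ, hf.next_length_le hw hΔ, ?_, ?_, ?_⟩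
  · rw [nextGrad_eq hw hf.mem']
    set R := (w' - w) ^ 2 / ((1 - w) ^ 2 * (1 - w')) - (w' - w) ^ 2 / ((1 + w) ^ 2 * (1 + w'))
    have hZ : 0 ≤ (barrierHess w + k) * (w' - w) ^ 2 * (barrierHess w' + k) := by positivity
    -- The weight $100$ gives $1.01\cdot 0.41=0.4141$ and $101\cdot 4/90000<0.0045$.
    nlinarith only [hR1, hρ, sq_nonneg (R - 100 * (e + g + (barrierHess w + k) * (w' - w))),
      mul_le_mul_of_nonneg_right hε2 hZ]
  · rw [nextGrad_eq hw hf.mem']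
    refine (abs_add_le _ _).trans ?_
    have h1 := Real.abs_le_sqrt hR2
    rw [Real.sqrt_mul (sq_nonneg _), Real.sqrt_sq hx0] at h1
    have hZ : 0 ≤ (barrierHess w + k) * (w' - w) ^ 2 := by positivity
    have h2 : |e + g + (barrierHess w + k) * (w' - w)| ≤ √(barrierHess w' + k)
        * (0.01 * ((barrierHess w + k) * (w' - w) ^ 2) + 100 * ε ^ 2) := by
      apply abs_le_of_sq_le_sq _ (by positivity)
      rw [mul_pow, Real.sq_sqrt (by positivity)]
      refine hρ.trans ?_
      rw [mul_comm]
      gcongr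
      nlinarith only [sq_nonneg (0.01 * ((barrierHess w + k) * (w' - w) ^ 2) - 100 * ε ^ 2)]
    linarith
  · have h1 : 299 / 300 * ((barrierHess w + k) * (w' - w)) ≤ -(e + g) := by
      have h2 := (abs_le.mp hres).2
      have h3 : 0 ≤ (barrierHess w + k) * (w' - w) := by positivity
      nlinarith only [h2, h3, hε1]
    have h2 := pow_le_pow_left₀ (by positivity) h1 2
    have h3 : 0 ≤ ((barrierHess w + k) * (w' - w)) ^ 2 := sq_nonneg _
    nlinarith only [h2, h3]

theorem ScalarStep.energy (h : ScalarStep ε b k w w' e g) (hi : ScalarInv b w e) :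
    ScalarEnergy ε k w w' e g := by
  rcases le_total w w' with hΔ | hΔ
  · exact h.energy_of_le hi hΔ
  · exact (h.neg.energy_of_le hi.neg (neg_le_neg hΔ)).of_neg

theorem sq_add_le_weighted {x y A B : ℝ} (hA : 0 < A) (hB : 0 < B) {p q : ℝ} (hx : x ^ 2 ≤ A * p)
    (hy : y ^ 2 ≤ B * q) : (x + y) ^ 2 ≤ (A + B) * (p + q) := by
  have h1 : (x + y) ^ 2 * (A * B) ≤ (A + B) * (p + q) * (A * B) := by
    nlinarith only [sq_nonneg (x * B - y * A), mul_le_mul_of_nonneg_left hx hB.le,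
      mul_le_mul_of_nonneg_left hy hA.le, mul_pos hA hB, mul_le_mul_of_nonneg_left hx
      (sq_nonneg B), mul_le_mul_of_nonneg_left hy (sq_nonneg A),
      mul_le_mul_of_nonneg_left hx (mul_pos hA hB).le,
      mul_le_mul_of_nonneg_left hy (mul_pos hA hB).le]
  exact le_of_mul_le_mul_right h1 (mul_pos hA hB)

/-- The energy of the step is at most $(e+g)^2$ up to $0.9933$. Weighted Cauchy–Schwarz splits this
between the elliptical charge $G$ of $g$ and the squared decrement $L$ before the step, with free
prices $C$ and $\kappa$. The quantity $N$ collects what the round must pay for. -/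
theorem ScalarEnergy.potential (h : ScalarEnergy ε k w w' e g) (hk : 0 < k) {C κ G L N : ℝ}
    (hC : 0 < C) (hκ : 0 < κ) (hG : 0 ≤ G) (hL : 0 ≤ L) (hg : g ^ 2 ≤ k * G)
    (he : e ^ 2 ≤ (barrierHess w + k) * L)
    (hN : N * ((k * (w' - w) ^ 2) / C + (barrierHess w + k) * (w' - w) ^ 2 / κ)
      ≤ 0.9933 * ((barrierHess w + k) * (w' - w) ^ 2) ^ 2)
    (hN0 : w' = w → N ≤ 0) : N ≤ C * G + κ * L := by
  have hW := barrierHess_nonneg w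
  rcases eq_or_ne w' w with h0 | h0
  · exact (hN0 h0).trans (by positivity)
  · have hΔ : 0 < (w' - w) ^ 2 := by
      have := sub_ne_zero.mpr h0
      positivity
    have h1 := sq_add_le_weighted (by positivity : 0 < (barrierHess w + k) / κ)
      (by positivity : 0 < k / C) (p := κ * L) (q := C * G)
      (he.trans (le_of_eq (by field_simp))) (hg.trans (le_of_eq (by field_simp)))
    have h2 := mul_le_mul_of_nonneg_right (h.energy_le.trans h1) hΔ.le
    have hpos : 0 < (k * (w' - w) ^ 2) / C + (barrierHess w + k) * (w' - w) ^ 2 / κ := by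
      positivity
    refine le_of_mul_le_mul_right ?_ hpos
    refine hN.trans (le_trans (le_of_eq (by ring)) (h2.trans (le_of_eq ?_)))
    field_simp
    ring

end ScalarEnergy

end OQNS

namespace OQNS

/-! ### Translation of the run for $d=1$ into scalars. -/

section OneDimensional

variable {η B β c : ℝ} {T : ℕ} {rule : LandmarkRule} {g u w : ℕ → E 1}

theorem norm_sq_one (x : E 1) : ‖x‖ ^ 2 = x 0 ^ 2 := by
  simp [EuclideanSpace.norm_sq_eq]

theorem norm_one_eq (x : E 1) : ‖x‖ = |x 0| := by
  rw [← abs_norm, ← sq_eq_sq_iff_abs_eq_abs, norm_sq_one]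

theorem inner_one (x y : E 1) : inner ℝ x y = x 0 * y 0 := by
  simp [PiLp.inner_apply, mul_comm]

theorem mem_Ioo_of_norm_lt {x : E 1} (hx : ‖x‖ < 1) : x 0 ∈ Set.Ioo (-1 : ℝ) 1 := by
  rw [norm_one_eq] at hx
  exact abs_lt.mp hx

theorem norm_lt_of_mem_Ioo {x : E 1} (hx : x 0 ∈ Set.Ioo (-1 : ℝ) 1) : ‖x‖ < 1 := by
  rw [norm_one_eq]
  exact abs_lt.mpr hx

theorem one_sub_sq_ne {x : ℝ} (hx : x ∈ Set.Ioo (-1 : ℝ) 1) :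
    1 - x ≠ 0 ∧ 1 + x ≠ 0 ∧ 1 - x ^ 2 ≠ 0 := by
  have h1 : 0 < 1 - x := sub_pos.mpr hx.2
  have h2 : 0 < 1 + x := by linarith [hx.1]
  exact ⟨h1.ne', h2.ne', by nlinarith only [h1, h2]⟩

theorem ballHess_one {x : E 1} (hx : ‖x‖ < 1) (v : E 1) :
    ballHess x v = barrierHess (x 0) * v 0 ^ 2 := by
  obtain ⟨h1, h2, h3⟩ := one_sub_sq_ne (mem_Ioo_of_norm_lt hx)
  rw [ballHess, barrierHess, norm_sq_one, norm_sq_one, inner_one]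
  have e : 1 - x 0 ^ 2 = (1 - x 0) * (1 + x 0) := by ring
  rw [e]
  field_simp
  ring

theorem ballGrad_one {x : E 1} (hx : ‖x‖ < 1) : ballGrad x 0 = barrierGrad (x 0) := by
  obtain ⟨h1, h2, h3⟩ := one_sub_sq_ne (mem_Ioo_of_norm_lt hx)
  rw [ballGrad, barrierGrad, norm_sq_one, PiLp.smul_apply, smul_eq_mul]
  have e : 1 - x 0 ^ 2 = (1 - x 0) * (1 + x 0) := by ring
  rw [e]
  field_simp
  ring

/-- The curvature of the quadratic part, relative to `η`. -/
noncomputable def quadCoeff (η B β : ℝ) (g : ℕ → E 1) (t : ℕ) : ℝ :=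
  (1 + B ^ 2 * η + β * ∑ s ∈ Finset.Ico 1 t, g s 0 ^ 2) / η

/-- The gradient of `Φ_t` at `w_t`, relative to `η`. -/
noncomputable def scaledGrad (η B β : ℝ) (g w : ℕ → E 1) (t : ℕ) : ℝ :=
  phiGrad 1 η B β g w t (w t) 0 / η

theorem quadHess_one (hη : 0 < η) (t : ℕ) (v : E 1) :
    quadHess 1 η B β g t v 0 = η * quadCoeff η B β g t * v 0 := by
  have h := inner_quadHess η B β g t v (EuclideanSpace.single 0 1)
  simp only [inner_one, PiLp.single_apply, if_true, one_mul, mul_one] at h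
  have h1 : ∑ s ∈ Finset.Ico 1 t, g s 0 * v 0 * g s 0 = (∑ s ∈ Finset.Ico 1 t, g s 0 ^ 2) * v 0 := by
    rw [Finset.sum_mul]
    exact Finset.sum_congr rfl fun s _ => by ring
  rw [h, h1, quadCoeff, mul_div_cancel₀ _ hη.ne']
  push_cast
  ring

theorem phiForm_one (hη : 0 < η) (t : ℕ) {x : E 1} (hx : ‖x‖ < 1) (v : E 1) :
    phiForm 1 η B β g t x v = η * ((barrierHess (x 0) + quadCoeff η B β g t) * v 0 ^ 2) := by
  rw [phiForm_eq, quadForm, inner_one, quadHess_one hη, ballHess_one hx]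
  push_cast
  ring

theorem quadCoeff_mono (hη : 0 < η) (hβ : 0 ≤ β) {t : ℕ} (ht : 1 ≤ t) :
    quadCoeff η B β g t ≤ quadCoeff η B β g (t + 1) := by
  unfold quadCoeff
  rw [Finset.sum_Ico_succ_top ht]
  gcongr
  linarith [sq_nonneg (g t 0)]

/-- The term $1/\eta$ gives $0.7$ because $\eta<1.42$; the term $B^2$ dominates $(B/\eta)^2$. -/
theorem le_quadCoeff (hη : 1 ≤ η) (hη2 : η * η < 2) (hβ : 0 ≤ β) (t : ℕ) :
    (B / η) ^ 2 + 0.7 ≤ quadCoeff η B β g t := by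
  have hη0 : 0 < η := by linarith
  have h1 := mul_nonneg hβ (Finset.sum_nonneg fun s (_ : s ∈ Finset.Ico 1 t) => sq_nonneg (g s 0))
  have h2 : η ≤ 1.42 := by nlinarith only [hη2, hη]
  have h3 : (B / η) ^ 2 * η ≤ B ^ 2 * η := by
    rw [div_pow]
    gcongr
    exact div_le_self (sq_nonneg B) (by nlinarith only [hη])
  rw [quadCoeff, le_div_iff₀ hη0]
  linarith

theorem phiGrad_sub_one (hη : 0 < η) (t : ℕ) {x y : E 1} (hx : ‖x‖ < 1) (hy : ‖y‖ < 1) :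
    phiGrad 1 η B β g w t y 0 - phiGrad 1 η B β g w t x 0
      = η * (barrierGrad (y 0) - barrierGrad (x 0) + quadCoeff η B β g t * (y 0 - x 0)) := by
  have h := congrArg (fun v : E 1 => v 0) (quadHess_apply_sub η B β g w t x (y - x))
  simp only [add_sub_cancel, PiLp.sub_apply, PiLp.add_apply, PiLp.smul_apply, smul_eq_mul,
    quadHess_one hη, ballGrad_one hx, ballGrad_one hy] at h
  rw [h]
  push_cast
  ring

theorem scaledGrad_succ (hη : 0 < η) {t : ℕ} (ht : 1 ≤ t) (hw : ‖w t‖ < 1)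
    (hw' : ‖w (t + 1)‖ < 1) : scaledGrad η B β g w (t + 1)
      = nextGrad (quadCoeff η B β g (t + 1)) (w t 0) (w (t + 1) 0) (scaledGrad η B β g w t)
        (g t 0 / η) := by
  have h1 := phiGrad_sub_one (B := B) (β := β) (g := g) (w := w) hη (t + 1) hw hw'
  rw [phiGrad_succ_self η B β g w ht, PiLp.add_apply] at h1
  have h2 : phiGrad 1 η B β g w (t + 1) (w (t + 1)) 0
      = phiGrad 1 η B β g w t (w t) 0 + g t 0 + η * (barrierGrad (w (t + 1) 0)
        - barrierGrad (w t 0) + quadCoeff η B β g (t + 1) * (w (t + 1) 0 - w t 0)) := by linarith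
  rw [scaledGrad, h2, nextGrad, scaledGrad]
  field_simp
  ring

theorem scalarStep_of_run (hT : 1 ≤ T) (hη : 1 ≤ η) (hη2 : η * η < 2)
    (hB : 0 < B) (hβ : 0 < β) (hc : c ∈ Set.Ioo (0 : ℝ) 1)
    (hrun : IsRun 1 η B β c T rule g u w) {t : ℕ} (ht : t ∈ Finset.Icc 1 T)
    (hg : ‖g t‖ ≤ B) (hw : ‖w t‖ < 1) (hu : LandmarkClose c (u t) (w t)) :
    ScalarStep (neumannError 1 η B β c T) (B / η) (quadCoeff η B β g (t + 1)) (w t 0)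
      (w (t + 1) 0) (scaledGrad η B β g w t) (g t 0 / η) := by
  have hη0 : 0 < η := by linarith
  obtain ⟨hε0, hε1, -⟩ := neumannError_bounds (d := 1) le_rfl hT hη hB hβ hc
  have hk := le_quadCoeff (B := B) (g := g) hη hη2 hβ.le (t + 1)
  refine ⟨mem_Ioo_of_norm_lt hw, hε0, hε1, by positivity, hk, ?_, ?_⟩
  · rw [abs_div, abs_of_pos hη0, ← norm_one_eq]
    gcongr
  · have h1 := abs_inner_step_residual_le le_rfl hη hβ hc hrun ht hw hu
      (EuclideanSpace.single 0 1)
    have hH := barrierHess_nonneg (w t 0)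
    have hh : 0 ≤ barrierHess (w t 0) + quadCoeff η B β g (t + 1) := by
      have := sq_nonneg (B / η)
      linarith
    have h2 : (psiHess 1 η (w t) + quadHess 1 η B β g (t + 1)) (w (t + 1) - w t) 0
        = η * ((barrierHess (w t 0) + quadCoeff η B β g (t + 1)) * (w (t + 1) 0 - w t 0)) := by
      have h3 := inner_psiHess_self η (w t) (EuclideanSpace.single (0 : Fin 1) (1 : ℝ))
      have h4 : psiHess 1 η (w t) (w (t + 1) - w t)
          = (w (t + 1) 0 - w t 0) • psiHess 1 η (w t) (EuclideanSpace.single 0 1) := by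
        rw [← map_smul]
        congr 1
        ext i
        fin_cases i
        simp
      rw [add_apply, PiLp.add_apply, quadHess_one hη0, h4, PiLp.smul_apply]
      rw [ballHess_one hw, inner_one] at h3
      simp only [PiLp.single_apply, if_true, one_mul] at h3
      rw [h3, PiLp.sub_apply]
      push_cast
      simp only [smul_eq_mul]
      ring
    rw [inner_one, PiLp.add_apply, h2, phiGrad_succ_self η B β g w (Finset.mem_Icc.mp ht).1,
      PiLp.add_apply, phiForm_one hη0 _ hw, phiForm_one hη0 _ hw, PiLp.sub_apply] at h1
    simp only [PiLp.single_apply, if_true, one_pow, mul_one] at h1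
    rw [← Real.sqrt_mul (by positivity)] at h1
    have h5 : η * ((barrierHess (w t 0) + quadCoeff η B β g (t + 1)) * (w (t + 1) 0 - w t 0) ^ 2)
        * (η * (barrierHess (w t 0) + quadCoeff η B β g (t + 1)))
        = (η * ((barrierHess (w t 0) + quadCoeff η B β g (t + 1)) * |w (t + 1) 0 - w t 0|)) ^ 2 := by
      rw [mul_pow, mul_pow, sq_abs]
      ring
    rw [h5, Real.sqrt_sq (by positivity)] at h1
    have h6 : phiGrad 1 η B β g w t (w t) 0 + g t 0
        + η * ((barrierHess (w t 0) + quadCoeff η B β g (t + 1)) * (w (t + 1) 0 - w t 0))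
        = η * (scaledGrad η B β g w t + g t 0 / η
          + (barrierHess (w t 0) + quadCoeff η B β g (t + 1)) * (w (t + 1) 0 - w t 0)) := by
      rw [scaledGrad]
      field_simp
    rw [h6, abs_mul, abs_of_pos hη0] at h1
    refine le_of_mul_le_mul_left (h1.trans (le_of_eq ?_)) hη0
    ring

/-- The Newton decrement in one dimension. -/
theorem newtonDecrement_one_dim (hη : 0 < η) (hβ : 0 ≤ β) {t : ℕ} (hw : ‖w t‖ < 1)
    (hh : 0 < barrierHess (w t 0) + quadCoeff η B β g t) :
    newtonDecrement (w t) (Phi 1 η B β g w t) * √(barrierHess (w t 0) + quadCoeff η B β g t)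
      = √η * |scaledGrad η B β g w t| := by
  have hs : 0 < √(barrierHess (w t 0) + quadCoeff η B β g t) := Real.sqrt_pos.mpr hh
  have hsη := Real.sqrt_pos.mpr hη
  have hsη2 := Real.mul_self_sqrt hη.le
  have hgrad : phiGrad 1 η B β g w t (w t) 0 = η * scaledGrad η B β g w t := by
    rw [scaledGrad, mul_div_cancel₀ _ hη.ne']
  have hform : ∀ v : E 1, √(phiForm 1 η B β g t (w t) v)
      = √η * (√(barrierHess (w t 0) + quadCoeff η B β g t) * |v 0|) := fun v => by
    rw [phiForm_one hη _ hw, Real.sqrt_mul hη.le, Real.sqrt_mul hh.le, Real.sqrt_sq_eq_abs]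
  apply le_antisymm
  · rw [← le_div_iff₀ hs]
    refine newtonDecrement_Phi_le hη.le hβ le_rfl g w t hw (by positivity) fun v => ?_
    rw [inner_one, hgrad, hform]
    calc η * scaledGrad η B β g w t * v 0 ≤ η * (|scaledGrad η B β g w t| * |v 0|) := by
          rw [mul_assoc, ← abs_mul]
          gcongr
          exact le_abs_self _
      _ = √η * √η * (|scaledGrad η B β g w t| * |v 0|) := by rw [hsη2]
      _ = _ := by field_simp
  · have hkey : ∀ a : ℝ, |a| = 1 → η * (scaledGrad η B β g w t * a)
        ≤ newtonDecrement (w t) (Phi 1 η B β g w t)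
          * (√η * √(barrierHess (w t 0) + quadCoeff η B β g t)) := fun a ha => by
      have h1 := inner_phiGrad_le (B := B) hη.le hβ le_rfl g w t hw (EuclideanSpace.single 0 a)
      rw [inner_one, hgrad, hform] at h1
      simp only [PiLp.single_apply, if_true, ha, mul_one] at h1
      linarith
    have h2 : η * |scaledGrad η B β g w t| ≤ newtonDecrement (w t) (Phi 1 η B β g w t)
        * (√η * √(barrierHess (w t 0) + quadCoeff η B β g t)) := by
      rcases abs_cases (scaledGrad η B β g w t) with ⟨h, -⟩ | ⟨h, -⟩ <;> rw [h]
      · simpa using hkey 1 (by simp)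
      · simpa using hkey (-1) (by simp)
    refine le_of_mul_le_mul_left ?_ hsη
    rw [← mul_assoc, hsη2]
    linarith

end OneDimensional

end OQNS

namespace OQNS

/-! ### The regime $d=1$, $\eta^2<2$. -/

section LargeCurvature

variable {η B β c : ℝ} {T : ℕ} {rule : LandmarkRule} {g u w : ℕ → E 1}

/-- The invariant of the run when `d = 1` and `η² < 2`. -/
structure LargeCurvature (η B β c : ℝ) (g u w : ℕ → E 1) (t : ℕ) : Prop where
  norm_lt : ‖w t‖ < 1
  close : LandmarkClose c (u t) (w t)
  inv : ScalarInv (B / η) (w t 0) (scaledGrad η B β g w t)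

theorem scaledGrad_one (hw1 : w 1 = 0) : scaledGrad η B β g w 1 = 0 := by
  rw [scaledGrad, hw1, phiGrad_one_zero]
  simp

theorem largeCurvature_one (hη : 0 < η) (hB : 0 < B) (hrun : IsRun 1 η B β c T rule g u w) :
    LargeCurvature η B β c g u w 1 := by
  refine ⟨by simp [hrun.w_one], ?_, ?_⟩
  · rw [hrun.u_one, hrun.w_one]
    exact landmarkClose_self (by simp)
  · rw [scaledGrad_one hrun.w_one, hrun.w_one]
    have : 0 < B / η := by positivity
    exact ⟨by rw [abs_zero]; positivity, fun h => by simp at h, fun h => by simp at h⟩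

theorem LargeCurvature.succ (hT : 1 ≤ T) (hη : 1 ≤ η) (hη2 : η * η < 2)
    (hB : 0 < B) (hβ : 0 < β) (hc : c ∈ Set.Ioo (0 : ℝ) 1)
    (hrule : rule = LandmarkRule.oldLandmark → c ≤ 1 / 3)
    (hrun : IsRun 1 η B β c T rule g u w) {t : ℕ} (ht : t ∈ Finset.Icc 1 T)
    (hg : ‖g t‖ ≤ B) (h : LargeCurvature η B β c g u w t) :
    LargeCurvature η B β c g u w (t + 1) := by
  have hη0 : 0 < η := by linarith
  obtain ⟨h1, h2⟩ := (scalarStep_of_run hT hη hη2 hB hβ hc hrun ht hg h.norm_lt h.close).inv h.inv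
  have hw' := norm_lt_of_mem_Ioo h1
  refine ⟨hw', landmarkClose_succ hc hrule hrun ht h.close.norm_lt hw', ?_⟩
  rwa [scaledGrad_succ hη0 (Finset.mem_Icc.mp ht).1 h.norm_lt hw']

theorem hess_add_quadCoeff_pos (hη : 1 ≤ η) (hη2 : η * η < 2) (hβ : 0 ≤ β) (t : ℕ) (x : ℝ) :
    0 < barrierHess x + quadCoeff η B β g t := by
  have := le_quadCoeff (B := B) (g := g) hη hη2 hβ t
  linarith [barrierHess_nonneg x, sq_nonneg (B / η)]

theorem LargeCurvature.goodIterate (hη : 1 ≤ η) (hη2 : η * η < 2)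
    (hB : 0 < B) (hβ : 0 < β) {t : ℕ} (h : LargeCurvature η B β c g u w t) :
    GoodIterate 1 η B β c g u w t := by
  have hη0 : 0 < η := by linarith
  have hk := le_quadCoeff (B := B) (g := g) hη hη2 hβ.le t
  have hh := hess_add_quadCoeff_pos (B := B) (g := g) hη hη2 hβ.le t (w t 0)
  have hl := newtonDecrement_one_dim hη0 hβ.le h.norm_lt hh
  have hs := Real.sqrt_pos.mpr hh
  have hs2 := Real.sq_sqrt hh.le
  have hsη := Real.sqrt_pos.mpr hη0
  have hsη2 := Real.sq_sqrt hη0.le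
  have hb0 : 0 < B / η := by positivity
  have hF := barrierHess_nonneg (w t 0)
  have he := h.inv.abs_le
  refine ⟨h.norm_lt, h.close, ?_, fun x hx => ?_⟩
  · rw [le_div_iff₀ hsη]
    refine le_of_mul_le_mul_right ?_ hs
    have h1 : η * |scaledGrad η B β g w t| ≤ √(barrierHess (w t 0) + quadCoeff η B β g t) := by
      apply Real.le_sqrt_of_sq_le
      have h2 : |scaledGrad η B β g w t| ^ 2 ≤ (0.65 * (B / η)) ^ 2 :=
        pow_le_pow_left₀ (abs_nonneg _) he 2
      have h3 : η ^ 2 * |scaledGrad η B β g w t| ^ 2 ≤ 2 * (0.65 * (B / η)) ^ 2 :=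
        mul_le_mul (by nlinarith only [hη2]) h2 (sq_nonneg _) (by norm_num)
      nlinarith only [h3, hk, hF, sq_nonneg (B / η)]
    calc _ = √η * (newtonDecrement (w t) (Phi 1 η B β g w t)
          * √(barrierHess (w t 0) + quadCoeff η B β g t)) := by ring
      _ = √η ^ 2 * |scaledGrad η B β g w t| := by rw [hl]; ring
      _ ≤ _ := by rw [hsη2, one_mul]; exact h1
  · have hx1 : ‖x‖ < 1 := by simpa using hx.1
    have h1 := phiGrad_sub_one (B := B) (β := β) (g := g) (w := w) hη0 t hx1 h.norm_lt
    rw [phiGrad_eq_zero_of_isFTRL hx, PiLp.zero_apply, sub_zero] at h1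
    have h2 : scaledGrad η B β g w t = barrierGrad (w t 0) - barrierGrad (x 0)
        + quadCoeff η B β g t * (w t 0 - x 0) := by
      rw [scaledGrad, h1, mul_div_cancel_left₀ _ hη0.ne']
    have hwI := mem_Ioo_of_norm_lt h.norm_lt
    have hxI := mem_Ioo_of_norm_lt hx1
    have hkb : (B / η) ^ 2 ≤ quadCoeff η B β g t := by linarith
    have hgap : (barrierHess (w t 0) + quadCoeff η B β g t) * |w t 0 - x 0|
        ≤ 2 * |scaledGrad η B β g w t| := by
      rcases le_total (x 0) (w t 0) with hle | hle
      · rw [abs_of_nonneg (sub_nonneg.mpr hle)]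
        have h3 := scalar_gap_le hwI hxI hle hkb
          ((le_abs_self _).trans (he.trans (by linarith))) h2
        linarith [le_abs_self (scaledGrad η B β g w t)]
      · rw [abs_of_nonpos (sub_nonpos.mpr hle)]
        have h3 := scalar_gap_le (b := B / η) (e := -scaledGrad η B β g w t)
          (k := quadCoeff η B β g t) (x := -w t 0) (y := -x 0)
          ⟨by linarith [hwI.2], by linarith [hwI.1]⟩
          ⟨by linarith [hxI.2], by linarith [hxI.1]⟩ (neg_le_neg hle) hkb
          ((neg_le_abs _).trans (he.trans (by linarith)))
          (by rw [barrierGrad_neg, barrierGrad_neg, h2]; ring)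
        rw [barrierHess_neg] at h3
        have h4 := neg_le_abs (scaledGrad η B β g w t)
        calc _ = (barrierHess (w t 0) + quadCoeff η B β g t) * (-w t 0 - -x 0) := by ring
          _ ≤ _ := h3
          _ ≤ _ := by linarith
    rw [phiForm_one hη0 t h.norm_lt, Real.sqrt_mul hη0.le, Real.sqrt_mul hh.le,
      Real.sqrt_sq_eq_abs, PiLp.sub_apply]
    refine le_of_mul_le_mul_right ?_ hs
    calc _ = √η * (√(barrierHess (w t 0) + quadCoeff η B β g t) ^ 2 * |w t 0 - x 0|) := by ring
      _ ≤ √η * (2 * |scaledGrad η B β g w t|) := by rw [hs2]; gcongr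
      _ = 2 * (√η * |scaledGrad η B β g w t|) := by ring
      _ = _ := by rw [← hl]; ring

/-- The squared Newton decrement, relative to `η`. -/
noncomputable def sqDecrement (η B β : ℝ) (g w : ℕ → E 1) (t : ℕ) : ℝ :=
  scaledGrad η B β g w t ^ 2 / (barrierHess (w t 0) + quadCoeff η B β g t)

theorem LargeCurvature.energy (hT : 1 ≤ T) (hη : 1 ≤ η) (hη2 : η * η < 2)
    (hB : 0 < B) (hβ : 0 < β) (hc : c ∈ Set.Ioo (0 : ℝ) 1)
    (hrun : IsRun 1 η B β c T rule g u w) {t : ℕ} (ht : t ∈ Finset.Icc 1 T)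
    (hg : ‖g t‖ ≤ B) (h : LargeCurvature η B β c g u w t) :
    ScalarEnergy (neumannError 1 η B β c T) (quadCoeff η B β g (t + 1)) (w t 0)
      (w (t + 1) 0) (scaledGrad η B β g w t) (g t 0 / η) :=
  (scalarStep_of_run hT hη hη2 hB hβ hc hrun ht hg h.norm_lt h.close).energy h.inv

theorem LargeCurvature.potential (hT : 1 ≤ T) (hη : 1 ≤ η) (hη2 : η * η < 2)
    (hB : 0 < B) (hβ : 0 < β) (hc : c ∈ Set.Ioo (0 : ℝ) 1)
    (hrun : IsRun 1 η B β c T rule g u w) {t : ℕ} (ht : t ∈ Finset.Icc 1 T)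
    (hg : ‖g t‖ ≤ B) {q : ℝ} (hq0 : 0 ≤ q)
    (hq : ∀ v, inner ℝ (g t) v ^ 2
      ≤ q * (‖v‖ ^ 2 + β * ∑ s ∈ Finset.Ico 1 (t + 1), inner ℝ (g s) v ^ 2))
    (h : LargeCurvature η B β c g u w t) (h' : LargeCurvature η B β c g u w (t + 1)) :
    |scaledGrad η B β g w (t + 1)| / √(barrierHess (w (t + 1) 0) + quadCoeff η B β g (t + 1))
        + 7 / 2 * sqDecrement η B β g w (t + 1)
      ≤ (8 / 3 * (q / η) + 100 * neumannError 1 η B β c T ^ 2) + 7 / 2 * sqDecrement η B β g w t ∧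
    (ballHess (w t) (w (t + 1) - w t) + ballHess (w (t + 1)) (w (t + 1) - w t))
        + 14 * sqDecrement η B β g w (t + 1)
      ≤ 8 * (q / η) + 14 * sqDecrement η B β g w t := by
  have hη0 : 0 < η := by linarith
  have ht1 := (Finset.mem_Icc.mp ht).1
  have hE := h.energy hT hη hη2 hB hβ hc hrun ht hg
  have hh := hess_add_quadCoeff_pos (B := B) (g := g) hη hη2 hβ.le t (w t 0)
  have hhs := hess_add_quadCoeff_pos (B := B) (g := g) hη hη2 hβ.le (t + 1) (w t 0)
  have hh' := hess_add_quadCoeff_pos (B := B) (g := g) hη hη2 hβ.le (t + 1) (w (t + 1) 0)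
  have hk : 0 < quadCoeff η B β g (t + 1) := by
    have := le_quadCoeff (B := B) (g := g) hη hη2 hβ.le (t + 1)
    linarith [sq_nonneg (B / η)]
  have hL : 0 ≤ sqDecrement η B β g w t := div_nonneg (sq_nonneg _) hh.le
  have he : scaledGrad η B β g w t ^ 2
      ≤ (barrierHess (w t 0) + quadCoeff η B β g (t + 1)) * sqDecrement η B β g w t := by
    have h1 : scaledGrad η B β g w t ^ 2
        = (barrierHess (w t 0) + quadCoeff η B β g t) * sqDecrement η B β g w t := by
      rw [sqDecrement, mul_div_cancel₀ _ hh.ne']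
    rw [h1]
    gcongr
    exact quadCoeff_mono hη0 hβ.le ht1
  have hgq : (g t 0 / η) ^ 2 ≤ quadCoeff η B β g (t + 1) * (q / η) := by
    have h1 := hq (EuclideanSpace.single 0 1)
    simp only [inner_one, norm_sq_one, PiLp.single_apply, if_true, mul_one, one_pow] at h1
    have h2 : 1 + β * ∑ s ∈ Finset.Ico 1 (t + 1), g s 0 ^ 2
        ≤ η * quadCoeff η B β g (t + 1) := by
      rw [quadCoeff, mul_div_cancel₀ _ hη0.ne']
      have : 0 ≤ B ^ 2 * η := by positivity
      linarith
    rw [div_pow, div_le_iff₀ (by positivity)]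
    calc g t 0 ^ 2 ≤ q * (η * quadCoeff η B β g (t + 1)) := h1.trans (by gcongr)
      _ = _ := by field_simp
  have hnext : sqDecrement η B β g w (t + 1)
      ≤ 0.4141 * (barrierHess (w t 0) * (w (t + 1) 0 - w t 0) ^ 2) + 0.0045
        * ((barrierHess (w t 0) + quadCoeff η B β g (t + 1)) * (w (t + 1) 0 - w t 0) ^ 2) := by
    rw [sqDecrement, div_le_iff₀ hh', scaledGrad_succ hη0 ht1 h.norm_lt h'.norm_lt, mul_comm]
    exact hE.sq_grad_le
  have habs : |scaledGrad η B β g w (t + 1)|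
        / √(barrierHess (w (t + 1) 0) + quadCoeff η B β g (t + 1))
      ≤ barrierHess (w t 0) * (w (t + 1) 0 - w t 0) ^ 2 + 0.01
        * ((barrierHess (w t 0) + quadCoeff η B β g (t + 1)) * (w (t + 1) 0 - w t 0) ^ 2)
        + 100 * neumannError 1 η B β c T ^ 2 := by
    rw [div_le_iff₀ (Real.sqrt_pos.mpr hh'), scaledGrad_succ hη0 ht1 h.norm_lt h'.norm_lt,
      mul_comm]
    exact hE.abs_grad_le
  have hx0 : 0 ≤ barrierHess (w t 0) * (w (t + 1) 0 - w t 0) ^ 2 :=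
    mul_nonneg (barrierHess_nonneg _) (sq_nonneg _)
  have hy0 : 0 ≤ quadCoeff η B β g (t + 1) * (w (t + 1) 0 - w t 0) ^ 2 := by positivity
  have hZ : (barrierHess (w t 0) + quadCoeff η B β g (t + 1)) * (w (t + 1) 0 - w t 0) ^ 2
      = barrierHess (w t 0) * (w (t + 1) 0 - w t 0) ^ 2
        + quadCoeff η B β g (t + 1) * (w (t + 1) 0 - w t 0) ^ 2 := by ring
  have hpot : ∀ C κ N : ℝ, 0 < C → 0 < κ →
      N * ((quadCoeff η B β g (t + 1) * (w (t + 1) 0 - w t 0) ^ 2) / C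
        + (barrierHess (w t 0) + quadCoeff η B β g (t + 1)) * (w (t + 1) 0 - w t 0) ^ 2 / κ)
      ≤ 0.9933 * ((barrierHess (w t 0) + quadCoeff η B β g (t + 1))
        * (w (t + 1) 0 - w t 0) ^ 2) ^ 2 → (w (t + 1) 0 = w t 0 → N ≤ 0) →
      N ≤ C * (q / η) + κ * sqDecrement η B β g w t := fun C κ N hC hκ hN hN0 =>
    hE.potential hk hC hκ (by positivity) hL hgq he hN hN0
  have hx' := hE.next_length_le
  rw [ballHess_one h.norm_lt, ballHess_one h'.norm_lt, PiLp.sub_apply]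
  rw [hZ] at hnext habs
  simp only [hZ] at hpot
  have hzero : w (t + 1) 0 = w t 0 → barrierHess (w t 0) * (w (t + 1) 0 - w t 0) ^ 2 = 0
      ∧ quadCoeff η B β g (t + 1) * (w (t + 1) 0 - w t 0) ^ 2 = 0 := fun h0 => by
    rw [h0]; simp
  generalize barrierHess (w t 0) * (w (t + 1) 0 - w t 0) ^ 2 = x at *
  generalize quadCoeff η B β g (t + 1) * (w (t + 1) 0 - w t 0) ^ 2 = y at *
  have hxy := mul_nonneg hx0 hy0
  constructor
  -- With $x$ and $y$ the barrier and quadratic parts of the energy, $N$ is the decrement bound plus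
  -- the new potential: $1+\tfrac72\cdot 0.4141$ rounds up to $2.4494$, and $0.01+\tfrac72\cdot
  -- 0.0045=0.02575$.
  · have := hpot (8 / 3) (7 / 2) (2.4494 * x + 0.02575 * (x + y)) (by norm_num) (by norm_num)
      (by nlinarith only [hxy, sq_nonneg x, sq_nonneg y, sq_nonneg (x - y)]) (fun h0 => by
        rw [(hzero h0).1, (hzero h0).2]; norm_num)
    linarith
  -- Here $11.3274=1+4.53+14\cdot 0.4141$ and $0.063=14\cdot 0.0045$.
  · have := hpot 8 14 (11.3274 * x + 0.063 * (x + y)) (by norm_num) (by norm_num)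
      (by nlinarith only [hxy, sq_nonneg x, sq_nonneg y, sq_nonneg (x - y)]) (fun h0 => by
        rw [(hzero h0).1, (hzero h0).2]; norm_num)
    linarith

theorem stableRun_of_lt_two (hT : 1 ≤ T) (hη : 1 ≤ η) (hη2 : η * η < 2)
    (hB : 0 < B) (hβ : 0 < β) (hc : c ∈ Set.Ioo (0 : ℝ) 1)
    (hrule : rule = LandmarkRule.oldLandmark → c ≤ 1 / 3)
    (hg : ∀ t ∈ Finset.Icc 1 T, ‖g t‖ ≤ B)
    (hrun : IsRun 1 η B β c T rule g u w) : StableRun 1 η B β c T g u w := by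
  have hη0 : 0 < η := by linarith
  have hT0 : (0 : ℝ) < T := by exact_mod_cast hT
  obtain ⟨hε0, hε1, hε2⟩ := neumannError_bounds (d := 1) le_rfl hT hη hB hβ hc
  obtain ⟨q, hq0, hq, hqsum⟩ := exists_elliptical_bound le_rfl hβ g T hg
  have hinv : ∀ t, t + 1 ∈ Finset.Icc 1 (T + 1) → LargeCurvature η B β c g u w (t + 1) := by
    intro t
    induction t with
    | zero => exact fun _ => largeCurvature_one hη0 hB hrun
    | succ n ih =>
      intro ht
      have hn : n + 1 ∈ Finset.Icc 1 T := by simp at ht ⊢; omega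
      exact (ih (by simp at ht ⊢; omega)).succ hT hη hη2 hB hβ hc hrule hrun hn (hg _ hn)
  have hinv' : ∀ t ∈ Finset.Icc 1 (T + 1), LargeCurvature η B β c g u w t := fun t ht => by
    have h1 := (Finset.mem_Icc.mp ht).1
    have := hinv (t - 1) (by rwa [Nat.sub_add_cancel h1])
    rwa [Nat.sub_add_cancel h1] at this
  have hT' : ∀ t ∈ Finset.Icc 1 T, t ∈ Finset.Icc 1 (T + 1) := fun t ht => by
    simp at ht ⊢; omega
  have hT1 : ∀ t ∈ Finset.Icc 1 T, t + 1 ∈ Finset.Icc 1 (T + 1) := fun t ht => by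
    simp at ht ⊢; omega
  have hpot := fun t (ht : t ∈ Finset.Icc 1 T) => (hinv' t (hT' t ht)).potential hT hη hη2 hB hβ
    hc hrun ht (hg t ht) (hq0 t) (fun v => hq t v (Finset.mem_Icc.mp ht).1)
    (hinv' (t + 1) (hT1 t ht))
  have hL1 : sqDecrement η B β g w 1 = 0 := by
    rw [sqDecrement, scaledGrad_one hrun.w_one]
    simp
  have hLT : 0 ≤ sqDecrement η B β g w (T + 1) :=
    div_nonneg (sq_nonneg _) (hess_add_quadCoeff_pos hη hη2 hβ.le _ _).le
  refine ⟨fun t ht => (hinv' t ht).goodIterate hη hη2 hB hβ, fun t ht => ?_, ?_, ?_⟩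
  · rw [ballHess_one (hinv' t (hT' t ht)).norm_lt, PiLp.sub_apply]
    exact ((hinv' t (hT' t ht)).energy hT hη hη2 hB hβ hc hrun ht (hg t ht)).length_le_one
  · have h1 := sum_le_of_potential (pot := fun t => 7 / 2 * sqDecrement η B β g w t) T
      fun t ht => (hpot t ht).1
    simp only [hL1] at h1
    rw [Finset.sum_add_distrib, Finset.sum_const, Nat.card_Icc, Nat.add_sub_cancel, nsmul_eq_mul,
      ← Finset.mul_sum, ← Finset.sum_div] at h1
    have h2 : ∑ t ∈ Finset.Icc 1 T, newtonDecrement (w (t + 1)) (Phi 1 η B β g w (t + 1))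
        = √η * ∑ t ∈ Finset.Icc 1 T, |scaledGrad η B β g w (t + 1)|
          / √(barrierHess (w (t + 1) 0) + quadCoeff η B β g (t + 1)) := by
      rw [Finset.mul_sum]
      refine Finset.sum_congr rfl fun t ht => ?_
      have hh := hess_add_quadCoeff_pos (B := B) (g := g) hη hη2 hβ.le (t + 1) (w (t + 1) 0)
      rw [← mul_div_assoc, eq_div_iff (Real.sqrt_pos.mpr hh).ne']
      exact newtonDecrement_one_dim hη0 hβ.le (hinv' (t + 1) (hT1 t ht)).norm_lt hh
    rw [h2]
    push_cast at hqsum hε2 ⊢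
    rw [mul_one] at hε2 ⊢
    have hs1 : 1 ≤ √η := Real.one_le_sqrt.mpr hη
    have hs2 := Real.mul_self_sqrt hη0.le
    have h3 : ∑ t ∈ Finset.Icc 1 T, |scaledGrad η B β g w (t + 1)|
          / √(barrierHess (w (t + 1) 0) + quadCoeff η B β g (t + 1))
        ≤ 8 / 3 * ((1 / β * Real.log (1 + β * B ^ 2 * T / 1)) / η)
          + T * (100 * neumannError 1 η B β c T ^ 2) := by
      have h4 : (∑ t ∈ Finset.Icc 1 T, q t) / η
          ≤ (1 / β * Real.log (1 + β * B ^ 2 * T / 1)) / η := by gcongr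
      linarith
    have h5 : √η * (T * (100 * neumannError 1 η B β c T ^ 2)) ≤ 1 / 2 := by
      have h6 : √η ≤ η := by nlinarith only [hs1, hs2]
      have h7 : √η * (T * (100 * neumannError 1 η B β c T ^ 2))
          ≤ η * (T * (100 * neumannError 1 η B β c T ^ 2)) := by gcongr
      linarith
    have h6 : √η * (8 / 3 * ((1 / β * Real.log (1 + β * B ^ 2 * T / 1)) / η))
        = 1 / √η * (8 / 3 * (1 / β * Real.log (1 + β * B ^ 2 * T / 1))) := by
      rw [← hs2]
      have : 0 < √η := by linarith
      rw [Real.sqrt_mul_self this.le]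
      field_simp
    have h8 := mul_le_mul_of_nonneg_left h3 (Real.sqrt_nonneg η)
    rw [mul_add, h6] at h8
    linarith
  · have h1 := sum_le_of_potential (pot := fun t => 14 * sqDecrement η B β g w t) T
      fun t ht => (hpot t ht).2
    simp only [hL1] at h1
    rw [← Finset.mul_sum, ← Finset.sum_div] at h1
    push_cast at hqsum ⊢
    simp only [mul_one]
    have h2 : ∑ t ∈ Finset.Icc 1 T, (ballHess (w t) (w (t + 1) - w t)
        + ballHess (w (t + 1)) (w (t + 1) - w t)) ≤ 8 * ((∑ t ∈ Finset.Icc 1 T, q t) / η) := by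
      linarith
    simp only [← mul_add]
    rw [← Finset.mul_sum]
    calc _ ≤ η * (8 * ((∑ t ∈ Finset.Icc 1 T, q t) / η)) := by gcongr
      _ = 8 * ∑ t ∈ Finset.Icc 1 T, q t := by field_simp
      _ ≤ _ := by gcongr

end LargeCurvature

end OQNS

/-! ### Assembly of the two regimes. -/

theorem mainTheorem4 (d : ℕ) (hd : 1 ≤ d) (T : ℕ) (hT : 1 ≤ T)
    (η B β c : ℝ) (hη : 1 ≤ η) (hB : 0 < B) (hβ : β ∈ Set.Ioo (0 : ℝ) 1)
    (hc : c ∈ Set.Ioo (0 : ℝ) 1)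
    (rule : OQNS.LandmarkRule) (hrule : rule = OQNS.LandmarkRule.oldLandmark → c ≤ 1 / 3)
    (g u w x : ℕ → OQNS.E d)
    (hg : ∀ t ∈ Finset.Icc 1 T, ‖g t‖ ≤ B)
    (hrun : OQNS.IsRun d η B β c T rule g u w)
    (hx : ∀ t ∈ Finset.Icc 1 (T + 1), OQNS.IsFTRL d η B β g w t (x t)) :
    (∀ t ∈ Finset.Icc 1 (T + 1), w t ∈ Metric.ball (0 : OQNS.E d) 1) ∧
    (∀ t ∈ Finset.Icc 1 (T + 1),
      √(η * d) / 4 *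
          (OQNS.normIn (OQNS.hessian (OQNS.Phi d η B β g w t) (w t)) (w t - x t) - 2 / T)
        ≤ √(η * d) / 2 * (OQNS.newtonDecrement (w t) (OQNS.Phi d η B β g w t) - 1 / T) ∧
      √(η * d) / 2 * (OQNS.newtonDecrement (w t) (OQNS.Phi d η B β g w t) - 1 / T)
        ≤ OQNS.newtonDecrement (w (t - 1)) (OQNS.Phi d η B β g w t) ^ 2 ∧
      OQNS.newtonDecrement (w (t - 1)) (OQNS.Phi d η B β g w t) ^ 2 ≤ 4 / η) ∧
    (∑ t ∈ Finset.Icc 1 T,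
        OQNS.normIn (OQNS.hessian (OQNS.Phi d η B β g w t) (w t)) (w t - x t)
      ≤ 1 + 16 * √d / (3 * β * √η) * Real.log (d + B ^ 2 * T / d)) ∧
    (∑ t ∈ Finset.Icc 1 T, OQNS.normIn (OQNS.hessian (OQNS.Psi d η) (w t)) (w t - w (t - 1)) ^ 2
        + ∑ t ∈ Finset.Icc 1 T,
            OQNS.normIn (OQNS.hessian (OQNS.Psi d η) (w (t - 1))) (w t - w (t - 1)) ^ 2
      ≤ 8 * d * Real.log (d + B ^ 2 * T / d) / β) := by
  have hst : OQNS.StableRun d η B β c T g u w := by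
    by_cases h : 2 ≤ η * (η * d)
    · exact OQNS.stableRun_of_two_le hd hT hη h hB hβ.1 hc hrule hg hrun
    · push Not at h
      -- If $d\ge 2$ then $\eta\ge 1$ already gives $\eta^2d\ge 2$, so the second regime is
      -- one-dimensional.
      have hd1 : d = 1 := by
        by_contra h1
        have h2 : (2 : ℝ) ≤ d := by exact_mod_cast (by omega : 2 ≤ d)
        have h3 : 1 ≤ η * η := one_le_mul_of_one_le_of_one_le hη hη
        nlinarith only [h, h2, h3]
      subst hd1
      exact OQNS.stableRun_of_lt_two hT hη (by simpa using h) hB hβ.1 hc hrule hg hrun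
  refine ⟨fun t ht => by simpa using (hst.good t ht).norm_lt, fun t ht => ⟨?_,
    hst.decrement_chain hd hT hη hB hβ.1 hc hg hrun ht⟩, ?_,
    hst.sum_sq_step_le hd hη hβ hrun⟩
  · have h1 := (hst.good t ht).gap_le (x t) (hx t ht)
    rw [OQNS.normIn_hessian_Phi η B β g w t (hst.good t ht).norm_lt]
    have h2 := Real.sqrt_nonneg (η * d)
    have h3 : (2 : ℝ) / T = 2 * (1 / T) := by ring
    rw [h3]
    nlinarith only [mul_le_mul_of_nonneg_left h1 h2]
  · refine le_trans (le_of_eq (Finset.sum_congr rfl fun t ht => ?_))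
      (hst.sum_gap_le hd hη hβ hrun fun t ht => hx t (by simp at ht ⊢; omega))
    exact OQNS.normIn_hessian_Phi η B β g w t (hst.good t (by simp at ht ⊢; omega)).norm_lt _
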